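/- **Setting.** Let $E_0\in\mathbb R$, let $\beta\colon\mathbb R^2\to[0,\infty[$ be continuous with compact support and $\int_{\mathbb R^2}\beta=1$, and let $\alpha$ be either polytropic, $\alpha(E)=(E_0-E)_+^k$ with some $k>\tfrac12$, or of King type, $\alpha(E)=(e^{E_0-E}-1)_+$. Put $\varphi(E,\bar v)=\alpha(E)\beta(\bar v)$ and $\varphi'=\partial_E\varphi$. Consider a non-trivial plane symmetric steady state of the Vlasov–Poisson system with this ansatz: for $x\in\mathbb R$, $v=(v_1,\bar v)\in\mathbb R\times\mathbb R^2$, $$E(x,v_1)=\tfrac12v_1^2+U_0(x),\quad f_0(x,v)=\varphi(E(x,v_1),\bar v),\quad \rho_0(x)=\int_{\mathbb R^3}f_0(x,v)\,dv,\quad U_0(x)=2\pi\int_{\mathbb R}|x-y|\,\rho_0(y)\,dy,$$ where $\rho_0$ and $y\mapsto|x-y|\rho_0(y)$ (for all $x$) are integrable, $\int\rho_0>0$, and $f_0(x,v)=f_0(-x,-v_1,\bar v)$. For $U_0(0)<E\le E_0$ let $x_-(E)<0<x_+(E)$ be the solutions of $U_0(x)=E$ and $$T(E)=2\int_{x_-(E)}^{x_+(E)}\frac{dx}{\sqrt{2E-2U_0(x)}},\qquad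 T(U_0(0))=\frac{2\pi}{\sqrt{U_0''(0)}} .$$ **Operators.** Let $\bar\Omega_0=\{f_0\ne0\}\subset\mathbb R\times\mathbb R^3$ and let $\bar H$ be the real Hilbert space of measurable $g\colon\bar\Omega_0\to\mathbb R$ with $\|g\|_{\bar H}^2=\int_{\bar\Omega_0}|\varphi'(E,\bar v)|^{-1}|g|^2\,d(x,v)<\infty$. For $\xi\in C^1_c(\bar\Omega_0)$ let $\bar{\mathcal D}\xi=v_1\partial_x\xi-U_0'(x)\partial_{v_1}\xi$; $g\in\bar H$ belongs to $\mathrm D(\bar{\mathcal D})$ with $\bar{\mathcal D}g=h\in\bar H$ if $$\int_{\bar\Omega_0}\frac{g\,\bar{\mathcal D}\xi}{|\varphi'(E,\bar v)|}\,d(x,v)=-\int_{\bar\Omega_0}\frac{h\,\xi}{|\varphi'(E,\bar v)|}\,d(x,v)\quad\text{for all }\xi\in C^1_c(\bar\Omega_0).$$ Let $\mathrm D(\bar{\mathcal D}^2)=\{g\in\mathrm D(\bar{\mathcal D}):\bar{\mathcal D}g\in\mathrm D(\bar{\mathcal D})\}$. With $g$ extended by $0$, put $$(\bar{\mathcal B}g)(x,v)=4\pi\,|\varphi'(E(x,v_1),\bar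 v)|\,v_1\int_{\mathbb R^3}w_1\,g(x,w)\,dw,\qquad \bar{\mathcal A}=-\bar{\mathcal D}^2-\bar{\mathcal B}\ \text{ on }\mathrm D(\bar{\mathcal D}^2).$$ Let $\bar{\mathcal H}\subset\bar H$ be the subspace of functions that are odd in $x$ and odd in $v_1$ almost everywhere. The essential spectrum $\sigma_{ess}$ is the spectrum without the isolated eigenvalues of finite multiplicity. **Theorem.** $\bar{\mathcal B}$ is defined on all of $\bar H$, and $-\bar{\mathcal B}$ is relatively $(-\bar{\mathcal D}^2)$-compact, i.e. $-\bar{\mathcal D}^2$ has non-empty resolvent set and $\bar{\mathcal B}(-\bar{\mathcal D}^2-\lambda)^{-1}$ is compact for $\lambda$ in it. Moreover $$\sigma_{ess}(\bar{\mathcal A})=\sigma_{ess}(-\bar{\mathcal D}^2)=\Big\{\Big(\frac{2\pi k}{T(E)}\Big)^2 : k\in\mathbb N_0,\ U_0(0)\le E\le E_0\Big\}.$$ Furthermore $\bar{\mathcal A}$ maps $\mathrm D(\bar{\mathcal D}^2)\cap\bar{\mathcal H}$ into $\bar{\mathcal H}$, and the restriction $\bar{\mathcal A}|_{\bar{\mathcal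 H}}\colon\mathrm D(\bar{\mathcal D}^2)\cap\bar{\mathcal H}\to\bar{\mathcal H}$ satisfies $$\sigma_{ess}(\bar{\mathcal A}|_{\bar{\mathcal H}})=\Big\{4\pi^2\Big(\frac{2k}{T(E)}\Big)^2 : k\in\mathbb N,\ k\ge1,\ U_0(0)\le E\le E_0\Big\}.$$ -/

import Mathlib

open MeasureTheory Set
open scoped ENNReal

noncomputable section

/-! Unbounded operators on a real normed space: resolvent, spectrum, relative compactness. -/

namespace LinearPMap

variable {H : Type*} [NormedAddCommGroup H] [NormedSpace ℝ H]

/-- The composition `g ∘ f` of unbounded operators, on its natural domain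
`{x ∈ D(f) | f x ∈ D(g)}`. -/
def naturalComp (g f : H →ₗ.[ℝ] H) : H →ₗ.[ℝ] H where
  domain := (g.domain.comap f.toFun).map f.domain.subtype
  toFun :=
    { toFun := fun x => g ⟨f ⟨x.1, by
          obtain ⟨y, _, hy⟩ := x.2; rw [← hy]; exact y.2⟩, by
          obtain ⟨x, y, hy, rfl⟩ := x; exact hy⟩
      map_add' := fun x y => by
        rw [← LinearPMap.map_add]
        congr 1
        apply Subtype.ext
        exact f.toFun.map_add ⟨x.1, _⟩ ⟨y.1, _⟩
      map_smul' := fun c x => by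
        rw [RingHom.id_apply, ← LinearPMap.map_smul]
        congr 1
        apply Subtype.ext
        exact f.toFun.map_smul c ⟨x.1, _⟩ }

/-- The restriction of an unbounded operator to a subspace `K`, as an operator in `K`, with domain
`{x ∈ D(A) ∩ K | A x ∈ K}`; this is `D(A) ∩ K` when `A` maps `D(A) ∩ K` into `K`. -/
def restrictTo (A : H →ₗ.[ℝ] H) (K : Submodule ℝ H) : K →ₗ.[ℝ] K where
  domain := ((K.comap A.toFun).map A.domain.subtype).comap K.subtype
  toFun :=
    { toFun := fun x => ⟨A ⟨x.1.1, by
          obtain ⟨y, _, hy⟩ := x.2; rw [← Submodule.subtype_apply, ← hy]; exact y.2⟩, by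
          obtain ⟨x, y, hy, h⟩ := x
          have : (x : H) = y.1 := h.symm
          simp only [this]
          exact hy⟩
      map_add' := fun x y => Subtype.ext (A.toFun.map_add ⟨x.1.1, _⟩ ⟨y.1.1, _⟩)
      map_smul' := fun c x => Subtype.ext (A.toFun.map_smul c ⟨x.1.1, _⟩) }

/-- `R` is the bounded everywhere defined inverse of `A - lam : D(A) → H`. -/
def IsResolventAt (A : H →ₗ.[ℝ] H) (lam : ℝ) (R : H →L[ℝ] H) : Prop :=
  (∀ f : H, ∃ h : R f ∈ A.domain, A ⟨R f, h⟩ - lam • R f = f) ∧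
    ∀ g : A.domain, R (A g - lam • (g : H)) = g

/-- The resolvent set of `A`. -/
def resolventSet (A : H →ₗ.[ℝ] H) : Set ℝ := {lam | ∃ R : H →L[ℝ] H, A.IsResolventAt lam R}

/-- The spectrum of `A`. -/
def spectrum (A : H →ₗ.[ℝ] H) : Set ℝ := (A.resolventSet)ᶜ

/-- The kernel of `A - lam`. -/
def eigenspace (A : H →ₗ.[ℝ] H) (lam : ℝ) : Submodule ℝ A.domain :=
  LinearMap.ker (A.toFun - lam • A.domain.subtype)

/-- The discrete spectrum of a self-adjoint operator: the isolated points of the spectrum that are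
eigenvalues of finite multiplicity. -/
def discreteSpectrum (A : H →ₗ.[ℝ] H) : Set ℝ :=
  {lam | lam ∈ A.spectrum ∧ (∃ ε > 0, ∀ mu ∈ A.spectrum, |mu - lam| < ε → mu = lam) ∧
    A.eigenspace lam ≠ ⊥ ∧ FiniteDimensional ℝ (A.eigenspace lam)}

/-- The essential spectrum of a self-adjoint operator. -/
def essentialSpectrum (A : H →ₗ.[ℝ] H) : Set ℝ := A.spectrum \ A.discreteSpectrum

/-- `B` is relatively `A`-compact: `D(A) ⊆ D(B)`, the resolvent set of `A` is non-empty, and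
`B (A - lam)⁻¹` is a compact operator for the points `lam` of the resolvent set. -/
def IsRelativelyCompact (B A : H →ₗ.[ℝ] H) : Prop :=
  A.domain ≤ B.domain ∧ A.resolventSet.Nonempty ∧
    ∀ (lam : ℝ) (R : H →L[ℝ] H), A.IsResolventAt lam R →
      ∃ K : H →L[ℝ] H, IsCompactOperator K ∧ ∀ f : H, ∃ h : R f ∈ B.domain, B ⟨R f, h⟩ = K f

end LinearPMap

/-! Plane symmetric steady states of the Vlasov-Poisson system. -/

/-- Effective phase space `ℝ × ℝ³` of plane symmetry: points are `(x, v₁, v₂, v₃)`. -/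
abbrev PlanarPhaseSpace : Type := ℝ × ℝ × ℝ × ℝ

/-- An ansatz `φ(E, v̄) = α(E) β(v̄)` for a plane symmetric steady state, where `α` is polytropic
with exponent `k > 1/2` or of King type, with cut-off energy `E₀`. -/
structure PlanarAnsatz where
  E₀ : ℝ
  α : ℝ → ℝ
  β : ℝ × ℝ → ℝ
  polytrope_or_king :
    (∃ k : ℝ, 1 / 2 < k ∧ ∀ E, α E = if E < E₀ then (E₀ - E) ^ k else 0) ∨
      (∀ E, α E = max (Real.exp (E₀ - E) - 1) 0)
  continuous_β : Continuous β
  hasCompactSupport_β : HasCompactSupport β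
  β_nonneg : ∀ w, 0 ≤ β w
  integral_β : ∫ w, β w = 1

namespace PlanarAnsatz

variable (a : PlanarAnsatz)

/-- The phase space density `f(x, v) = φ(v₁² / 2 + U(x), v̄)`. -/
def phaseDensity (U : ℝ → ℝ) (z : PlanarPhaseSpace) : ℝ :=
  a.α (z.2.1 ^ 2 / 2 + U z.1) * a.β z.2.2

/-- The mass density `ρ(x) = ∫ f(x, v) dv`. -/
def massDensity (U : ℝ → ℝ) (x : ℝ) : ℝ := ∫ v : ℝ × ℝ × ℝ, a.phaseDensity U (x, v)

end PlanarAnsatz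

/-- A (non-trivial) plane symmetric steady state with the given ansatz: `U₀` is the potential
`U₀(x) = 2π ∫ |x - y| ρ₀(y) dy` of its own mass density `ρ₀`, the mass is finite and positive, and
`f₀(x, v) = f₀(-x, -v₁, v̄)`. -/
structure PlanarSteadyState extends PlanarAnsatz where
  U₀ : ℝ → ℝ
  symmetric : ∀ x v₁ v₂ v₃,
    toPlanarAnsatz.phaseDensity U₀ (-x, -v₁, v₂, v₃) =
      toPlanarAnsatz.phaseDensity U₀ (x, v₁, v₂, v₃)
  integrable_massDensity : Integrable (toPlanarAnsatz.massDensity U₀)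
  integrable_kernel : ∀ x, Integrable fun y => |x - y| * toPlanarAnsatz.massDensity U₀ y
  poisson : ∀ x, U₀ x = 2 * Real.pi * ∫ y, |x - y| * toPlanarAnsatz.massDensity U₀ y
  mass_pos : 0 < ∫ x, toPlanarAnsatz.massDensity U₀ x

namespace PlanarSteadyState

variable (S : PlanarSteadyState)

/-- The steady state distribution function `f₀`. -/
def f₀ : PlanarPhaseSpace → ℝ := S.phaseDensity S.U₀

/-- The particle energy `E(x, v₁) = v₁² / 2 + U₀(x)`. -/
def energy (z : PlanarPhaseSpace) : ℝ := z.2.1 ^ 2 / 2 + S.U₀ z.1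

/-- The phase space support `Ω₀ = {f₀ ≠ 0}`. -/
def Ω₀ : Set PlanarPhaseSpace := {z | S.f₀ z ≠ 0}

/-- `φ' = ∂φ/∂E`, evaluated at `(E(x, v₁), v̄)`. -/
def dφ (z : PlanarPhaseSpace) : ℝ := deriv S.α (S.energy z) * S.β z.2.2

/-- The measure `|φ'|⁻¹ d(x, v)` on `Ω₀`. -/
def weightMeasure : Measure PlanarPhaseSpace :=
  (volume.restrict S.Ω₀).withDensity fun z => ENNReal.ofReal (1 / |S.dφ z|)

/-- The weighted real Hilbert space `L²(Ω₀, |φ'|⁻¹ d(x, v))`. -/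
abbrev Hilb : Type := Lp ℝ 2 S.weightMeasure

/-- The transport operator `v₁ ∂ₓ ξ - U₀'(x) ∂_{v₁} ξ` on differentiable functions. -/
def classicalTransport (ξ : PlanarPhaseSpace → ℝ) (z : PlanarPhaseSpace) : ℝ :=
  z.2.1 * fderiv ℝ ξ z (1, 0, 0, 0) - deriv S.U₀ z.1 * fderiv ℝ ξ z (0, 1, 0, 0)

/-- Test functions: `C¹` functions with compact support in `Ω₀`. -/
def IsTest (ξ : PlanarPhaseSpace → ℝ) : Prop :=
  ContDiff ℝ 1 ξ ∧ HasCompactSupport ξ ∧ tsupport ξ ⊆ S.Ω₀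

/-! Elementary facts that make the operators below well defined. -/

theorem massDensity_nonneg (x : ℝ) : 0 ≤ S.massDensity S.U₀ x := by
  refine integral_nonneg fun v => mul_nonneg ?_ (S.β_nonneg _)
  rcases S.polytrope_or_king with ⟨k, _, h⟩ | h
  · rw [h]
    split_ifs with h1
    · exact Real.rpow_nonneg (by linarith) _
    · exact le_rfl
  · rw [h]; exact le_max_right _ _

theorem exists_lipschitz : ∃ C, LipschitzWith C S.U₀ := by
  refine ⟨Real.toNNReal (2 * Real.pi * ∫ x, S.massDensity S.U₀ x), ?_⟩
  refine LipschitzWith.of_dist_le' fun x y => ?_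
  rw [Real.dist_eq, Real.dist_eq, S.poisson x, S.poisson y, ← mul_sub,
    ← integral_sub (S.integrable_kernel x) (S.integrable_kernel y), abs_mul,
    abs_of_pos Real.two_pi_pos, mul_assoc (2 * Real.pi)]
  refine mul_le_mul_of_nonneg_left ?_ Real.two_pi_pos.le
  rw [mul_comm, ← integral_const_mul]
  refine (abs_integral_le_integral_abs).trans (integral_mono ?_ ?_ fun z => ?_)
  · exact ((S.integrable_kernel x).sub (S.integrable_kernel y)).abs
  · exact S.integrable_massDensity.const_mul _
  · simp only [← sub_mul, abs_mul, abs_of_nonneg (S.massDensity_nonneg z)]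
    refine mul_le_mul_of_nonneg_right ?_ (S.massDensity_nonneg z)
    have := abs_abs_sub_abs_le_abs_sub (x - z) (y - z)
    simpa using this

theorem continuous_U₀ : Continuous S.U₀ := S.exists_lipschitz.choose_spec.continuous

theorem continuous_energy : Continuous S.energy := by
  have := S.continuous_U₀
  unfold energy
  fun_prop

theorem continuous_α : Continuous S.α := by
  rcases S.polytrope_or_king with ⟨k, hk, h⟩ | h
  · have : S.α = fun E => (max (S.E₀ - E) 0) ^ k := by
      funext E
      rw [h]
      split_ifs with h1
      · rw [max_eq_left (by linarith)]
      · rw [max_eq_right (by linarith), Real.zero_rpow (by linarith)]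
    rw [this]
    exact (by fun_prop : Continuous fun E => max (S.E₀ - E) 0).rpow_const
      fun _ => Or.inr (by linarith)
  · rw [funext h]; fun_prop

theorem α_ne_zero_iff (E : ℝ) : S.α E ≠ 0 ↔ E < S.E₀ := by
  rcases S.polytrope_or_king with ⟨k, hk, h⟩ | h
  · rw [h]
    split_ifs with h1
    · simp [h1, (Real.rpow_pos_of_pos (sub_pos.2 h1) k).ne']
    · simp [h1]
  · rw [h]
    constructor
    · intro h1
      by_contra h2
      exact h1 (max_eq_right (by
        have := Real.exp_le_one_iff.2 (by linarith : S.E₀ - E ≤ 0); linarith))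
    · intro h1
      have := Real.one_lt_exp_iff.2 (by linarith : 0 < S.E₀ - E)
      exact (lt_max_of_lt_left (by linarith)).ne'

theorem deriv_α : ContinuousOn (deriv S.α) (Iio S.E₀) ∧ ∀ E < S.E₀, deriv S.α E < 0 := by
  rcases S.polytrope_or_king with ⟨k, hk, h⟩ | h
  · have key : ∀ E ∈ Iio S.E₀, deriv S.α E = -1 * k * (S.E₀ - E) ^ (k - 1) := by
      intro E hE
      have h1 : S.α =ᶠ[nhds E] fun E => (S.E₀ - E) ^ k := by
        filter_upwards [Iio_mem_nhds hE] with y hy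
        rw [h, if_pos (mem_Iio.1 hy)]
      rw [h1.deriv_eq]
      exact (((hasDerivAt_id E).const_sub S.E₀).rpow_const
        (Or.inl (sub_pos.2 hE).ne')).deriv
    refine ⟨ContinuousOn.congr ?_ key, fun E hE => ?_⟩
    · refine continuousOn_const.mul (ContinuousOn.rpow_const (by fun_prop) fun E hE => ?_)
      exact Or.inl (sub_pos.2 hE).ne'
    · rw [key E hE]
      have := Real.rpow_pos_of_pos (sub_pos.2 hE) (k - 1)
      nlinarith
  · have key : ∀ E ∈ Iio S.E₀, deriv S.α E = Real.exp (S.E₀ - E) * -1 := by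
      intro E hE
      have h1 : S.α =ᶠ[nhds E] fun E => Real.exp (S.E₀ - E) - 1 := by
        filter_upwards [Iio_mem_nhds hE] with y hy
        rw [h, max_eq_left]
        have := Real.one_lt_exp_iff.2 (sub_pos.2 hy)
        linarith
      rw [h1.deriv_eq]
      exact ((((hasDerivAt_id E).const_sub S.E₀).exp).sub_const 1).deriv
    refine ⟨ContinuousOn.congr (by fun_prop) key, fun E hE => ?_⟩
    rw [key E hE]
    have := Real.exp_pos (S.E₀ - E)
    linarith

theorem mem_Ω₀_iff (z : PlanarPhaseSpace) : z ∈ S.Ω₀ ↔ S.energy z < S.E₀ ∧ S.β z.2.2 ≠ 0 := by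
  rw [← S.α_ne_zero_iff]
  exact mul_ne_zero_iff

theorem isOpen_Ω₀ : IsOpen S.Ω₀ := by
  have h1 := S.continuous_α
  have h2 := S.continuous_energy
  have h3 := S.continuous_β
  have : Continuous S.f₀ :=
    (h1.comp h2).mul (h3.comp (by fun_prop : Continuous fun z : PlanarPhaseSpace => z.2.2))
  exact isOpen_ne_fun this continuous_const

theorem measurableSet_Ω₀ : MeasurableSet S.Ω₀ := S.isOpen_Ω₀.measurableSet

theorem dφ_ne_zero {z : PlanarPhaseSpace} (hz : z ∈ S.Ω₀) : S.dφ z ≠ 0 := by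
  rw [mem_Ω₀_iff] at hz
  exact mul_ne_zero (S.deriv_α.2 _ hz.1).ne hz.2

theorem continuousOn_dφ : ContinuousOn S.dφ S.Ω₀ := by
  refine ContinuousOn.mul (S.deriv_α.1.comp S.continuous_energy.continuousOn
    fun z hz => ((S.mem_Ω₀_iff z).1 hz).1) ?_
  have h3 := S.continuous_β
  exact (h3.comp (by fun_prop : Continuous fun z : PlanarPhaseSpace => z.2.2)).continuousOn

theorem measurable_dφ : Measurable S.dφ :=
  ((measurable_deriv S.α).comp S.continuous_energy.measurable).mul
    (S.continuous_β.measurable.comp (by fun_prop))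

theorem measurable_weight : Measurable fun z => ENNReal.ofReal (1 / |S.dφ z|) :=
  ENNReal.measurable_ofReal.comp (measurable_const.div S.measurable_dφ.abs)

/-- Null sets of the weighted measure are the Lebesgue null sets of `Ω₀`. -/
theorem ae_weightMeasure_iff {p : PlanarPhaseSpace → Prop} :
    (∀ᵐ z ∂S.weightMeasure, p z) ↔ ∀ᵐ z, z ∈ S.Ω₀ → p z := by
  rw [weightMeasure, ae_withDensity_iff S.measurable_weight,
    ae_restrict_iff' S.measurableSet_Ω₀]
  refine Filter.eventually_congr (Filter.Eventually.of_forall fun z => ?_)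
  refine forall_congr' fun hz => ?_
  have : ENNReal.ofReal (1 / |S.dφ z|) ≠ 0 := by
    rw [Ne, ENNReal.ofReal_eq_zero, not_le]
    exact one_div_pos.2 (abs_pos.2 (S.dφ_ne_zero hz))
  exact forall_prop_of_true this

theorem weightMeasure_lt_top {K : Set PlanarPhaseSpace} (hK : IsCompact K) (hKΩ : K ⊆ S.Ω₀) :
    S.weightMeasure K < ∞ := by
  have hc : ContinuousOn (fun z => 1 / |S.dφ z|) K :=
    continuousOn_const.div (S.continuousOn_dφ.mono hKΩ).abs
      fun z hz => abs_ne_zero.2 (S.dφ_ne_zero (hKΩ hz))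
  obtain ⟨C, hC⟩ := hK.exists_bound_of_continuousOn hc
  rw [weightMeasure, withDensity_apply _ hK.measurableSet]
  calc ∫⁻ z in K, ENNReal.ofReal (1 / |S.dφ z|) ∂(volume.restrict S.Ω₀)
      ≤ ∫⁻ _ in K, ENNReal.ofReal C ∂(volume.restrict S.Ω₀) := by
        refine setLIntegral_mono' hK.measurableSet fun z hz => ENNReal.ofReal_le_ofReal ?_
        exact (le_abs_self _).trans (hC z hz)
    _ = ENNReal.ofReal C * (volume.restrict S.Ω₀) K := by simp
    _ < ∞ := ENNReal.mul_lt_top ENNReal.ofReal_lt_top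
        ((Measure.restrict_apply_le _ _).trans_lt hK.measure_lt_top)

theorem memLp_of_compact {ξ : PlanarPhaseSpace → ℝ} (hξ : Measurable ξ) {C : ℝ}
    {K : Set PlanarPhaseSpace} (hK : IsCompact K) (hKΩ : K ⊆ S.Ω₀) (hC : ∀ z ∈ K, ‖ξ z‖ ≤ C)
    (h0 : ∀ z ∉ K, ξ z = 0) : MemLp ξ 2 S.weightMeasure := by
  have hi : K.indicator ξ = ξ := by
    rw [indicator_eq_self]
    intro z hz
    by_contra h
    exact hz (h0 z h)
  rw [← hi, memLp_indicator_iff_restrict hK.measurableSet]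
  have : IsFiniteMeasure (S.weightMeasure.restrict K) :=
    ⟨by simpa using S.weightMeasure_lt_top hK hKΩ⟩
  refine MemLp.of_bound hξ.aestronglyMeasurable C ?_
  filter_upwards [ae_restrict_mem hK.measurableSet] with z hz using hC z hz

theorem memLp_test {ξ : PlanarPhaseSpace → ℝ} (hξ : S.IsTest ξ) :
    MemLp ξ 2 S.weightMeasure := by
  obtain ⟨h1, h2, h3⟩ := hξ
  obtain ⟨C, hC⟩ := h2.exists_bound_of_continuousOn h1.continuous.continuousOn
  exact S.memLp_of_compact h1.continuous.measurable h2 h3 hC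
    fun z hz => image_eq_zero_of_notMem_tsupport hz

theorem memLp_transport_test {ξ : PlanarPhaseSpace → ℝ} (hξ : S.IsTest ξ) :
    MemLp (S.classicalTransport ξ) 2 S.weightMeasure := by
  obtain ⟨h1, h2, h3⟩ := hξ
  have hd : Continuous (fderiv ℝ ξ) := h1.continuous_fderiv one_ne_zero
  have c1 : Continuous fun z : PlanarPhaseSpace => z.2.1 * fderiv ℝ ξ z (1, 0, 0, 0) := by
    fun_prop
  have c2 : Continuous fun z : PlanarPhaseSpace => fderiv ℝ ξ z (0, 1, 0, 0) := by fun_prop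
  obtain ⟨L, hL⟩ := S.exists_lipschitz
  obtain ⟨C1, hC1⟩ := h2.exists_bound_of_continuousOn c1.continuousOn
  obtain ⟨C2, hC2⟩ := h2.exists_bound_of_continuousOn c2.continuousOn
  refine S.memLp_of_compact (C := C1 + L * C2) ?_ h2 h3 (fun z hz => ?_) fun z hz => ?_
  · exact c1.measurable.sub (((measurable_deriv S.U₀).comp measurable_fst).mul c2.measurable)
  · refine (norm_sub_le _ _).trans (add_le_add (hC1 z hz) ?_)
    rw [norm_mul]
    exact mul_le_mul (norm_deriv_le_of_lipschitz hL) (hC2 z hz) (norm_nonneg _) L.2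
  · have : fderiv ℝ ξ z = 0 :=
      image_eq_zero_of_notMem_tsupport fun h => hz (tsupport_fderiv_subset ℝ h)
    simp [classicalTransport, this]

theorem integrable_mul_memLp (g : S.Hilb) {ξ : PlanarPhaseSpace → ℝ}
    (hξ : MemLp ξ 2 S.weightMeasure) : Integrable (fun z => g z * ξ z) S.weightMeasure :=
  MemLp.integrable_mul (Lp.memLp g) hξ

theorem U₀_neg (x : ℝ) : S.U₀ (-x) = S.U₀ x := by
  have hρ : ∀ x, S.massDensity S.U₀ (-x) = S.massDensity S.U₀ x := by
    intro x
    refine integral_congr_ae (Filter.Eventually.of_forall fun v => ?_)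
    have := S.symmetric x v.1 v.2.1 v.2.2
    simpa [PlanarAnsatz.phaseDensity] using this
  rw [S.poisson, S.poisson, ← integral_neg_eq_self]
  congr 2
  funext y
  rw [hρ, ← abs_neg]
  congr 2
  ring

/-! The operators. -/

/-- Graph of the weak transport operator: pairs `(g, h)` with
`∫ |φ'|⁻¹ g 𝓓ξ = - ∫ |φ'|⁻¹ h ξ` for all test functions `ξ`. -/
def transportGraph : Submodule ℝ (S.Hilb × S.Hilb) where
  carrier := {p | ∀ ξ, S.IsTest ξ →
    ∫ z, p.1 z * S.classicalTransport ξ z ∂S.weightMeasure =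
      -∫ z, p.2 z * ξ z ∂S.weightMeasure}
  zero_mem' := by
    intro ξ _
    have h0 : ∀ η : PlanarPhaseSpace → ℝ,
        ∫ z, (0 : S.Hilb) z * η z ∂S.weightMeasure = 0 := by
      intro η
      refine integral_eq_zero_of_ae ?_
      filter_upwards [Lp.coeFn_zero ℝ 2 S.weightMeasure] with z hz
      rw [hz, Pi.zero_apply, zero_mul]
    rw [Prod.fst_zero, Prod.snd_zero, h0, h0, neg_zero]
  add_mem' := by
    intro p q hp hq ξ hξ
    have key : ∀ (g h : S.Hilb) {η : PlanarPhaseSpace → ℝ}, MemLp η 2 S.weightMeasure →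
        ∫ z, (g + h) z * η z ∂S.weightMeasure =
          ∫ z, g z * η z ∂S.weightMeasure + ∫ z, h z * η z ∂S.weightMeasure := by
      intro g h η hη
      rw [← integral_add (S.integrable_mul_memLp g hη) (S.integrable_mul_memLp h hη)]
      refine integral_congr_ae ?_
      filter_upwards [Lp.coeFn_add g h] with z hz
      rw [hz, Pi.add_apply, add_mul]
    rw [Prod.fst_add, Prod.snd_add, key _ _ (S.memLp_transport_test hξ),
      key _ _ (S.memLp_test hξ), hp ξ hξ, hq ξ hξ]
    ring
  smul_mem' := by
    intro c p hp ξ hξ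
    have key : ∀ (g : S.Hilb) (η : PlanarPhaseSpace → ℝ),
        ∫ z, (c • g) z * η z ∂S.weightMeasure = c * ∫ z, g z * η z ∂S.weightMeasure := by
      intro g η
      rw [← integral_const_mul]
      refine integral_congr_ae ?_
      filter_upwards [Lp.coeFn_smul c g] with z hz
      rw [hz, Pi.smul_apply, smul_eq_mul, mul_assoc]
    rw [Prod.smul_fst, Prod.smul_snd, key, key, hp ξ hξ]
    ring

/-- The weak transport derivative is unique, so that `transportGraph` is the graph of an
operator. -/
theorem transportGraph_unique (p : S.Hilb × S.Hilb) (hp : p ∈ S.transportGraph)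
    (h0 : p.1 = 0) : p.2 = 0 := by
  have hloc : LocallyIntegrableOn p.2 S.Ω₀ S.weightMeasure := by
    rw [locallyIntegrableOn_iff S.isOpen_Ω₀.isLocallyClosed]
    intro K hKΩ hK
    have : IsFiniteMeasure (S.weightMeasure.restrict K) :=
      ⟨by simpa using S.weightMeasure_lt_top hK hKΩ⟩
    exact ((Lp.memLp p.2).restrict K).integrable one_le_two
  have hz : ∀ᵐ z ∂S.weightMeasure, z ∈ S.Ω₀ → p.2 z = 0 := by
    refine S.isOpen_Ω₀.ae_eq_zero_of_integral_contDiff_smul_eq_zero hloc fun ξ h1 h2 h3 => ?_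
    have h := hp ξ ⟨h1.of_le (by exact_mod_cast le_top), h2, h3⟩
    have hl : ∫ z, p.1 z * S.classicalTransport ξ z ∂S.weightMeasure = 0 := by
      refine integral_eq_zero_of_ae ?_
      rw [h0]
      filter_upwards [Lp.coeFn_zero ℝ 2 S.weightMeasure] with z hz
      rw [hz, Pi.zero_apply, zero_mul]
    rw [hl, eq_comm, neg_eq_zero] at h
    simpa [mul_comm] using h
  rw [Lp.eq_zero_iff_ae_eq_zero]
  have hmem : ∀ᵐ z ∂S.weightMeasure, z ∈ S.Ω₀ :=
    S.ae_weightMeasure_iff.2 (Filter.Eventually.of_forall fun _ h => h)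
  filter_upwards [hz, hmem] with z h1 h2 using h1 h2

/-- The transport operator `𝓓`, with domain
`{g ∈ H | 𝓓 g exists weakly and 𝓓 g ∈ H}`. -/
def transport : S.Hilb →ₗ.[ℝ] S.Hilb := S.transportGraph.toLinearPMap

theorem transport_graph : S.transport.graph = S.transportGraph :=
  Submodule.toLinearPMap_graph_eq _ S.transportGraph_unique

/-- `𝓓²`, with domain `{g ∈ D(𝓓) | 𝓓 g ∈ D(𝓓)}`. -/
def transportSq : S.Hilb →ₗ.[ℝ] S.Hilb := S.transport.naturalComp S.transport

/-- The integrand `v₁ g(x, v)`, with `g` extended by zero outside `Ω₀`. -/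
def currentIntegrand (g : PlanarPhaseSpace → ℝ) (x : ℝ) (v : ℝ × ℝ × ℝ) : ℝ :=
  v.1 * S.Ω₀.indicator g (x, v)

/-- `𝓙(g)(x) = ∫ v₁ g(x, v) dv`. -/
def current (g : PlanarPhaseSpace → ℝ) (x : ℝ) : ℝ := ∫ v, S.currentIntegrand g x v

theorem currentIntegrand_congr {g h : PlanarPhaseSpace → ℝ} (hgh : g =ᵐ[S.weightMeasure] h) :
    ∀ᵐ x : ℝ, S.currentIntegrand g x =ᵐ[volume] S.currentIntegrand h x := by
  have h1 := S.ae_weightMeasure_iff.1 hgh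
  rw [Measure.volume_eq_prod] at h1
  filter_upwards [Measure.ae_ae_of_ae_prod h1] with x hx
  filter_upwards [hx] with v hv
  unfold currentIntegrand
  by_cases hz : (x, v) ∈ S.Ω₀
  · rw [indicator_of_mem hz, indicator_of_mem hz, hv hz]
  · rw [indicator_of_notMem hz, indicator_of_notMem hz]

theorem ae_fst {p : ℝ → Prop} (hp : ∀ᵐ x : ℝ, p x) : ∀ᵐ z ∂S.weightMeasure, p z.1 := by
  rw [ae_weightMeasure_iff, Measure.volume_eq_prod]
  exact (Measure.quasiMeasurePreserving_fst.ae hp).mono fun _ h _ => h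

/-- Graph of `(𝓑 g)(x, v) = 4π |φ'(E, v̄)| v₁ 𝓙(g)(x)`, on the natural domain where `𝓙(g)(x)` exists
for almost every `x` and the right-hand side is in `H`. -/
def responseGraph : Submodule ℝ (S.Hilb × S.Hilb) where
  carrier := {p | (∀ᵐ x : ℝ, Integrable (S.currentIntegrand p.1 x)) ∧
    ∀ᵐ z ∂S.weightMeasure, p.2 z = 4 * Real.pi * |S.dφ z| * z.2.1 * S.current p.1 z.1}
  zero_mem' := by
    have h0 : ∀ᵐ x : ℝ, S.currentIntegrand (0 : S.Hilb) x =ᵐ[volume] 0 := by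
      filter_upwards [S.currentIntegrand_congr (Lp.coeFn_zero ℝ 2 S.weightMeasure)] with x hx
      refine hx.trans (Filter.Eventually.of_forall fun v => ?_)
      simp [currentIntegrand]
    refine ⟨?_, ?_⟩
    · filter_upwards [h0] with x hx
      exact (integrable_congr hx).2 (integrable_zero _ _ _)
    · filter_upwards [S.ae_fst h0, Lp.coeFn_zero ℝ 2 S.weightMeasure] with z hz h
      have : S.current (0 : S.Hilb) z.1 = 0 := integral_eq_zero_of_ae hz
      rw [Prod.fst_zero, Prod.snd_zero, this, h]
      simp
  add_mem' := by
    intro p q hp hq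
    have h0 : ∀ᵐ x : ℝ, S.currentIntegrand (p.1 + q.1 : S.Hilb) x =ᵐ[volume]
        S.currentIntegrand p.1 x + S.currentIntegrand q.1 x := by
      filter_upwards [S.currentIntegrand_congr (Lp.coeFn_add p.1 q.1)] with x hx
      refine hx.trans (Filter.Eventually.of_forall fun v => ?_)
      simp only [currentIntegrand, Pi.add_apply, indicator_add']
      ring
    refine ⟨?_, ?_⟩
    · filter_upwards [h0, hp.1, hq.1] with x hx h1 h2
      exact (integrable_congr hx).2 (h1.add h2)
    · filter_upwards [S.ae_fst h0, S.ae_fst hp.1, S.ae_fst hq.1, hp.2, hq.2,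
        Lp.coeFn_add p.2 q.2] with z hz h1 h2 h3 h4 h5
      have : S.current (p.1 + q.1 : S.Hilb) z.1 = S.current p.1 z.1 + S.current q.1 z.1 := by
        unfold current
        rw [integral_congr_ae hz]
        exact integral_add h1 h2
      rw [Prod.fst_add, Prod.snd_add, this, h5, Pi.add_apply, h3, h4]
      ring
  smul_mem' := by
    intro c p hp
    have h0 : ∀ᵐ x : ℝ, S.currentIntegrand (c • p.1 : S.Hilb) x =ᵐ[volume]
        fun v => c * S.currentIntegrand p.1 x v := by
      filter_upwards [S.currentIntegrand_congr (Lp.coeFn_smul c p.1)] with x hx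
      refine hx.trans (Filter.Eventually.of_forall fun v => ?_)
      by_cases hz : (x, v) ∈ S.Ω₀
      · simp only [currentIntegrand, indicator_of_mem hz, Pi.smul_apply, smul_eq_mul,
          mul_left_comm]
      · simp only [currentIntegrand, indicator_of_notMem hz, mul_zero]
    refine ⟨?_, ?_⟩
    · filter_upwards [h0, hp.1] with x hx h1
      exact (integrable_congr hx).2 (h1.const_mul c)
    · filter_upwards [S.ae_fst h0, hp.2, Lp.coeFn_smul c p.2] with z hz h3 h5
      have : S.current (c • p.1 : S.Hilb) z.1 = c * S.current p.1 z.1 := by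
        unfold current
        rw [integral_congr_ae hz, integral_const_mul]
      rw [Prod.smul_fst, Prod.smul_snd, this, h5, Pi.smul_apply, h3, smul_eq_mul]
      ring

theorem responseGraph_unique (p : S.Hilb × S.Hilb) (hp : p ∈ S.responseGraph)
    (h0 : p.1 = 0) : p.2 = 0 := by
  have h := S.responseGraph.zero_mem.2
  rw [Lp.eq_zero_iff_ae_eq_zero]
  filter_upwards [hp.2, h, Lp.coeFn_zero ℝ 2 S.weightMeasure] with z h1 h2 h3
  rw [h1, h0]
  exact h2.symm.trans h3

/-- The gravitational response operator `𝓑`. -/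
def response : S.Hilb →ₗ.[ℝ] S.Hilb := S.responseGraph.toLinearPMap

theorem response_graph : S.response.graph = S.responseGraph :=
  Submodule.toLinearPMap_graph_eq _ S.responseGraph_unique

/-- The planar Antonov operator `𝓐 = -𝓓² - 𝓑`. -/
def antonov : S.Hilb →ₗ.[ℝ] S.Hilb := -S.transportSq - S.response

/-- Reflection `(x, v) ↦ (-x, v)`. -/
def reflX (z : PlanarPhaseSpace) : PlanarPhaseSpace := (-z.1, z.2)

/-- Reflection `(x, v) ↦ (x, -v₁, v̄)`. -/
def reflV (z : PlanarPhaseSpace) : PlanarPhaseSpace := (z.1, -z.2.1, z.2.2)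

theorem ae_comp_of_measurePreserving {r : PlanarPhaseSpace → PlanarPhaseSpace}
    (hr : MeasurePreserving r volume volume) (hΩ : ∀ z, z ∈ S.Ω₀ → r z ∈ S.Ω₀)
    {p : PlanarPhaseSpace → Prop} (hp : ∀ᵐ z ∂S.weightMeasure, p z) :
    ∀ᵐ z ∂S.weightMeasure, p (r z) := by
  rw [ae_weightMeasure_iff] at hp ⊢
  filter_upwards [hr.quasiMeasurePreserving.ae hp] with z hz h using hz (hΩ z h)

theorem ae_reflX {p : PlanarPhaseSpace → Prop} (hp : ∀ᵐ z ∂S.weightMeasure, p z) :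
    ∀ᵐ z ∂S.weightMeasure, p (reflX z) := by
  refine S.ae_comp_of_measurePreserving ?_ (fun z hz => ?_) hp
  · exact (Measure.measurePreserving_neg (volume : Measure ℝ)).prod
      (MeasurePreserving.id (volume : Measure (ℝ × ℝ × ℝ)))
  · rw [mem_Ω₀_iff] at hz ⊢
    simpa [reflX, energy, S.U₀_neg] using hz

theorem ae_reflV {p : PlanarPhaseSpace → Prop} (hp : ∀ᵐ z ∂S.weightMeasure, p z) :
    ∀ᵐ z ∂S.weightMeasure, p (reflV z) := by
  refine S.ae_comp_of_measurePreserving ?_ (fun z hz => ?_) hp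
  · exact (MeasurePreserving.id (volume : Measure ℝ)).prod
      ((Measure.measurePreserving_neg (volume : Measure ℝ)).prod
        (MeasurePreserving.id (volume : Measure (ℝ × ℝ))))
  · rw [mem_Ω₀_iff] at hz ⊢
    simpa [reflV, energy] using hz

/-- The functions in `H` that are odd in `x` and odd in `v₁`, almost everywhere on `Ω₀`. -/
def oddSubspace : Submodule ℝ S.Hilb where
  carrier := {g | ∀ᵐ z ∂S.weightMeasure, g z = -g (reflX z) ∧ g z = -g (reflV z)}
  zero_mem' := by
    have h := Lp.coeFn_zero ℝ 2 S.weightMeasure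
    filter_upwards [h, S.ae_reflX h, S.ae_reflV h] with z h1 h2 h3
    rw [h1, h2, h3]
    simp
  add_mem' := by
    intro f g hf hg
    have h := Lp.coeFn_add f g
    filter_upwards [hf, hg, h, S.ae_reflX h, S.ae_reflV h] with z h1 h2 h3 h4 h5
    rw [h3, h4, h5]
    simp only [Pi.add_apply]
    constructor
    · rw [h1.1, h2.1]; ring
    · rw [h1.2, h2.2]; ring
  smul_mem' := by
    intro c f hf
    have h := Lp.coeFn_smul c f
    filter_upwards [hf, h, S.ae_reflX h, S.ae_reflV h] with z h1 h3 h4 h5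
    rw [h3, h4, h5]
    simp only [Pi.smul_apply, smul_eq_mul]
    constructor
    · rw [h1.1]; ring
    · rw [h1.2]; ring

/-! The period function. -/

/-- `x₊(E)`, the largest solution of `U₀(x) = E`. -/
def xPlus (E : ℝ) : ℝ := sSup {x | S.U₀ x = E}

/-- `x₋(E)`, the smallest solution of `U₀(x) = E`. -/
def xMinus (E : ℝ) : ℝ := sInf {x | S.U₀ x = E}

/-- The period `T(E) = 2 ∫_{x₋(E)}^{x₊(E)} (2E - 2U₀(x))^{-1/2} dx` of the particle motion
`x' = v₁, v₁' = -U₀'(x)` with energy `E > U₀(0) = min U₀`, with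
`T(U₀(0)) = 2π / √(U₀''(0))`. -/
def period (E : ℝ) : ℝ :=
  if E = S.U₀ 0 then 2 * Real.pi / √(deriv (deriv S.U₀) 0)
  else 2 * ∫ x in (S.xMinus E)..(S.xPlus E), 1 / √(2 * E - 2 * S.U₀ x)

end PlanarSteadyState

end

open MeasureTheory Set
open scoped ENNReal
open Filter Topology
open scoped InnerProductSpace

/-! The one-dimensional flow x' = v₁, v₁' = -U₀'(x) is integrable, so 𝓓 can be diagonalised
explicitly, and 𝓑 is compact relative to 𝓓². The essential spectrum is then read off from the
diagonal form.

Diagonalisation. The mass density is a C¹ function of the potential, hence U₀'' is C¹; it is even,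
nonnegative and positive at 0. Writing U₀(x) = U₀(0) + r(x)²/2 turns energy curves into circles in
the complex coordinate v₁ + i r(x). Measuring the polar angle by elapsed time gives an angle
variable θ with 𝓓 exp(2πiθ) = i (2π / T(E)) exp(2πiθ). The modes Re(Ψ(E, v̄) exp(2πikθ)), with Ψ of
class C¹ and compactly supported away from the equilibrium, are test functions (`isTest_mode`). On
them -𝓓² is multiplication by (2πk / T(E))² (`transport_transport_mode`). Different orders are
orthogonal, and by Stone–Weierstrass the modes are total (`eq_zero_of_integral_mode_eq_zero`). Off
the bands {(2πk / T(E))²} the resolvent equation is solved by dividing amplitudes; so the resolvent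
is bounded and the modes form a core of the weakly defined operator
(`IsModePart.exists_isResolventAt`).

Compactness. One has 𝓑 = 4π 𝓓 N with N g = |φ'| ∫_{y < x} 𝓙(g)(y) dy, and N is compact by
Arzelà–Ascoli (`exists_integratedResponse`, `response_mem_transportGraph`). As 𝓓 is antisymmetric
and 𝓑 symmetric, 𝓑 R = -4π N* 𝓓 R for a resolvent R, and 𝓓 R is bounded
(`isCompactOperator_response_comp`).

Spectrum. Off the bands, 𝓐 u - lam u = f reads (1 - R 𝓑) u = R f with R 𝓑 compact, so only isolated
eigenvalues of finite multiplicity occur. On the bands, modes concentrated in energy are approximate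
eigenvectors of -𝓓². If their amplitudes have mean zero in v̄ they carry no current, 𝓑 annihilates
them, and they serve for 𝓐 as well. A point isolated in the band set forces k / T(E) to be constant
on an energy interval and has an infinite-dimensional eigenspace
(`LinearPMap.essentialSpectrum_eq_of_compact`, `IsModePart.essentialSpectrum_eq`).

Odd functions. The reflections in x and v₁ send θ to -θ and 1/2 - θ, so the modes odd in both are
those of even order k ≥ 2 with imaginary amplitude. The argument is carried out once, for an
isometrically embedded subspace spanned by modes (`IsModePart`), and applied to the whole space and
to the odd subspace. -/

noncomputable section

/-! ### Compact operators. -/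

section CompactOperators

variable {E F : Type*} [NormedAddCommGroup E] [InnerProductSpace ℝ E] [CompleteSpace E]
  [NormedAddCommGroup F] [InnerProductSpace ℝ F] [CompleteSpace F]

/-- The adjoint of a compact operator between Hilbert spaces is compact. -/
theorem IsCompactOperator.adjoint {T : E →L[ℝ] F} (hT : IsCompactOperator T) :
    IsCompactOperator (ContinuousLinearMap.adjoint T) := by
  rw [← ContinuousLinearMap.coe_coe, isCompactOperator_iff_image_ball_subset_compact _ one_pos]
  refine ⟨_, TotallyBounded.isCompact_of_isClosed (TotallyBounded.closure ?_) isClosed_closure,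
    subset_closure⟩
  -- Since ‖T* y‖² = ⟪y, T T* y⟫ ≤ ‖y‖ ‖T T* y‖, a net for the image of the unit ball under T T*
  -- gives one for its image under T*. Differences within the ball have norm at most 2, so the mesh
  -- ε²/4 yields ‖T*(x - y)‖² ≤ ε²/2.
  have hc : IsCompactOperator (T ∘L ContinuousLinearMap.adjoint T) := hT.comp_clm _
  obtain ⟨K, hK, hKs⟩ := (isCompactOperator_iff_image_ball_subset_compact
    (T ∘L ContinuousLinearMap.adjoint T : F →L[ℝ] F).toLinearMap one_pos).1 hc
  have htb := hK.totallyBounded.subset hKs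
  rw [Metric.totallyBounded_iff]
  intro ε hε
  obtain ⟨t, hts, htf, htc⟩ := Metric.finite_approx_of_totallyBounded htb (ε ^ 2 / 4)
    (by positivity)
  have hts' : ∀ z ∈ t, ∃ y ∈ Metric.ball (0 : F) 1,
      (T ∘L ContinuousLinearMap.adjoint T) y = z := fun z hz => hts hz
  choose! y hyb hy using hts'
  refine ⟨(fun z => ContinuousLinearMap.adjoint T (y z)) '' t, htf.image _, ?_⟩
  rintro _ ⟨x, hx, rfl⟩
  obtain ⟨z, hz⟩ := mem_iUnion.1 (htc ⟨x, hx, rfl⟩)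
  obtain ⟨hzt, hz⟩ := mem_iUnion.1 hz
  refine mem_iUnion₂.2 ⟨_, ⟨z, hzt, rfl⟩, ?_⟩
  rw [← hy z hzt, Metric.mem_ball, dist_eq_norm, ContinuousLinearMap.coe_coe, ← map_sub] at hz
  rw [Metric.mem_ball, dist_eq_norm, ContinuousLinearMap.coe_coe, ← map_sub]
  have h2 : ‖x - y z‖ ≤ 2 := by
    have h1 := mem_ball_zero_iff.1 hx
    have h3 := mem_ball_zero_iff.1 (hyb z hzt)
    linarith [norm_sub_le x (y z)]
  have h3 : ‖ContinuousLinearMap.adjoint T (x - y z)‖ ^ 2 ≤ ε ^ 2 / 4 * 2 := by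
    rw [← real_inner_self_eq_norm_sq, ContinuousLinearMap.adjoint_inner_right]
    exact (real_inner_le_norm _ _).trans
      (mul_le_mul hz.le h2 (norm_nonneg _) (by positivity))
  exact lt_of_pow_lt_pow_left₀ 2 hε.le (by nlinarith)

end CompactOperators

/-- Pairing with a continuous family of vectors over a compact space is a compact operator into
the continuous functions. -/
theorem exists_isCompactOperator_inner {E I : Type*} [NormedAddCommGroup E]
    [InnerProductSpace ℝ E] [TopologicalSpace I] [CompactSpace I]
    {k : I → E} (hk : Continuous k) :
    ∃ L : E →L[ℝ] (BoundedContinuousFunction I ℝ),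
      (∀ g x, L g x = ⟪k x, g⟫_ℝ) ∧ IsCompactOperator L := by
  obtain ⟨C, hC⟩ : ∃ C, ∀ x, ‖k x‖ ≤ C := by
    obtain ⟨C, hC⟩ := isCompact_univ.exists_bound_of_continuousOn hk.continuousOn
    exact ⟨C, fun x => hC x (mem_univ x)⟩
  -- `C` may be negative when `I` is empty, hence the maximum with 0.
  have hbd : ∀ g x, |⟪k x, g⟫_ℝ| ≤ max C 0 * ‖g‖ := fun g x =>
    (abs_real_inner_le_norm _ _).trans
      (mul_le_mul_of_nonneg_right ((hC x).trans (le_max_left _ _)) (norm_nonneg _))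
  have hcont : ∀ g, Continuous fun x => ⟪k x, g⟫_ℝ := fun g => hk.inner continuous_const
  let L₀ : E →ₗ[ℝ] BoundedContinuousFunction I ℝ :=
    { toFun := fun g => BoundedContinuousFunction.mkOfCompact ⟨fun x => ⟪k x, g⟫_ℝ, hcont g⟩
      map_add' := fun g h => by ext x; simp [inner_add_right]
      map_smul' := fun c g => by ext x; simp [inner_smul_right] }
  let L : E →L[ℝ] BoundedContinuousFunction I ℝ := L₀.mkContinuous (max C 0) fun g =>
    (BoundedContinuousFunction.norm_le (by positivity)).2 fun x => hbd g x
  refine ⟨L, fun g x => rfl, ?_⟩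
  rw [← ContinuousLinearMap.coe_coe, isCompactOperator_iff_image_ball_subset_compact _ one_pos]
  -- Equicontinuity of the image of the unit ball is the continuity of `k`: |⟪k x₀ - k x, g⟫| ≤ ‖k
  -- x₀ - k x‖ for ‖g‖ ≤ 1.
  refine ⟨_, BoundedContinuousFunction.arzela_ascoli (Metric.closedBall (0 : ℝ) (max C 0))
    (isCompact_closedBall _ _) _ ?_ ?_, subset_closure⟩
  · rintro _ x ⟨g, hg, rfl⟩
    rw [mem_closedBall_zero_iff]
    refine (hbd g x).trans ?_
    have := (mem_ball_zero_iff.1 hg).le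
    nlinarith [le_max_right C 0]
  · intro x₀
    rw [Metric.equicontinuousAt_iff_right]
    intro ε hε
    filter_upwards [Metric.tendsto_nhds.1 hk.continuousAt ε hε] with x hx
    rintro ⟨_, g, hg, rfl⟩
    have h1 := (mem_ball_zero_iff.1 hg).le
    change dist (⟪k x₀, g⟫_ℝ) (⟪k x, g⟫_ℝ) < ε
    rw [Real.dist_eq, ← inner_sub_left]
    refine (abs_real_inner_le_norm _ _).trans_lt ?_
    rw [dist_comm, dist_eq_norm] at hx
    nlinarith [norm_nonneg (k x₀ - k x), norm_nonneg g]

/-! ### Unbounded symmetric operators: resolvents from a core, stability of the essential spectrum.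
-/

namespace LinearPMap

variable {H : Type*} [NormedAddCommGroup H] [InnerProductSpace ℝ H]

theorem mem_eigenspace_iff {A : H →ₗ.[ℝ] H} {lam : ℝ} {u : A.domain} :
    u ∈ A.eigenspace lam ↔ A u = lam • (u : H) := by
  rw [eigenspace, LinearMap.mem_ker, LinearMap.sub_apply, sub_eq_zero]
  rfl

/-- A symmetric operator which is closed on a core `W`, bounded below on `W` after a shift, with
dense range on `W`, has a bounded resolvent there. -/
theorem exists_isResolventAt_of_core [CompleteSpace H] {A : H →ₗ.[ℝ] H} {W : Submodule ℝ H}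
    {lam d : ℝ} (hd : 0 < d)
    (hclosed : ∀ (w : ℕ → A.domain) (u h : H), (∀ n, (w n : H) ∈ W) →
      Tendsto (fun n => (w n : H)) atTop (𝓝 u) → Tendsto (fun n => A (w n)) atTop (𝓝 h) →
      ∃ hu : u ∈ A.domain, A ⟨u, hu⟩ = h)
    (hsymm : ∀ g w : A.domain, (w : H) ∈ W → ⟪A g, w⟫_ℝ = ⟪(g : H), A w⟫_ℝ)
    (hdense : ∀ f : H, ∀ ε > 0, ∃ w : A.domain, (w : H) ∈ W ∧ ‖A w - lam • (w : H) - f‖ < ε)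
    (hbound : ∀ w : A.domain, (w : H) ∈ W → d * ‖(w : H)‖ ≤ ‖A w - lam • (w : H)‖) :
    ∃ R : H →L[ℝ] H, A.IsResolventAt lam R ∧
      ∀ g : A.domain, ∃ w : ℕ → A.domain, (∀ n, (w n : H) ∈ W) ∧
        Tendsto (fun n => (w n : H)) atTop (𝓝 g) ∧
        Tendsto (fun n => A (w n)) atTop (𝓝 (A g)) := by
  -- Approximate solutions in `W` exist by density of the range; the lower bound makes them Cauchy,
  -- and closedness makes their limit a solution. The approximating sequence is kept because it
  -- shows that `W` is a core.
  have hsurj : ∀ f : H, ∃ u : A.domain, A u - lam • (u : H) = f ∧ d * ‖(u : H)‖ ≤ ‖f‖ ∧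
      ∃ w : ℕ → A.domain, (∀ n, (w n : H) ∈ W) ∧
        Tendsto (fun n => (w n : H)) atTop (𝓝 u) ∧
        Tendsto (fun n => A (w n)) atTop (𝓝 (A u)) := by
    intro f
    choose w hwW hw using fun n : ℕ => hdense f (1 / ((n : ℝ) + 1)) Nat.one_div_pos_of_nat
    have hlim : Tendsto (fun n => A (w n) - lam • (w n : H)) atTop (𝓝 f) := by
      rw [tendsto_iff_norm_sub_tendsto_zero]
      exact squeeze_zero (fun _ => norm_nonneg _) (fun n => (hw n).le)
        tendsto_one_div_add_atTop_nhds_zero_nat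
    have hcau : CauchySeq fun n => (w n : H) := by
      have hc := hlim.cauchySeq
      rw [Metric.cauchySeq_iff] at hc ⊢
      intro ε hε
      obtain ⟨N, hN⟩ := hc (d * ε) (by positivity)
      refine ⟨N, fun m hm n hn => ?_⟩
      have h1 := hN m hm n hn
      have h2 := hbound (w m - w n) (W.sub_mem (hwW m) (hwW n))
      rw [dist_eq_norm] at h1 ⊢
      have h3 : A (w m - w n) - lam • ((w m - w n : A.domain) : H) =
          A (w m) - lam • (w m : H) - (A (w n) - lam • (w n : H)) := by
        rw [LinearPMap.map_sub, Submodule.coe_sub, smul_sub]; abel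
      rw [h3, Submodule.coe_sub] at h2
      exact lt_of_mul_lt_mul_left (h2.trans_lt h1) hd.le
    obtain ⟨u, hu⟩ := cauchySeq_tendsto_of_complete hcau
    have hA : Tendsto (fun n => A (w n)) atTop (𝓝 (f + lam • u)) := by
      have := hlim.add (hu.const_smul lam)
      simpa using this
    obtain ⟨huD, hAu⟩ := hclosed w u _ hwW hu hA
    refine ⟨⟨u, huD⟩, by rw [hAu]; simp, ?_, w, hwW, hu, by rw [hAu]; exact hA⟩
    exact le_of_tendsto_of_tendsto' (hu.norm.const_mul d) hlim.norm fun n => hbound _ (hwW n)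
  -- A solution of A g = lam g is orthogonal to (A - lam) W by symmetry; an element of this range
  -- closer to g than ‖g‖ is then impossible unless g = 0.
  have hinj : ∀ g : A.domain, A g - lam • (g : H) = 0 → g = 0 := by
    intro g hg
    apply Subtype.ext
    by_contra hne
    have hpos : 0 < ‖(g : H)‖ := norm_pos_iff.2 hne
    obtain ⟨w, hwW, hw⟩ := hdense g ‖(g : H)‖ hpos
    have h0 : ⟪(g : H), A w - lam • (w : H)⟫_ℝ = 0 := by
      rw [inner_sub_right, ← hsymm g w hwW, inner_smul_right, sub_eq_zero.1 hg, inner_smul_left]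
      simp
    have h1 : ⟪(g : H), A w - lam • (w : H) - g⟫_ℝ = -(‖(g : H)‖ * ‖(g : H)‖) := by
      rw [inner_sub_right, h0, real_inner_self_eq_norm_mul_norm, zero_sub]
    have h2 := abs_real_inner_le_norm (g : H) (A w - lam • (w : H) - g)
    rw [h1, abs_neg, abs_of_pos (by positivity)] at h2
    nlinarith
  have huniq : ∀ g g' : A.domain, A g - lam • (g : H) = A g' - lam • (g' : H) → g = g' := by
    intro g g' h
    refine sub_eq_zero.1 (hinj (g - g') ?_)
    rw [LinearPMap.map_sub, Submodule.coe_sub, smul_sub]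
    rw [← sub_eq_zero] at h
    rw [← h]; abel
  choose r hr hrb hrc using hsurj
  let R : H →ₗ[ℝ] H :=
    { toFun := fun f => r f
      map_add' := fun f f' => by
        rw [← Submodule.coe_add]
        congr 1
        apply huniq
        rw [hr, LinearPMap.map_add, Submodule.coe_add, smul_add]
        calc f + f' = (A (r f) - lam • (r f : H)) + (A (r f') - lam • (r f' : H)) := by
              rw [hr, hr]
          _ = _ := by abel
      map_smul' := fun c f => by
        rw [RingHom.id_apply, ← Submodule.coe_smul]
        congr 1
        apply huniq
        rw [hr, LinearPMap.map_smul, Submodule.coe_smul, smul_comm lam c, ← smul_sub, hr] }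
  have hRr : ∀ g : A.domain, r (A g - lam • (g : H)) = g := fun g => huniq _ _ (hr _)
  refine ⟨R.mkContinuous d⁻¹ fun f => ?_, ⟨fun f => ⟨(r f).2, hr f⟩, fun g => ?_⟩, fun g => ?_⟩
  · have := hrb f
    change ‖(r f : H)‖ ≤ _
    rw [inv_mul_eq_div, le_div_iff₀ hd, mul_comm]
    exact this
  · exact congrArg Subtype.val (hRr g)
  · have := hrc (A g - lam • (g : H))
    rwa [hRr] at this

/-- Stability of the essential spectrum, in the situation where it is the whole spectrum `S` of the
unperturbed operator: off `S` the equation `A u - lam u = f` is a compact perturbation of the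
identity, and on `S` there are approximate eigenvectors and isolated points have infinite
multiplicity. -/
theorem essentialSpectrum_eq_of_compact [CompleteSpace H] {A : H →ₗ.[ℝ] H} {S : Set ℝ}
    (hsymm : ∀ u v : A.domain, ⟪A u, v⟫_ℝ = ⟪(u : H), A v⟫_ℝ) (hS : _root_.IsClosed S)
    (hres : ∀ lam ∉ S, ∃ R K : H →L[ℝ] H, IsCompactOperator K ∧
      (∀ u : A.domain, (u : H) - K u = R (A u - lam • (u : H))) ∧
      ∀ u f : H, u - K u = R f → ∃ h : u ∈ A.domain, A ⟨u, h⟩ - lam • u = f)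
    (happrox : ∀ lam ∈ S, ∀ ε > 0, ∃ u : A.domain, (u : H) ≠ 0 ∧
      ‖A u - lam • (u : H)‖ ≤ ε * ‖(u : H)‖)
    (hinf : ∀ lam ∈ S, (∃ ε > 0, ∀ mu ∈ S, |mu - lam| < ε → mu = lam) →
      ¬ FiniteDimensional ℝ (A.eigenspace lam)) :
    A.essentialSpectrum = S := by
  -- With ε = 1 / (2 (‖R‖ + 1)) a resolvent R would give ‖u‖ ≤ ‖u‖ / 2 for an approximate
  -- eigenvector u ≠ 0.
  have hSspec : S ⊆ A.spectrum := by
    rintro lam hlam ⟨R, -, hR⟩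
    obtain ⟨u, hu0, hu⟩ := happrox lam hlam (1 / (2 * (‖R‖ + 1))) (by positivity)
    have h1 : ‖(u : H)‖ ≤ ‖R‖ * (1 / (2 * (‖R‖ + 1)) * ‖(u : H)‖) := by
      calc ‖(u : H)‖ = ‖R (A u - lam • (u : H))‖ := by rw [hR]
        _ ≤ ‖R‖ * ‖A u - lam • (u : H)‖ := R.le_opNorm _
        _ ≤ _ := mul_le_mul_of_nonneg_left hu (norm_nonneg _)
    have h2 : 0 < ‖(u : H)‖ := norm_pos_iff.2 hu0
    have h3 : ‖R‖ * (1 / (2 * (‖R‖ + 1))) ≤ 1 / 2 := by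
      rw [mul_one_div, div_le_div_iff₀ (by positivity) two_pos]
      linarith [norm_nonneg R]
    nlinarith
  have hSinf : ∀ lam ∈ S, lam ∉ A.discreteSpectrum := by
    rintro lam hlam ⟨-, ⟨ε, hε, h⟩, -, hfin⟩
    exact hinf lam hlam ⟨ε, hε, fun mu hmu => h mu (hSspec hmu)⟩ hfin
  -- Fredholm alternative: either 1 is an eigenvalue of K, and then lam is one of A, or 1 - K is
  -- invertible and (1 - K)⁻¹ R is a resolvent of A.
  have heig : ∀ lam ∉ S, lam ∈ A.spectrum → A.eigenspace lam ≠ ⊥ := by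
    intro lam hlam hspec hbot
    obtain ⟨R, K, hK, h1, h2⟩ := hres lam hlam
    have hno : ¬ Module.End.HasEigenvalue (K : Module.End ℝ H) 1 := by
      intro hev
      obtain ⟨u, hu, hu0⟩ := hev.exists_hasEigenvector
      rw [Module.End.mem_eigenspace_iff, one_smul] at hu
      have hu' : K u = u := hu
      obtain ⟨huD, hAu⟩ := h2 u 0 (by rw [hu', sub_self, _root_.map_zero])
      have : (⟨u, huD⟩ : A.domain) ∈ A.eigenspace lam :=
        mem_eigenspace_iff.2 (sub_eq_zero.1 hAu)
      rw [hbot, Submodule.mem_bot] at this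
      exact hu0 (congrArg Subtype.val this)
    have hreg := (hK.hasEigenvalue_or_mem_resolventSet one_ne_zero).resolve_left hno
    rw [_root_.spectrum.mem_resolventSet_iff, map_one] at hreg
    obtain ⟨V, hV⟩ := hreg
    have hV1 : ∀ x, (↑V⁻¹ : H →L[ℝ] H) (x - K x) = x := by
      intro x
      have : ((↑V⁻¹ : H →L[ℝ] H) * (↑V : H →L[ℝ] H)) x = x := by simp
      rw [hV] at this
      simpa using this
    have hV2 : ∀ x, (↑V⁻¹ : H →L[ℝ] H) x - K ((↑V⁻¹ : H →L[ℝ] H) x) = x := by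
      intro x
      have : ((↑V : H →L[ℝ] H) * (↑V⁻¹ : H →L[ℝ] H)) x = x := by simp
      rw [hV] at this
      simpa using this
    refine hspec ⟨(↑V⁻¹ : H →L[ℝ] H) ∘L R, fun f => h2 _ f (hV2 _), fun g => ?_⟩
    rw [ContinuousLinearMap.comp_apply, ← h1, hV1]
  have hfin : ∀ lam ∉ S, FiniteDimensional ℝ (A.eigenspace lam) := by
    intro lam hlam
    obtain ⟨R, K, hK, h1, -⟩ := hres lam hlam
    have hf := ContinuousLinearMap.finite_dimensional_eigenspace hK 1 one_ne_zero
    let j : A.eigenspace lam →ₗ[ℝ] Module.End.eigenspace K.toLinearMap 1 :=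
      (A.domain.subtype ∘ₗ (A.eigenspace lam).subtype).codRestrict _ fun u => by
        rw [Module.End.mem_eigenspace_iff, one_smul]
        have := h1 u
        rw [mem_eigenspace_iff.1 u.2, sub_self, _root_.map_zero, sub_eq_zero] at this
        exact this.symm
    refine Module.Finite.of_injective j fun u v huv => ?_
    have := congrArg Subtype.val huv
    exact Subtype.ext (Subtype.ext this)
  -- Spectral points off `S` are eigenvalues. If they accumulated at lam, unit eigenvectors u n
  -- would satisfy u n - K (u n) = (mu n - lam) R (u n) → 0, so by compactness a subsequence would
  -- converge to a unit eigenvector w for lam. Symmetry makes w orthogonal to every u n, hence to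
  -- itself.
  have hisol : ∀ lam ∉ S, ∃ ε > 0, ∀ mu ∈ A.spectrum, |mu - lam| < ε → mu = lam := by
    intro lam hlam
    obtain ⟨ε₀, hε₀, hball⟩ := Metric.isOpen_iff.1 hS.isOpen_compl lam hlam
    by_contra! hcon
    have hseq : ∀ n : ℕ, ∃ mu, ∃ u : A.domain, mu ≠ lam ∧ |mu - lam| < 1 / ((n : ℝ) + 1) ∧
        ‖(u : H)‖ = 1 ∧ A u = mu • (u : H) := by
      intro n
      obtain ⟨mu, hmu, hlt, hne⟩ := hcon (min ε₀ (1 / ((n : ℝ) + 1)))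
        (lt_min hε₀ Nat.one_div_pos_of_nat)
      have hmuS : mu ∉ S := hball (by
        rw [Metric.mem_ball, Real.dist_eq]; exact hlt.trans_le (min_le_left _ _))
      obtain ⟨u, hu, hu0⟩ := Submodule.exists_mem_ne_zero_of_ne_bot (heig mu hmuS hmu)
      have hu0' : ‖(u : H)‖ ≠ 0 := by
        rw [norm_ne_zero_iff]
        exact fun h => hu0 (Subtype.ext h)
      refine ⟨mu, ‖(u : H)‖⁻¹ • u, hne, hlt.trans_le (min_le_right _ _), ?_, ?_⟩
      · rw [Submodule.coe_smul, norm_smul, norm_inv, norm_norm, inv_mul_cancel₀ hu0']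
      · rw [LinearPMap.map_smul, mem_eigenspace_iff.1 hu, Submodule.coe_smul, smul_comm]
    choose mu u hne hlt hnorm hAu using hseq
    obtain ⟨R, K, hK, h1, h2⟩ := hres lam hlam
    have hmu : Tendsto (fun n => mu n - lam) atTop (𝓝 0) := by
      rw [tendsto_zero_iff_abs_tendsto_zero]
      exact squeeze_zero (fun _ => abs_nonneg _) (fun n => (hlt n).le)
        tendsto_one_div_add_atTop_nhds_zero_nat
    have hdiff : Tendsto (fun n => (u n : H) - K (u n)) atTop (𝓝 0) := by
      have : ∀ n, (u n : H) - K (u n) = (mu n - lam) • R (u n) := by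
        intro n
        rw [h1, hAu, ← sub_smul, _root_.map_smul]
      simp only [this]
      rw [tendsto_zero_iff_norm_tendsto_zero]
      refine squeeze_zero (fun _ => norm_nonneg _) (fun n => ?_)
        (by simpa using hmu.abs.mul_const ‖R‖)
      rw [norm_smul, Real.norm_eq_abs]
      refine mul_le_mul_of_nonneg_left ?_ (abs_nonneg _)
      simpa [hnorm] using R.le_opNorm (u n)
    obtain ⟨C, hC, hCK⟩ := IsCompactOperator.image_closedBall_subset_compact
      (f := K.toLinearMap) hK 1
    obtain ⟨w, -, φ, hφ, hw⟩ := hC.tendsto_subseq fun n =>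
      hCK ⟨(u n : H), by simp [hnorm], rfl⟩
    have hw' : Tendsto (fun n => (u (φ n) : H)) atTop (𝓝 w) := by
      have := (hdiff.comp hφ.tendsto_atTop).add hw
      simpa using this
    have hwn : ‖w‖ = 1 := by
      have := hw'.norm
      simp only [hnorm] at this
      exact (tendsto_nhds_unique this tendsto_const_nhds)
    have hKw : w - K w = R 0 := by
      rw [_root_.map_zero]
      exact tendsto_nhds_unique
        (hw'.sub ((K.continuous.tendsto w).comp hw')) (hdiff.comp hφ.tendsto_atTop)
    obtain ⟨hwD, hAw⟩ := h2 w 0 hKw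
    rw [sub_eq_zero] at hAw
    have horth : ∀ n, ⟪(u n : H), w⟫_ℝ = 0 := by
      intro n
      have := hsymm (u n) ⟨w, hwD⟩
      rw [hAu, hAw, inner_smul_left, inner_smul_right] at this
      have h3 : (mu n - lam) * ⟪(u n : H), w⟫_ℝ = 0 := by
        rw [sub_mul, sub_eq_zero]; simpa using this
      exact (mul_eq_zero.1 h3).resolve_left (sub_ne_zero.2 (hne n))
    have h3 : ⟪w, w⟫_ℝ = 0 := by
      have h4 := Filter.Tendsto.inner (𝕜 := ℝ) hw' (tendsto_const_nhds (x := w))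
      simp only [horth] at h4
      exact tendsto_nhds_unique h4 tendsto_const_nhds
    rw [real_inner_self_eq_norm_sq, hwn] at h3
    norm_num at h3
  refine Subset.antisymm (fun lam hlam => ?_) fun lam hlam => ⟨hSspec hlam, hSinf lam hlam⟩
  by_contra hn
  exact hlam.2 ⟨hlam.1, hisol lam hn, heig lam hn hlam.1, hfin lam hn⟩

theorem mem_domain_restrictTo_iff {A : H →ₗ.[ℝ] H} {K : Submodule ℝ H}
    (hK : ∀ g : A.domain, (g : H) ∈ K → A g ∈ K) (g : K) :
    g ∈ (A.restrictTo K).domain ↔ (g : H) ∈ A.domain := by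
  constructor
  · rintro ⟨y, -, hy⟩
    have hy' : (y : H) = g := hy
    rw [← hy']
    exact y.2
  · intro h
    exact ⟨⟨g, h⟩, hK ⟨g, h⟩ g.2, rfl⟩

end LinearPMap

/-! ### C¹ regularity of parametric integrals and of truncated powers. -/

/-- A parametric integral of a `C¹` function over `[0, 1]` is `C¹`. -/
theorem ContDiff.intervalIntegral_one {E F : Type*} [NormedAddCommGroup E] [NormedSpace ℝ E]
    [FiniteDimensional ℝ E] [NormedAddCommGroup F] [NormedSpace ℝ F] [CompleteSpace F]
    {f : E → ℝ → F} (hf : ContDiff ℝ 1 (Function.uncurry f)) :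
    ContDiff ℝ 1 fun x => ∫ s in (0 : ℝ)..1, f x s := by
  have := FiniteDimensional.proper ℝ E
  have hd : Continuous fun z : E × ℝ =>
      (fderiv ℝ (Function.uncurry f) z).comp (ContinuousLinearMap.inl ℝ E ℝ) :=
    (hf.continuous_fderiv one_ne_zero).clm_comp continuous_const
  rw [contDiff_one_iff_hasFDerivAt]
  refine ⟨fun x => ∫ s in (0 : ℝ)..1,
    (fderiv ℝ (Function.uncurry f) (x, s)).comp (ContinuousLinearMap.inl ℝ E ℝ), ?_, fun x => ?_⟩
  · exact intervalIntegral.continuous_parametric_intervalIntegral_of_continuous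
      (f := fun x s => (fderiv ℝ (Function.uncurry f) (x, s)).comp
        (ContinuousLinearMap.inl ℝ E ℝ)) hd continuous_const
  · obtain ⟨C, hC⟩ := ((isCompact_closedBall x 1).prod (isCompact_Icc (a := (0 : ℝ))
      (b := 1))).exists_bound_of_continuousOn hd.continuousOn
    have hfc : ∀ y, Continuous (f y) := fun y =>
      hf.continuous.comp (continuous_const.prodMk continuous_id)
    refine (intervalIntegral.hasFDerivAt_integral_of_dominated_of_fderiv_le (𝕜 := ℝ)
      (bound := fun _ => C) (F := f) (F' := fun x s =>
        (fderiv ℝ (Function.uncurry f) (x, s)).comp (ContinuousLinearMap.inl ℝ E ℝ))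
      (Metric.closedBall_mem_nhds x one_pos) ?_ ?_ ?_ ?_ ?_ ?_)
    · exact Eventually.of_forall fun y => (hfc y).aestronglyMeasurable
    · exact (hfc x).intervalIntegrable _ _
    · exact (hd.comp (continuous_const.prodMk continuous_id)).aestronglyMeasurable
    · refine Eventually.of_forall fun s hs y hy => hC (y, s) ⟨hy, ?_⟩
      rw [uIoc_of_le zero_le_one] at hs
      exact Ioc_subset_Icc_self hs
    · exact intervalIntegrable_const
    · refine Eventually.of_forall fun s _ y _ => ?_
      have h1 : HasFDerivAt (Function.uncurry f) _ (y, s) :=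
        (hf.differentiable one_ne_zero (y, s)).hasFDerivAt
      exact h1.comp (f := fun y : E => (y, s)) y (hasFDerivAt_prodMk_left y s)

/-- Away from 0 the derivative is elementary; the formula extends to 0 because p > 1 makes the
candidate derivative continuous there. With p = k + 1/2 this is where k > 1/2 yields a C¹ mass
density. -/
theorem contDiff_one_max_rpow {p : ℝ} (hp : 1 < p) : ContDiff ℝ 1 fun x : ℝ => max x 0 ^ p := by
  have hc : Continuous fun x : ℝ => p * max x 0 ^ (p - 1) :=
    continuous_const.mul ((by fun_prop : Continuous fun x : ℝ => max x 0).rpow_const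
      fun _ => Or.inr (by linarith))
  have hc' : Continuous fun x : ℝ => max x 0 ^ p :=
    (by fun_prop : Continuous fun x : ℝ => max x 0).rpow_const fun _ => Or.inr (by linarith)
  have hne : ∀ x : ℝ, x ≠ 0 → HasDerivAt (fun x : ℝ => max x 0 ^ p) (p * max x 0 ^ (p - 1)) x := by
    intro x hx
    rcases hx.lt_or_gt with h | h
    · have h1 : (fun x : ℝ => max x 0 ^ p) =ᶠ[𝓝 x] fun _ => 0 := by
        filter_upwards [Iio_mem_nhds h] with y hy
        rw [max_eq_right (le_of_lt hy), Real.zero_rpow (by linarith)]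
      rw [max_eq_right h.le, Real.zero_rpow (by linarith), mul_zero]
      exact (hasDerivAt_const x 0).congr_of_eventuallyEq h1
    · have h1 : (fun x : ℝ => max x 0 ^ p) =ᶠ[𝓝 x] fun x => x ^ p := by
        filter_upwards [Ioi_mem_nhds h] with y hy
        rw [max_eq_left (le_of_lt hy)]
      rw [max_eq_left h.le]
      exact (Real.hasDerivAt_rpow_const (Or.inl hx)).congr_of_eventuallyEq h1
  have hall : ∀ x, HasDerivAt (fun x : ℝ => max x 0 ^ p) (p * max x 0 ^ (p - 1)) x := by
    intro x
    rcases eq_or_ne x 0 with rfl | hx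
    · exact hasDerivAt_of_hasDerivAt_of_ne hne hc'.continuousAt hc.continuousAt
    · exact hne x hx
  rw [contDiff_one_iff_deriv]
  refine ⟨fun x => (hall x).differentiableAt, ?_⟩
  rw [funext fun x => (hall x).deriv]
  exact hc

/-! ### The mass density as a C¹ function of the potential. -/

namespace PlanarSteadyState

variable (S : PlanarSteadyState)

/-- The mass density as a function of the potential. -/
def marginal (u : ℝ) : ℝ := ∫ v : ℝ, S.α (v ^ 2 / 2 + u)

theorem massDensity_eq (x : ℝ) : S.massDensity S.U₀ x = S.marginal (S.U₀ x) := by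
  rw [PlanarAnsatz.massDensity, marginal, Measure.volume_eq_prod]
  simp only [PlanarAnsatz.phaseDensity]
  rw [integral_prod_mul (fun v : ℝ => S.α (v ^ 2 / 2 + S.U₀ x)) S.β, S.integral_β, mul_one]

theorem α_nonneg (E : ℝ) : 0 ≤ S.α E := by
  rcases S.polytrope_or_king with ⟨k, _, h⟩ | h
  · rw [h]
    split_ifs with h1
    · exact Real.rpow_nonneg (by linarith) _
    · exact le_rfl
  · rw [h]; exact le_max_right _ _

theorem α_eq_zero {E : ℝ} (h : S.E₀ ≤ E) : S.α E = 0 := by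
  by_contra h1
  exact absurd ((S.α_ne_zero_iff E).1 h1) (not_lt.2 h)

theorem continuous_α_comp (u : ℝ) : Continuous fun v : ℝ => S.α (v ^ 2 / 2 + u) :=
  S.continuous_α.comp (by fun_prop)

theorem integrable_α_comp (u : ℝ) : Integrable fun v : ℝ => S.α (v ^ 2 / 2 + u) := by
  refine (S.continuous_α_comp u).integrable_of_hasCompactSupport ?_
  refine HasCompactSupport.of_support_subset_isCompact
    (isCompact_closedBall (0 : ℝ) (√(2 * (S.E₀ - u)))) fun v hv => ?_
  have h1 := (S.α_ne_zero_iff _).1 hv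
  rw [mem_closedBall_zero_iff, Real.norm_eq_abs]
  exact Real.abs_le_sqrt (by linarith)

theorem marginal_nonneg (u : ℝ) : 0 ≤ S.marginal u := integral_nonneg fun _ => S.α_nonneg _

theorem marginal_eq_zero {u : ℝ} (hu : S.E₀ ≤ u) : S.marginal u = 0 := by
  have : ∀ v : ℝ, S.α (v ^ 2 / 2 + u) = 0 := fun v => S.α_eq_zero (by nlinarith [sq_nonneg v])
  simp [marginal, this]

theorem marginal_pos {u : ℝ} (hu : u < S.E₀) : 0 < S.marginal u := by
  refine (S.continuous_α_comp u).integral_pos_of_hasCompactSupport_nonneg_nonzero ?_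
    (fun _ => S.α_nonneg _) (x := 0) ?_
  · refine HasCompactSupport.of_support_subset_isCompact
      (isCompact_closedBall (0 : ℝ) (√(2 * (S.E₀ - u)))) fun v hv => ?_
    have h1 := (S.α_ne_zero_iff _).1 hv
    rw [mem_closedBall_zero_iff, Real.norm_eq_abs]
    exact Real.abs_le_sqrt (by linarith)
  · exact (S.α_ne_zero_iff _).2 (by simpa using hu)

/-- Differentiation under the integral: u ↦ α(v²/2 + u) is locally Lipschitz with a Gaussian
constant, and its kink v²/2 + u = E₀ is met, for fixed u, by at most two v. The same null set and
majorant give continuity of the derivative by dominated convergence. -/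
theorem contDiff_marginal_of_king (h : ∀ E, S.α E = max (Real.exp (S.E₀ - E) - 1) 0) :
    ContDiff ℝ 1 S.marginal := by
  have hnull : ∀ u : ℝ, ∀ᵐ v : ℝ, v ^ 2 / 2 + u ≠ S.E₀ := by
    intro u
    have hf : ({√(2 * (S.E₀ - u)), -√(2 * (S.E₀ - u))} : Set ℝ).Finite := by simp
    filter_upwards [hf.countable.ae_notMem volume] with v hv h1
    apply hv
    have h2 : v ^ 2 = 2 * (S.E₀ - u) := by linarith
    have h3 : √(2 * (S.E₀ - u)) = |v| := by rw [← h2, Real.sqrt_sq_eq_abs]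
    rw [h3, mem_insert_iff, mem_singleton_iff]
    rcases abs_choice v with h | h <;> rw [h] <;> simp
  let F' : ℝ → ℝ → ℝ := fun u v =>
    if v ^ 2 / 2 + u < S.E₀ then -Real.exp (S.E₀ - (v ^ 2 / 2 + u)) else 0
  have hgauss : ∀ c : ℝ, Integrable fun v : ℝ => Real.exp (c - v ^ 2 / 2) := by
    intro c
    have := (integrable_exp_neg_mul_sq (b := 1 / 2) (by norm_num)).const_mul (Real.exp c)
    refine this.congr (Eventually.of_forall fun v => ?_)
    dsimp only
    rw [← Real.exp_add]
    congr 1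
    ring
  have hF'm : ∀ u, Measurable (F' u) := by
    intro u
    refine Measurable.ite ?_ (by fun_prop) measurable_const
    exact measurableSet_lt (by fun_prop) measurable_const
  have hF'le : ∀ u₀ u v, u₀ - 1 ≤ u → ‖F' u v‖ ≤ Real.exp (S.E₀ - u₀ + 1 - v ^ 2 / 2) := by
    intro u₀ u v hu
    simp only [F']
    split_ifs
    · rw [norm_neg, Real.norm_eq_abs, Real.abs_exp]
      exact Real.exp_le_exp.2 (by linarith)
    · rw [norm_zero]; exact (Real.exp_pos _).le
  have hder : ∀ u, HasDerivAt S.marginal (∫ v, F' u v) u := by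
    intro u₀
    refine (hasDerivAt_integral_of_dominated_loc_of_lip (F := fun u v => S.α (v ^ 2 / 2 + u))
      (bound := fun v => Real.exp (S.E₀ - u₀ + 1 - v ^ 2 / 2)) (s := Ioi (u₀ - 1))
      (Ioi_mem_nhds (by linarith)) ?_ ?_ (hF'm u₀).aestronglyMeasurable ?_ (hgauss _) ?_).2
    · exact Eventually.of_forall fun u => (S.continuous_α_comp u).aestronglyMeasurable
    · exact S.integrable_α_comp u₀
    · refine Eventually.of_forall fun v => ?_
      refine LipschitzOnWith.of_dist_le_mul fun u hu u' hu' => ?_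
      rw [Real.dist_eq, Real.dist_eq, h, h]
      -- Truncation at 0 does not increase differences, so the mean value bound for the exponential
      -- suffices.
      refine (abs_max_sub_max_le_abs _ _ _).trans ?_
      have hL := (convex_Ioi (u₀ - 1)).norm_image_sub_le_of_norm_hasDerivWithin_le
        (f := fun u => Real.exp (S.E₀ - (v ^ 2 / 2 + u)) - 1)
        (f' := fun u => Real.exp (S.E₀ - (v ^ 2 / 2 + u)) * -1)
        (C := Real.exp (S.E₀ - u₀ + 1 - v ^ 2 / 2)) (fun y hy => ?_) (fun y hy => ?_) hu' hu
      · rw [Real.norm_eq_abs, Real.norm_eq_abs] at hL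
        rw [Real.coe_nnabs, Real.abs_exp]
        exact hL
      · exact (((((hasDerivAt_id y).const_add (v ^ 2 / 2)).const_sub S.E₀).exp).sub_const
          1).hasDerivWithinAt
      · rw [mul_neg_one, norm_neg, Real.norm_eq_abs, Real.abs_exp]
        exact Real.exp_le_exp.2 (by rw [mem_Ioi] at hy; linarith)
    · filter_upwards [hnull u₀] with v hv
      simp only [F']
      rcases hv.lt_or_gt with hlt | hgt
      · rw [if_pos hlt]
        have h1 : (fun u => S.α (v ^ 2 / 2 + u)) =ᶠ[𝓝 u₀]
            fun u => Real.exp (S.E₀ - (v ^ 2 / 2 + u)) - 1 := by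
          filter_upwards [Iio_mem_nhds (by linarith : u₀ < S.E₀ - v ^ 2 / 2)] with u hu
          rw [h, max_eq_left]
          rw [mem_Iio] at hu
          have := Real.one_le_exp (by linarith : 0 ≤ S.E₀ - (v ^ 2 / 2 + u))
          linarith
        refine HasDerivAt.congr_of_eventuallyEq ?_ h1
        have := ((((hasDerivAt_id u₀).const_add (v ^ 2 / 2)).const_sub S.E₀).exp).sub_const 1
        simpa using this
      · rw [if_neg (not_lt.2 hgt.le)]
        have h1 : (fun u => S.α (v ^ 2 / 2 + u)) =ᶠ[𝓝 u₀] fun _ => 0 := by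
          filter_upwards [Ioi_mem_nhds (by linarith : S.E₀ - v ^ 2 / 2 < u₀)] with u hu
          rw [mem_Ioi] at hu
          exact S.α_eq_zero (by linarith)
        exact (hasDerivAt_const u₀ 0).congr_of_eventuallyEq h1
  rw [contDiff_one_iff_deriv]
  refine ⟨fun u => (hder u).differentiableAt, ?_⟩
  rw [funext fun u => (hder u).deriv, continuous_iff_continuousAt]
  intro u₀
  refine continuousAt_of_dominated (bound := fun v => Real.exp (S.E₀ - u₀ + 1 - v ^ 2 / 2))
    (Eventually.of_forall fun u => (hF'm u).aestronglyMeasurable) ?_ (hgauss _) ?_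
  · filter_upwards [Ioi_mem_nhds (by linarith : u₀ - 1 < u₀)] with u hu
    exact Eventually.of_forall fun v => hF'le u₀ u v (le_of_lt hu)
  · filter_upwards [hnull u₀] with v hv
    simp only [F']
    rcases hv.lt_or_gt with hlt | hgt
    · have h1 : (fun u => if v ^ 2 / 2 + u < S.E₀ then -Real.exp (S.E₀ - (v ^ 2 / 2 + u)) else 0)
          =ᶠ[𝓝 u₀] fun u => -Real.exp (S.E₀ - (v ^ 2 / 2 + u)) := by
        filter_upwards [Iio_mem_nhds (by linarith : u₀ < S.E₀ - v ^ 2 / 2)] with u hu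
        rw [mem_Iio] at hu
        rw [if_pos (by linarith)]
      rw [continuousAt_congr h1]
      fun_prop
    · have h1 : (fun u => if v ^ 2 / 2 + u < S.E₀ then -Real.exp (S.E₀ - (v ^ 2 / 2 + u)) else 0)
          =ᶠ[𝓝 u₀] fun _ => 0 := by
        filter_upwards [Ioi_mem_nhds (by linarith : S.E₀ - v ^ 2 / 2 < u₀)] with u hu
        rw [mem_Ioi] at hu
        rw [if_neg (by linarith)]
      rw [continuousAt_congr h1]
      fun_prop

/-- The substitution v = √(E₀ - u) s shows the marginal to be a constant multiple of (E₀ - u)₊ to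
the power k + 1/2. -/
theorem contDiff_marginal_of_polytrope {k : ℝ} (hk : 1 / 2 < k)
    (h : ∀ E, S.α E = if E < S.E₀ then (S.E₀ - E) ^ k else 0) : ContDiff ℝ 1 S.marginal := by
  have hα : ∀ E, S.α E = max (S.E₀ - E) 0 ^ k := by
    intro E
    rw [h]
    split_ifs with h1
    · rw [max_eq_left (by linarith)]
    · rw [max_eq_right (by linarith), Real.zero_rpow (by linarith)]
  have key : S.marginal = fun u =>
      max (S.E₀ - u) 0 ^ (k + 1 / 2) * ∫ s : ℝ, max (1 - s ^ 2 / 2) 0 ^ k := by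
    funext u
    rcases le_or_gt S.E₀ u with hu | hu
    · rw [S.marginal_eq_zero hu, max_eq_right (by linarith), Real.zero_rpow (by linarith),
        zero_mul]
    · have hW : 0 < S.E₀ - u := by linarith
      have hsq : 0 < √(S.E₀ - u) := Real.sqrt_pos.2 hW
      have h1 := Measure.integral_comp_mul_left (fun v => S.α (v ^ 2 / 2 + u)) (√(S.E₀ - u))
      have h2 : ∀ s, S.α ((√(S.E₀ - u) * s) ^ 2 / 2 + u) =
          (S.E₀ - u) ^ k * max (1 - s ^ 2 / 2) 0 ^ k := by
        intro s
        rw [hα, ← Real.mul_rpow hW.le (le_max_right _ _), mul_max_of_nonneg _ _ hW.le, mul_zero,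
          mul_pow, Real.sq_sqrt hW.le]
        congr 2
        ring
      simp only [h2] at h1
      rw [integral_const_mul, abs_of_pos (inv_pos.2 hsq), smul_eq_mul, inv_mul_eq_div,
        eq_div_iff hsq.ne'] at h1
      rw [marginal, ← h1, max_eq_left hW.le, Real.rpow_add hW, Real.sqrt_eq_rpow]
      ring
  rw [key]
  exact ((contDiff_one_max_rpow (by linarith)).comp
    (contDiff_const.sub contDiff_id)).mul contDiff_const

theorem contDiff_marginal : ContDiff ℝ 1 S.marginal := by
  rcases S.polytrope_or_king with ⟨k, hk, h⟩ | h
  · exact S.contDiff_marginal_of_polytrope hk h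
  · exact S.contDiff_marginal_of_king h

end PlanarSteadyState

/-! ### Regularity of the potential and the radial coordinate r(x). -/

namespace PlanarSteadyState

variable (S : PlanarSteadyState)

/-- The second derivative of the potential. -/
def curv (x : ℝ) : ℝ := 4 * Real.pi * S.marginal (S.U₀ x)

theorem continuous_curv : Continuous S.curv :=
  continuous_const.mul (S.contDiff_marginal.continuous.comp S.continuous_U₀)

theorem curv_nonneg (x : ℝ) : 0 ≤ S.curv x :=
  mul_nonneg (by positivity) (S.marginal_nonneg _)

theorem curv_neg (x : ℝ) : S.curv (-x) = S.curv x := by rw [curv, S.U₀_neg, curv]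

/-- x ↦ |x - y| is 1-Lipschitz and differentiable for x ≠ y, so ρ₀ itself dominates the difference
quotients. -/
theorem hasDerivAt_U₀_aux (x : ℝ) :
    HasDerivAt S.U₀ (2 * Real.pi * ∫ y, (SignType.sign (x - y) : ℝ) * S.massDensity S.U₀ y) x := by
  refine HasDerivAt.congr_of_eventuallyEq ?_ (Eventually.of_forall S.poisson)
  refine HasDerivAt.const_mul _ ?_
  have hint := S.integrable_massDensity
  refine (hasDerivAt_integral_of_dominated_loc_of_lip
    (F := fun x y => |x - y| * S.massDensity S.U₀ y)
    (bound := fun y => S.massDensity S.U₀ y) (s := univ) univ_mem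
    (Eventually.of_forall fun u => (S.integrable_kernel u).aestronglyMeasurable)
    (S.integrable_kernel x) ?_ ?_ hint ?_).2
  · refine AEStronglyMeasurable.mul ?_ hint.aestronglyMeasurable
    have h1 : (fun y => (SignType.sign (x - y) : ℝ)) =
        fun y => if y < x then 1 else if x < y then -1 else 0 := by
      funext y
      simp only [sign_apply, sub_pos, sub_neg]
      split_ifs <;> simp
    rw [h1]
    exact (Measurable.ite measurableSet_Iio measurable_const
      (Measurable.ite measurableSet_Ioi measurable_const measurable_const)).aestronglyMeasurable
  · refine Eventually.of_forall fun y => LipschitzOnWith.of_dist_le_mul fun u _ u' _ => ?_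
    rw [Real.dist_eq, Real.dist_eq, Real.coe_nnabs, ← sub_mul, abs_mul, mul_comm]
    refine mul_le_mul_of_nonneg_left ?_ (abs_nonneg _)
    have := abs_abs_sub_abs_le_abs_sub (u - y) (u' - y)
    simpa using this
  · filter_upwards [(countable_singleton x).ae_notMem volume] with y hy
    have hne : x - y ≠ 0 := fun h => hy (by rw [mem_singleton_iff]; linarith)
    have h1 := (hasDerivAt_abs hne).comp x ((hasDerivAt_id x).sub_const y)
    rw [mul_one] at h1
    exact h1.mul_const _

/-- Almost everywhere sign(x - y) = 2·1_{y ≤ x} - 1; in this form U₀' is visibly an indefinite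
integral of 4πρ₀. -/
theorem force_eq (x : ℝ) :
    2 * Real.pi * ∫ y, (SignType.sign (x - y) : ℝ) * S.massDensity S.U₀ y =
      4 * Real.pi * (∫ y in Iic x, S.massDensity S.U₀ y) -
        2 * Real.pi * ∫ y, S.massDensity S.U₀ y := by
  have hint := S.integrable_massDensity
  have h1 : ∫ y, (SignType.sign (x - y) : ℝ) * S.massDensity S.U₀ y =
      ∫ y, (2 * (Iic x).indicator (S.massDensity S.U₀) y - S.massDensity S.U₀ y) := by
    refine integral_congr_ae ?_
    filter_upwards [(countable_singleton x).ae_notMem volume] with y hy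
    rcases lt_trichotomy y x with h | h | h
    · rw [indicator_of_mem (show y ∈ Iic x from h.le), sign_pos (by linarith)]
      simp; ring
    · exact absurd h hy
    · rw [indicator_of_notMem (show y ∉ Iic x from not_le.2 h), sign_neg (by linarith)]
      simp
  rw [h1, integral_sub ((hint.indicator measurableSet_Iic).const_mul 2) hint, integral_const_mul,
    integral_indicator measurableSet_Iic]
  ring

/-- U₀ is even, so U₀'(0) = 0 fixes the constant of integration. -/
theorem deriv_U₀_eq (x : ℝ) : deriv S.U₀ x = ∫ y in (0 : ℝ)..x, S.curv y := by
  have hint := S.integrable_massDensity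
  have hd : ∀ x, deriv S.U₀ x = 4 * Real.pi * (∫ y in Iic x, S.massDensity S.U₀ y) -
      2 * Real.pi * ∫ y, S.massDensity S.U₀ y := fun x => by
    rw [(S.hasDerivAt_U₀_aux x).deriv, S.force_eq]
  have h0 : deriv S.U₀ 0 = 0 := by
    have h1 : deriv (fun x => S.U₀ (-x)) 0 = -deriv S.U₀ 0 := by
      rw [deriv_comp_neg, neg_zero]
    rw [funext S.U₀_neg] at h1
    change deriv S.U₀ 0 = _ at h1
    linarith
  have h2 : deriv S.U₀ x = deriv S.U₀ x - deriv S.U₀ 0 := by rw [h0, sub_zero]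
  rw [h2, hd x, hd 0]
  have := intervalIntegral.integral_Iic_sub_Iic (μ := volume) (f := S.massDensity S.U₀)
    (a := 0) (b := x) hint.integrableOn hint.integrableOn
  calc _ = 4 * Real.pi * ((∫ y in Iic x, S.massDensity S.U₀ y) -
        ∫ y in Iic 0, S.massDensity S.U₀ y) := by ring
    _ = _ := by
      rw [this, ← intervalIntegral.integral_const_mul]
      simp only [curv, S.massDensity_eq]

theorem differentiable_U₀ : Differentiable ℝ S.U₀ := fun x =>
  (S.hasDerivAt_U₀_aux x).differentiableAt

theorem hasDerivAt_U₀ (x : ℝ) : HasDerivAt S.U₀ (deriv S.U₀ x) x :=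
  (S.differentiable_U₀ x).hasDerivAt

theorem hasDerivAt_deriv_U₀ (x : ℝ) : HasDerivAt (deriv S.U₀) (S.curv x) x := by
  rw [funext S.deriv_U₀_eq]
  exact intervalIntegral.integral_hasDerivAt_right (S.continuous_curv.intervalIntegrable _ _)
    (S.continuous_curv.stronglyMeasurableAtFilter _ _) S.continuous_curv.continuousAt

theorem contDiff_deriv_U₀ : ContDiff ℝ 1 (deriv S.U₀) := by
  rw [contDiff_one_iff_deriv]
  refine ⟨fun x => (S.hasDerivAt_deriv_U₀ x).differentiableAt, ?_⟩
  rw [funext fun x => (S.hasDerivAt_deriv_U₀ x).deriv]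
  exact S.continuous_curv

theorem contDiff_U₀ : ContDiff ℝ 1 S.U₀ := by
  rw [contDiff_one_iff_deriv]
  exact ⟨S.differentiable_U₀, S.contDiff_deriv_U₀.continuous⟩

theorem contDiff_curv : ContDiff ℝ 1 S.curv :=
  contDiff_const.mul (S.contDiff_marginal.comp S.contDiff_U₀)

/-- The quotient `U₀'(x) / x`. -/
def forceQuot (x : ℝ) : ℝ := ∫ s in (0 : ℝ)..1, S.curv (x * s)

/-- The quotient `(U₀(x) - U₀(0)) / x²`. -/
def potQuot (x : ℝ) : ℝ := ∫ s in (0 : ℝ)..1, s * S.forceQuot (x * s)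

/-- The quotients are defined as averages over the fixed interval [0, 1], so that they inherit the
C¹ regularity of `curv`, also across x = 0 where division would lose it. -/
theorem contDiff_forceQuot : ContDiff ℝ 1 S.forceQuot :=
  ContDiff.intervalIntegral_one (f := fun x s => S.curv (x * s))
    (S.contDiff_curv.comp (contDiff_fst.mul contDiff_snd))

theorem contDiff_potQuot : ContDiff ℝ 1 S.potQuot :=
  ContDiff.intervalIntegral_one (f := fun x s => s * S.forceQuot (x * s))
    (contDiff_snd.mul (S.contDiff_forceQuot.comp (contDiff_fst.mul contDiff_snd)))

theorem deriv_U₀ (x : ℝ) : deriv S.U₀ x = x * S.forceQuot x := by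
  rw [S.deriv_U₀_eq, forceQuot]
  have := intervalIntegral.smul_integral_comp_mul_left (a := 0) (b := 1) S.curv x
  rw [mul_zero, mul_one, smul_eq_mul] at this
  rw [this]

theorem U₀_sub (x : ℝ) : S.U₀ x - S.U₀ 0 = x ^ 2 * S.potQuot x := by
  have h1 := intervalIntegral.integral_eq_sub_of_hasDerivAt (a := 0) (b := x)
    (f := S.U₀) (f' := deriv S.U₀) (fun y _ => S.hasDerivAt_U₀ y)
    (S.contDiff_deriv_U₀.continuous.intervalIntegrable _ _)
  have h2 := intervalIntegral.smul_integral_comp_mul_left (a := 0) (b := 1)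
    (deriv S.U₀) x
  rw [mul_zero, mul_one, smul_eq_mul] at h2
  have h3 : ∫ s in (0 : ℝ)..1, deriv S.U₀ (x * s) = x * S.potQuot x := by
    rw [potQuot, ← intervalIntegral.integral_const_mul]
    refine intervalIntegral.integral_congr (μ := volume) fun s _ => ?_
    simp only [S.deriv_U₀]
    ring
  rw [← h1, ← h2, h3]
  ring

/-- U₀ is minimal at 0 since U₀'' ≥ 0. If this minimum were at least E₀, there would be no mass. -/
theorem U₀_zero_lt : S.U₀ 0 < S.E₀ := by
  by_contra! h
  have hp : ∀ x, 0 ≤ S.potQuot x := fun x =>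
    intervalIntegral.integral_nonneg zero_le_one fun s hs => mul_nonneg hs.1
      (intervalIntegral.integral_nonneg zero_le_one fun t _ => S.curv_nonneg _)
  have : ∀ x, S.massDensity S.U₀ x = 0 := fun x => by
    rw [S.massDensity_eq]
    refine S.marginal_eq_zero (h.trans ?_)
    have := S.U₀_sub x
    nlinarith [hp x, sq_nonneg x, mul_nonneg (sq_nonneg x) (hp x)]
  have h1 := S.mass_pos
  simp [this] at h1

theorem curv_zero_pos : 0 < S.curv 0 :=
  mul_pos (by positivity) (S.marginal_pos S.U₀_zero_lt)

theorem forceQuot_pos (x : ℝ) : 0 < S.forceQuot x := by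
  refine intervalIntegral.integral_pos zero_lt_one
    (S.continuous_curv.comp (by fun_prop)).continuousOn (fun s _ => S.curv_nonneg _)
    ⟨0, ⟨le_rfl, zero_le_one⟩, ?_⟩
  rw [mul_zero]
  exact S.curv_zero_pos

theorem potQuot_pos (x : ℝ) : 0 < S.potQuot x := by
  refine intervalIntegral.integral_pos zero_lt_one
    (continuous_id.mul (S.contDiff_forceQuot.continuous.comp (by fun_prop))).continuousOn
    (fun s hs => mul_nonneg hs.1.le (S.forceQuot_pos _).le) ⟨1, ⟨zero_le_one, le_rfl⟩, ?_⟩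
  exact mul_pos one_pos (S.forceQuot_pos _)

theorem forceQuot_neg (x : ℝ) : S.forceQuot (-x) = S.forceQuot x := by
  simp only [forceQuot, neg_mul, S.curv_neg]

theorem potQuot_neg (x : ℝ) : S.potQuot (-x) = S.potQuot x := by
  simp only [potQuot, neg_mul, S.forceQuot_neg]

/-- The coordinate `r` with `U₀(x) = U₀(0) + r(x)² / 2`. -/
def radial (x : ℝ) : ℝ := x * √(2 * S.potQuot x)

/-- The derivative of `radial`. -/
def radialSpeed (x : ℝ) : ℝ := S.forceQuot x / √(2 * S.potQuot x)

theorem sqrt_potQuot_pos (x : ℝ) : 0 < √(2 * S.potQuot x) :=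
  Real.sqrt_pos.2 (mul_pos two_pos (S.potQuot_pos x))

theorem contDiff_sqrt_potQuot : ContDiff ℝ 1 fun x => √(2 * S.potQuot x) :=
  (contDiff_const.mul S.contDiff_potQuot).sqrt fun x => (mul_pos two_pos (S.potQuot_pos x)).ne'

/-- A Morse-type coordinate: `potQuot` is positive, so its square root costs no regularity, although
r is a signed root of 2(U₀ - U₀(0)), which vanishes at 0. -/
theorem contDiff_radial : ContDiff ℝ 1 S.radial := contDiff_id.mul S.contDiff_sqrt_potQuot

theorem contDiff_radialSpeed : ContDiff ℝ 1 S.radialSpeed :=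
  S.contDiff_forceQuot.div S.contDiff_sqrt_potQuot fun x => (S.sqrt_potQuot_pos x).ne'

theorem radialSpeed_pos (x : ℝ) : 0 < S.radialSpeed x :=
  div_pos (S.forceQuot_pos x) (S.sqrt_potQuot_pos x)

theorem radial_sq (x : ℝ) : S.radial x ^ 2 = 2 * (S.U₀ x - S.U₀ 0) := by
  rw [radial, mul_pow, Real.sq_sqrt (mul_pos two_pos (S.potQuot_pos x)).le, S.U₀_sub]
  ring

theorem radial_mul_radialSpeed (x : ℝ) : S.radial x * S.radialSpeed x = deriv S.U₀ x := by
  rw [radial, radialSpeed, S.deriv_U₀]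
  have := (S.sqrt_potQuot_pos x).ne'
  field_simp

theorem radial_zero : S.radial 0 = 0 := by simp [radial]

theorem radial_neg (x : ℝ) : S.radial (-x) = -S.radial x := by
  simp [radial, S.potQuot_neg]

theorem radialSpeed_neg (x : ℝ) : S.radialSpeed (-x) = S.radialSpeed x := by
  simp [radialSpeed, S.potQuot_neg, S.forceQuot_neg]

theorem radialSpeed_zero : S.radialSpeed 0 = √(S.curv 0) := by
  have h1 : S.forceQuot 0 = S.curv 0 := by simp [forceQuot]
  have h2 : 2 * S.potQuot 0 = S.curv 0 := by simp [potQuot, h1]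
  rw [radialSpeed, h1, h2, Real.div_sqrt]

/-- For x ≠ 0 differentiate r² = 2(U₀ - U₀(0)) and divide by 2r; at 0 the product rule applies.
Since `radialSpeed` is itself C¹, r is in effect C², which the regularity of `slowness` requires. -/
theorem hasDerivAt_radial (x : ℝ) : HasDerivAt S.radial (S.radialSpeed x) x := by
  rcases eq_or_ne x 0 with rfl | hx
  · have h1 := (hasDerivAt_id (0 : ℝ)).mul
      (S.contDiff_sqrt_potQuot.differentiable one_ne_zero 0).hasDerivAt
    have h2 : 2 * S.potQuot 0 = S.curv 0 := by simp [potQuot, forceQuot]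
    have h3 : S.radialSpeed 0 = √(2 * S.potQuot 0) := by rw [S.radialSpeed_zero, h2]
    rw [h3]
    refine h1.congr_deriv ?_
    simp
  · have hd := (S.contDiff_radial.differentiable one_ne_zero x).hasDerivAt
    have h1 := hd.pow 2
    have h2 : HasDerivAt (fun x => S.radial x ^ 2) (2 * deriv S.U₀ x) x := by
      rw [funext S.radial_sq]
      exact ((S.hasDerivAt_U₀ x).sub_const _).const_mul 2
    have h3 := h1.unique h2
    have hr : S.radial x ≠ 0 := mul_ne_zero hx (S.sqrt_potQuot_pos x).ne'
    rw [← S.radial_mul_radialSpeed] at h3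
    have h4 : deriv S.radial x = S.radialSpeed x := by
      refine mul_left_cancel₀ (mul_ne_zero two_ne_zero hr) ?_
      have : (2 : ℝ) * S.radial x * deriv S.radial x = 2 * (S.radial x * S.radialSpeed x) := by
        rw [← h3]; norm_num
      rw [this]; ring
    rwa [h4] at hd

theorem strictMono_radial : StrictMono S.radial :=
  strictMono_of_deriv_pos fun x => by
    rw [(S.hasDerivAt_radial x).deriv]; exact S.radialSpeed_pos x

/-- U₀' is nondecreasing with U₀'(1) > 0, so U₀ grows at least linearly. -/
theorem tendsto_radial_atTop : Tendsto S.radial atTop atTop := by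
  have hb := S.forceQuot_pos 1
  have hder : ∀ x ∈ interior (Ici (1 : ℝ)), S.forceQuot 1 ≤ deriv S.U₀ x := by
    intro x hx
    rw [interior_Ici, mem_Ioi] at hx
    have hmono : Monotone (deriv S.U₀) := monotone_of_deriv_nonneg
      (fun x => (S.hasDerivAt_deriv_U₀ x).differentiableAt)
      fun x => by rw [(S.hasDerivAt_deriv_U₀ x).deriv]; exact S.curv_nonneg x
    have := hmono hx.le
    rwa [S.deriv_U₀ 1, one_mul] at this
  have hlow : ∀ x, 1 ≤ x → S.U₀ 1 + S.forceQuot 1 * (x - 1) ≤ S.U₀ x := by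
    intro x hx
    have := (convex_Ici (1 : ℝ)).mul_sub_le_image_sub_of_le_deriv S.continuous_U₀.continuousOn
      S.differentiable_U₀.differentiableOn hder 1 self_mem_Ici x hx hx
    linarith
  have hU : Tendsto S.U₀ atTop atTop := by
    refine tendsto_atTop_mono' atTop ?_ (tendsto_atTop_add_const_left atTop (S.U₀ 1)
      ((tendsto_id.atTop_add (tendsto_const_nhds (x := (-1 : ℝ)))).const_mul_atTop hb))
    filter_upwards [eventually_ge_atTop 1] with x hx
    simpa [sub_eq_add_neg] using hlow x hx
  have h2 : Tendsto (fun x => √(2 * (S.U₀ x - S.U₀ 0))) atTop atTop :=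
    Real.tendsto_sqrt_atTop.comp ((tendsto_atTop_add_const_right _ (-S.U₀ 0) hU).const_mul_atTop
      two_pos)
  refine h2.congr' ?_
  filter_upwards [eventually_ge_atTop 0] with x hx
  rw [← S.radial_sq, Real.sqrt_sq]
  exact mul_nonneg hx (Real.sqrt_nonneg _)

theorem surjective_radial : Function.Surjective S.radial := by
  refine S.contDiff_radial.continuous.surjective S.tendsto_radial_atTop ?_
  have h1 : Tendsto (fun x => -S.radial (-x)) atBot atBot :=
    tendsto_neg_atTop_atBot.comp (S.tendsto_radial_atTop.comp tendsto_neg_atBot_atTop)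
  refine h1.congr fun x => ?_
  rw [S.radial_neg, neg_neg]

/-- `radial` as a homeomorphism of the line. -/
def radialHomeo : ℝ ≃ₜ ℝ :=
  (S.strictMono_radial.orderIsoOfSurjective S.radial S.surjective_radial).toHomeomorph

/-- The inverse of `radial`. -/
def position (r : ℝ) : ℝ := S.radialHomeo.symm r

theorem radial_position (r : ℝ) : S.radial (S.position r) = r := S.radialHomeo.apply_symm_apply r

theorem position_radial (x : ℝ) : S.position (S.radial x) = x := S.radialHomeo.symm_apply_apply x

theorem position_neg (r : ℝ) : S.position (-r) = -S.position r := by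
  apply S.strictMono_radial.injective
  rw [S.radial_position, S.radial_neg, S.radial_position]

theorem contDiff_position : ContDiff ℝ 1 S.position :=
  S.radialHomeo.contDiff_symm_deriv (fun x => (S.radialSpeed_pos x).ne') S.hasDerivAt_radial
    S.contDiff_radial

theorem hasDerivAt_position (r : ℝ) :
    HasDerivAt S.position (S.radialSpeed (S.position r))⁻¹ r := by
  refine HasDerivAt.of_local_left_inverse S.contDiff_position.continuous.continuousAt
    (S.hasDerivAt_radial _) (S.radialSpeed_pos _).ne' ?_
  exact Eventually.of_forall S.radial_position

/-- The slowness `1 / r'(x)` as a function of `r`. -/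
def slowness (r : ℝ) : ℝ := (S.radialSpeed (S.position r))⁻¹

theorem slowness_pos (r : ℝ) : 0 < S.slowness r := inv_pos.2 (S.radialSpeed_pos _)

theorem contDiff_slowness : ContDiff ℝ 1 S.slowness :=
  (S.contDiff_radialSpeed.comp S.contDiff_position).inv fun _ => (S.radialSpeed_pos _).ne'

theorem slowness_neg (r : ℝ) : S.slowness (-r) = S.slowness r := by
  rw [slowness, S.position_neg, S.radialSpeed_neg, slowness]

theorem slowness_zero : S.slowness 0 = (√(S.curv 0))⁻¹ := by
  have : S.position 0 = 0 := by
    have := S.position_radial 0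
    rwa [S.radial_zero] at this
  rw [slowness, this, S.radialSpeed_zero]

end PlanarSteadyState

/-! ### Elapsed time along orbits and the angle variable. -/

namespace PlanarSteadyState

variable (S : PlanarSteadyState)

/-- The time needed to reach the polar angle `φ` on the orbit of radius `R`. -/
def angleTime (R φ : ℝ) : ℝ := ∫ s in (0 : ℝ)..φ, S.slowness (R * Real.sin s)

/-- The period of the orbit of radius `R`. -/
def radialPeriod (R : ℝ) : ℝ := S.angleTime R (2 * Real.pi)

theorem continuous_slowness_sin (R : ℝ) : Continuous fun s => S.slowness (R * Real.sin s) :=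
  S.contDiff_slowness.continuous.comp (by fun_prop)

theorem intervalIntegrable_slowness_sin (R a b : ℝ) :
    IntervalIntegrable (fun s => S.slowness (R * Real.sin s)) volume a b :=
  (S.continuous_slowness_sin R).intervalIntegrable _ _

theorem angleTime_sub (R φ ψ : ℝ) :
    S.angleTime R φ - S.angleTime R ψ = ∫ s in ψ..φ, S.slowness (R * Real.sin s) :=
  intervalIntegral.integral_interval_sub_left (S.intervalIntegrable_slowness_sin _ _ _)
    (S.intervalIntegrable_slowness_sin _ _ _)

/-- Rescaling the integral to [0, 1] moves the angle into the integrand and leaves a parametric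
integral of a C¹ function. -/
theorem contDiff_angleTime : ContDiff ℝ 1 fun p : ℝ × ℝ => S.angleTime p.1 p.2 := by
  have h1 : ContDiff ℝ 1 fun p : ℝ × ℝ =>
      ∫ s in (0 : ℝ)..1, S.slowness (p.1 * Real.sin (p.2 * s)) :=
    ContDiff.intervalIntegral_one (f := fun (p : ℝ × ℝ) s =>
      S.slowness (p.1 * Real.sin (p.2 * s))) (S.contDiff_slowness.comp (by fun_prop))
  have h2 : (fun p : ℝ × ℝ => S.angleTime p.1 p.2) = fun p =>
      p.2 * ∫ s in (0 : ℝ)..1, S.slowness (p.1 * Real.sin (p.2 * s)) := by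
    funext p
    have := intervalIntegral.smul_integral_comp_mul_left (a := 0) (b := 1)
      (fun s => S.slowness (p.1 * Real.sin s)) p.2
    rw [mul_zero, mul_one, smul_eq_mul] at this
    rw [this, angleTime]
  rw [h2]
  exact contDiff_snd.mul h1

theorem contDiff_radialPeriod : ContDiff ℝ 1 S.radialPeriod :=
  S.contDiff_angleTime.comp (f := fun R : ℝ => (R, 2 * Real.pi))
    (contDiff_id.prodMk contDiff_const)

theorem hasDerivAt_angleTime (R φ : ℝ) :
    HasDerivAt (S.angleTime R) (S.slowness (R * Real.sin φ)) φ :=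
  intervalIntegral.integral_hasDerivAt_right (S.intervalIntegrable_slowness_sin _ _ _)
    ((S.continuous_slowness_sin R).stronglyMeasurableAtFilter _ _)
    (S.continuous_slowness_sin R).continuousAt

theorem strictMono_angleTime (R : ℝ) : StrictMono (S.angleTime R) :=
  strictMono_of_deriv_pos fun φ => by
    rw [(S.hasDerivAt_angleTime R φ).deriv]; exact S.slowness_pos _

theorem angleTime_zero (R : ℝ) : S.angleTime R 0 = 0 := intervalIntegral.integral_same

theorem radialPeriod_pos (R : ℝ) : 0 < S.radialPeriod R := by
  rw [← S.angleTime_zero R]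
  exact S.strictMono_angleTime R Real.two_pi_pos

theorem periodic_slowness_sin (R : ℝ) :
    Function.Periodic (fun s => S.slowness (R * Real.sin s)) (2 * Real.pi) := fun s => by
  simp only [Real.sin_add_two_pi]

theorem angleTime_add_zsmul (R φ : ℝ) (n : ℤ) :
    S.angleTime R (φ + n • (2 * Real.pi)) = S.angleTime R φ + n * S.radialPeriod R := by
  have h1 := (S.periodic_slowness_sin R).intervalIntegral_add_zsmul_eq n φ
    (S.intervalIntegrable_slowness_sin R)
  have h2 := (S.periodic_slowness_sin R).intervalIntegral_add_eq φ 0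
  rw [← S.angleTime_sub, h2, zero_add] at h1
  rw [radialPeriod, ← zsmul_eq_mul]
  exact sub_eq_iff_eq_add'.1 h1

theorem angleTime_neg (R φ : ℝ) : S.angleTime R (-φ) = -S.angleTime R φ := by
  have := intervalIntegral.integral_comp_neg (a := 0) (b := φ)
    (fun s => S.slowness (R * Real.sin s))
  simp only [Real.sin_neg, mul_neg, S.slowness_neg, neg_zero] at this
  rw [angleTime, angleTime, this, intervalIntegral.integral_symm]

/-- sin(s + π) = -sin s and `slowness` is even, so both halves of a turn take the same time. -/
theorem angleTime_add_pi (R φ : ℝ) :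
    S.angleTime R (φ + Real.pi) = S.angleTime R φ + S.radialPeriod R / 2 := by
  have key : ∀ φ, S.angleTime R (φ + Real.pi) = S.angleTime R φ + S.angleTime R Real.pi := by
    intro φ
    have h1 := intervalIntegral.integral_comp_add_right (a := 0) (b := φ)
      (fun s => S.slowness (R * Real.sin s)) Real.pi
    simp only [Real.sin_add_pi, mul_neg, S.slowness_neg, zero_add] at h1
    rw [← S.angleTime_sub, ← S.angleTime_sub, S.angleTime_zero, sub_zero] at h1
    exact (sub_eq_iff_eq_add.1 h1.symm)
  have h2 := key Real.pi
  rw [← two_mul] at h2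
  rw [key, radialPeriod, h2]
  ring

theorem angleTime_pi_sub (R φ : ℝ) :
    S.angleTime R (Real.pi - φ) = S.radialPeriod R / 2 - S.angleTime R φ := by
  rw [sub_eq_neg_add, S.angleTime_add_pi, S.angleTime_neg]
  ring

/-- The exponential of the angle variable, in polar coordinates. -/
def polarAngleExp (R φ : ℝ) : ℂ :=
  Complex.exp (((2 * Real.pi * (S.angleTime R φ / S.radialPeriod R) : ℝ) : ℂ) * Complex.I)

theorem contDiff_polarAngleExp : ContDiff ℝ 1 fun p : ℝ × ℝ => S.polarAngleExp p.1 p.2 := by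
  have h1 : ContDiff ℝ 1 fun p : ℝ × ℝ =>
      2 * Real.pi * (S.angleTime p.1 p.2 / S.radialPeriod p.1) :=
    contDiff_const.mul (S.contDiff_angleTime.div (S.contDiff_radialPeriod.comp contDiff_fst)
      fun p => (S.radialPeriod_pos _).ne')
  exact Complex.contDiff_exp.comp ((Complex.ofRealCLM.contDiff.comp h1).mul contDiff_const)

theorem hasDerivAt_polarAngleExp (R φ : ℝ) :
    HasDerivAt (S.polarAngleExp R) ((S.slowness (R * Real.sin φ) : ℝ) *
      ((2 * Real.pi / S.radialPeriod R : ℝ) * Complex.I * S.polarAngleExp R φ)) φ := by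
  have h1 := ((((S.hasDerivAt_angleTime R φ).div_const (S.radialPeriod R)).const_mul
    (2 * Real.pi)).ofReal_comp.mul_const Complex.I).cexp
  refine h1.congr_deriv ?_
  rw [polarAngleExp]
  push_cast
  ring

/-- A full turn adds a whole period, hence a multiple of 2πi in the exponent; the choice of the
argument of a complex number is therefore immaterial. -/
theorem polarAngleExp_congr {R φ ψ : ℝ} (h : (φ : Real.Angle) = ψ) :
    S.polarAngleExp R φ = S.polarAngleExp R ψ := by
  obtain ⟨n, hn⟩ := Real.Angle.angle_eq_iff_two_pi_dvd_sub.1 h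
  have h1 : φ = ψ + n • (2 * Real.pi) := by rw [zsmul_eq_mul]; linarith
  have hP := (S.radialPeriod_pos R).ne'
  rw [polarAngleExp, polarAngleExp, h1, S.angleTime_add_zsmul, Complex.exp_eq_exp_iff_exists_int]
  refine ⟨n, ?_⟩
  rw [add_div, mul_div_cancel_right₀ _ hP]
  push_cast
  ring

/-- Elapsed time increases strictly with the polar angle, so times equal modulo the period mean
angles equal modulo 2π. -/
theorem angle_eq_of_polarAngleExp_eq {R φ ψ : ℝ} (h : S.polarAngleExp R φ = S.polarAngleExp R ψ) :
    (φ : Real.Angle) = ψ := by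
  have hP := (S.radialPeriod_pos R).ne'
  rw [polarAngleExp, polarAngleExp, Complex.exp_eq_exp_iff_exists_int] at h
  obtain ⟨n, hn⟩ := h
  have h1 : 2 * Real.pi * (S.angleTime R φ / S.radialPeriod R) =
      2 * Real.pi * (S.angleTime R ψ / S.radialPeriod R) + n * (2 * Real.pi) := by
    have h2 : (((2 * Real.pi * (S.angleTime R φ / S.radialPeriod R) : ℝ) : ℂ)) * Complex.I =
      ((2 * Real.pi * (S.angleTime R ψ / S.radialPeriod R) + n * (2 * Real.pi) : ℝ) : ℂ) *
        Complex.I := by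
      rw [hn]; push_cast; ring
    exact_mod_cast mul_right_cancel₀ Complex.I_ne_zero h2
  have h3 : S.angleTime R φ = S.angleTime R (ψ + n • (2 * Real.pi)) := by
    rw [S.angleTime_add_zsmul]
    have hpi := Real.two_pi_pos.ne'
    have h4 : S.angleTime R φ / S.radialPeriod R = S.angleTime R ψ / S.radialPeriod R + n := by
      refine mul_left_cancel₀ hpi ?_
      rw [h1]; ring
    field_simp at h4
    linarith
  have h5 := (S.strictMono_angleTime R).injective h3
  rw [Real.Angle.angle_eq_iff_two_pi_dvd_sub]
  refine ⟨n, ?_⟩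
  rw [h5, zsmul_eq_mul]
  ring

/-- The exponential of the angle variable as a function of the complex coordinate
`v₁ + i r(x)`. -/
def complexAngleExp (w : ℂ) : ℂ := S.polarAngleExp ‖w‖ w.arg

theorem complexAngleExp_polar {R : ℝ} (hR : 0 < R) (φ : ℝ) :
    S.complexAngleExp (R * Complex.exp (φ * Complex.I)) = S.polarAngleExp R φ := by
  rw [complexAngleExp, norm_mul, Complex.norm_exp_ofReal_mul_I, mul_one, Complex.norm_real,
    Real.norm_eq_abs, abs_of_pos hR]
  apply S.polarAngleExp_congr
  rw [Complex.arg_real_mul _ hR, Complex.exp_mul_I]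
  simpa using Complex.arg_cos_add_sin_mul_I_coe_angle φ

theorem norm_complexAngleExp (w : ℂ) : ‖S.complexAngleExp w‖ = 1 :=
  Complex.norm_exp_ofReal_mul_I _

theorem complexAngleExp_mul_exp {w : ℂ} (hw : w ≠ 0) (l : ℂ) :
    S.complexAngleExp (w * Complex.exp l) =
      S.polarAngleExp (‖w‖ * Real.exp l.re) (w.arg + l.im) := by
  rw [← S.complexAngleExp_polar (mul_pos (norm_pos_iff.2 hw) (Real.exp_pos _))]
  congr 1
  conv_lhs => rw [← Complex.norm_mul_exp_arg_mul_I w, ← Complex.re_add_im l, Complex.exp_add]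
  push_cast
  rw [add_mul, Complex.exp_add]
  ring

/-- `Complex.arg` jumps on the negative axis. Near w the polar coordinates are taken from log(u / w)
instead, which is smooth there; by 2π-periodicity the result is the same function. -/
theorem contDiffAt_complexAngleExp {w : ℂ} (hw : w ≠ 0) : ContDiffAt ℝ 1 S.complexAngleExp w := by
  have h1 : S.complexAngleExp =ᶠ[𝓝 w] fun u =>
      S.polarAngleExp (‖w‖ * Real.exp (Complex.log (u / w)).re)
        (w.arg + (Complex.log (u / w)).im) := by
    filter_upwards [isOpen_ne.mem_nhds hw] with u hu
    rw [← S.complexAngleExp_mul_exp hw, Complex.exp_log (div_ne_zero hu hw),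
      mul_div_cancel₀ _ hw]
  refine ContDiffAt.congr_of_eventuallyEq ?_ h1
  have hlog : ContDiffAt ℝ 1 (fun u : ℂ => Complex.log (u / w)) w := by
    have h2 : ContDiffAt ℂ 1 Complex.log (w / w) :=
      Complex.contDiffAt_log (by rw [div_self hw]; exact Complex.one_mem_slitPlane)
    exact (h2.restrict_scalars ℝ).comp (f := fun u : ℂ => u / w) w (contDiffAt_id.div_const w)
  refine ContDiffAt.comp w (g := fun p : ℝ × ℝ => S.polarAngleExp p.1 p.2)
    (f := fun u => (‖w‖ * Real.exp (Complex.log (u / w)).re,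
      w.arg + (Complex.log (u / w)).im)) S.contDiff_polarAngleExp.contDiffAt ?_
  refine ContDiffAt.prodMk (contDiffAt_const.mul ?_) (contDiffAt_const.add ?_)
  · exact (Complex.reCLM.contDiff.contDiffAt.comp w hlog).exp
  · exact Complex.imCLM.contDiff.contDiffAt.comp w hlog

/-- Differentiation along the rotation t ↦ w exp(it), which keeps the radius, and with it the
period, fixed. -/
theorem fderiv_complexAngleExp {w : ℂ} (hw : w ≠ 0) :
    fderiv ℝ S.complexAngleExp w (w * Complex.I) = (S.slowness w.im : ℝ) *
      ((2 * Real.pi / S.radialPeriod ‖w‖ : ℝ) * Complex.I * S.complexAngleExp w) := by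
  have h1 : HasDerivAt (fun t : ℝ => w * Complex.exp (t * Complex.I)) (w * Complex.I) 0 := by
    have := (((hasDerivAt_id (0 : ℝ)).ofReal_comp.mul_const Complex.I).cexp).const_mul w
    simpa using this
  have h2 : HasFDerivAt S.complexAngleExp (fderiv ℝ S.complexAngleExp w)
      (w * Complex.exp (((0 : ℝ) : ℂ) * Complex.I)) := by
    simpa using ((S.contDiffAt_complexAngleExp hw).differentiableAt one_ne_zero).hasFDerivAt
  have h3 := h2.comp_hasDerivAt (0 : ℝ) h1
  have h4 : (S.complexAngleExp ∘ fun t : ℝ => w * Complex.exp (t * Complex.I)) =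
      fun t => S.polarAngleExp ‖w‖ (w.arg + t) := by
    funext t
    have := S.complexAngleExp_mul_exp hw (t * Complex.I)
    simpa using this
  rw [h4] at h3
  have h5 := (S.hasDerivAt_polarAngleExp ‖w‖ (w.arg + 0)).comp_const_add w.arg 0
  rw [h3.unique h5, add_zero, Complex.norm_mul_sin_arg]
  rfl

theorem complexAngleExp_injective {w u : ℂ} (hn : ‖w‖ = ‖u‖)
    (h : S.complexAngleExp w = S.complexAngleExp u) : w = u := by
  rw [complexAngleExp, complexAngleExp, hn] at h
  have h1 := S.angle_eq_of_polarAngleExp_eq h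
  exact Complex.ext_norm_arg hn (Complex.arg_coe_angle_eq_iff.1 h1)

theorem conj_polarAngleExp (R φ : ℝ) :
    S.polarAngleExp R (-φ) = (starRingEnd ℂ) (S.polarAngleExp R φ) := by
  rw [polarAngleExp, polarAngleExp, ← Complex.exp_conj, S.angleTime_neg, map_mul,
    Complex.conj_ofReal, Complex.conj_I]
  congr 1
  push_cast
  ring

theorem polarAngleExp_pi_sub (R φ : ℝ) :
    S.polarAngleExp R (Real.pi - φ) = -(starRingEnd ℂ) (S.polarAngleExp R φ) := by
  rw [polarAngleExp, polarAngleExp, ← Complex.exp_conj, S.angleTime_pi_sub, map_mul,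
    Complex.conj_ofReal, Complex.conj_I]
  have hP := (S.radialPeriod_pos R).ne'
  have h1 : 2 * Real.pi * ((S.radialPeriod R / 2 - S.angleTime R φ) / S.radialPeriod R) =
      Real.pi - 2 * Real.pi * (S.angleTime R φ / S.radialPeriod R) := by
    field_simp
  rw [h1, Complex.ofReal_sub, sub_mul, sub_eq_add_neg, Complex.exp_add, Complex.exp_pi_mul_I,
    neg_one_mul, mul_neg]

theorem complexAngleExp_conj {w : ℂ} (hw : w ≠ 0) :
    S.complexAngleExp ((starRingEnd ℂ) w) = (starRingEnd ℂ) (S.complexAngleExp w) := by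
  have h1 : (starRingEnd ℂ) w = (‖w‖ : ℝ) * Complex.exp ((-w.arg : ℝ) * Complex.I) := by
    conv_lhs => rw [← Complex.norm_mul_exp_arg_mul_I w]
    rw [map_mul, Complex.conj_ofReal, ← Complex.exp_conj, map_mul, Complex.conj_ofReal,
      Complex.conj_I]
    push_cast
    ring_nf
  rw [h1, S.complexAngleExp_polar (norm_pos_iff.2 hw), S.conj_polarAngleExp, complexAngleExp]

theorem complexAngleExp_neg_conj {w : ℂ} (hw : w ≠ 0) :
    S.complexAngleExp (-(starRingEnd ℂ) w) = -(starRingEnd ℂ) (S.complexAngleExp w) := by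
  have h1 : -(starRingEnd ℂ) w = (‖w‖ : ℝ) * Complex.exp ((Real.pi - w.arg : ℝ) * Complex.I) := by
    conv_lhs => rw [← Complex.norm_mul_exp_arg_mul_I w]
    rw [map_mul, Complex.conj_ofReal, ← Complex.exp_conj, map_mul, Complex.conj_ofReal,
      Complex.conj_I, Complex.ofReal_sub, sub_mul, sub_eq_add_neg, Complex.exp_add,
      Complex.exp_pi_mul_I, neg_one_mul, mul_neg, mul_neg]
  rw [h1, S.complexAngleExp_polar (norm_pos_iff.2 hw), S.polarAngleExp_pi_sub, complexAngleExp]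

/-! The period function. -/

theorem setOf_U₀_eq {E : ℝ} (hE : S.U₀ 0 < E) : {x | S.U₀ x = E} =
    {S.position (-√(2 * (E - S.U₀ 0))), S.position √(2 * (E - S.U₀ 0))} := by
  have hR : 0 ≤ 2 * (E - S.U₀ 0) := by linarith
  ext x
  have h1 := S.radial_sq x
  rw [mem_ofPred_eq, mem_insert_iff, mem_singleton_iff]
  have h2 : ∀ r, x = S.position r ↔ S.radial x = r := fun r =>
    ⟨fun h => by rw [h, S.radial_position], fun h => by rw [← h, S.position_radial]⟩
  rw [h2, h2, or_comm, ← sq_eq_sq_iff_eq_or_eq_neg, Real.sq_sqrt hR, h1]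
  constructor <;> intro h <;> linarith

theorem strictMono_position : StrictMono S.position := by
  intro a b hab
  rw [← S.strictMono_radial.lt_iff_lt, S.radial_position, S.radial_position]
  exact hab

theorem two_mul_U₀_position (r : ℝ) : 2 * S.U₀ (S.position r) = 2 * S.U₀ 0 + r ^ 2 := by
  have := S.radial_sq (S.position r)
  rw [S.radial_position] at this
  linarith

/-- Under x = position(R sin φ) the integrand 1 / √(R² - r²) becomes 1 / (R cos φ) and cancels the
factor R cos φ of dx. The end-point singularities disappear, and what remains is the time of the
half turn from -π/2 to π/2. -/
theorem period_integral {R : ℝ} (hR : 0 < R) :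
    2 * ∫ x in (S.position (-R))..(S.position R), 1 / √(2 * S.U₀ 0 + R ^ 2 - 2 * S.U₀ x) =
      S.radialPeriod R := by
  have hpi := Real.pi_pos
  let f : ℝ → ℝ := fun φ => S.position (R * Real.sin φ)
  let s : Set ℝ := Ioo (-(Real.pi / 2)) (Real.pi / 2)
  have himg : f '' s = Ioo (S.position (-R)) (S.position R) := by
    ext x
    constructor
    · rintro ⟨φ, hφ, rfl⟩
      have h1 := Real.sin_lt_sin_of_lt_of_le_pi_div_two le_rfl hφ.2.le hφ.1
      have h2 := Real.sin_lt_sin_of_lt_of_le_pi_div_two hφ.1.le le_rfl hφ.2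
      rw [Real.sin_neg, Real.sin_pi_div_two] at h1
      rw [Real.sin_pi_div_two] at h2
      exact ⟨S.strictMono_position (by nlinarith), S.strictMono_position (by nlinarith)⟩
    · rintro ⟨h1, h2⟩
      rw [← S.strictMono_radial.lt_iff_lt, S.radial_position] at h1 h2
      have h3 : -1 < S.radial x / R := by rw [lt_div_iff₀ hR]; linarith
      have h4 : S.radial x / R < 1 := by rw [div_lt_iff₀ hR]; linarith
      refine ⟨Real.arcsin (S.radial x / R),
        ⟨Real.neg_pi_div_two_lt_arcsin.2 h3, Real.arcsin_lt_pi_div_two.2 h4⟩, ?_⟩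
      simp only [f]
      rw [Real.sin_arcsin h3.le h4.le, mul_div_cancel₀ _ hR.ne', S.position_radial]
  have hinj : InjOn f s := by
    intro a ha b hb hab
    have h1 := mul_left_cancel₀ hR.ne' (S.strictMono_position.injective hab)
    exact Real.injOn_sin ⟨ha.1.le, ha.2.le⟩ ⟨hb.1.le, hb.2.le⟩ h1
  have hder : ∀ φ ∈ s, HasDerivWithinAt f
      (S.slowness (R * Real.sin φ) * (R * Real.cos φ)) s φ := fun φ _ =>
    ((S.hasDerivAt_position (R * Real.sin φ)).comp φ
      ((Real.hasDerivAt_sin φ).const_mul R)).hasDerivWithinAt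
  have h1 := integral_image_eq_integral_abs_deriv_smul measurableSet_Ioo hder hinj
    fun x => 1 / √(2 * S.U₀ 0 + R ^ 2 - 2 * S.U₀ x)
  have h2 : ∫ φ in s, |S.slowness (R * Real.sin φ) * (R * Real.cos φ)| •
      (1 / √(2 * S.U₀ 0 + R ^ 2 - 2 * S.U₀ (f φ))) = ∫ φ in s, S.slowness (R * Real.sin φ) := by
    refine setIntegral_congr_fun measurableSet_Ioo fun φ hφ => ?_
    have hc : 0 < R * Real.cos φ := mul_pos hR (Real.cos_pos_of_mem_Ioo hφ)
    have h3 : 2 * S.U₀ 0 + R ^ 2 - 2 * S.U₀ (f φ) = (R * Real.cos φ) ^ 2 := by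
      simp only [f]
      rw [S.two_mul_U₀_position, mul_pow, mul_pow, Real.cos_sq']
      ring
    rw [h3, Real.sqrt_sq hc.le, abs_of_pos (mul_pos (S.slowness_pos _) hc), smul_eq_mul,
      mul_assoc, mul_one_div_cancel hc.ne', mul_one]
  have h3 : S.radialPeriod R = 2 * ∫ φ in s, S.slowness (R * Real.sin φ) := by
    rw [← integral_Ioc_eq_integral_Ioo, ← intervalIntegral.integral_of_le (by linarith),
      ← S.angleTime_sub, S.angleTime_neg, sub_neg_eq_add]
    have := S.angleTime_pi_sub R (Real.pi / 2)
    rw [sub_half] at this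
    linarith
  rw [h3, ← h2, ← h1, himg, ← integral_Ioc_eq_integral_Ioo, intervalIntegral.integral_of_le]
  exact (S.strictMono_position (by linarith)).le

/-- At E = U₀(0) the radius is 0 and `slowness` has the constant value 1 / √(U₀''(0)), so the
prescribed value of T is the one that makes it continuous there. -/
theorem period_eq {E : ℝ} (hE : S.U₀ 0 ≤ E) :
    S.period E = S.radialPeriod √(2 * (E - S.U₀ 0)) := by
  rw [period]
  split_ifs with h
  · rw [h, sub_self, mul_zero, Real.sqrt_zero, radialPeriod, angleTime]
    simp only [zero_mul, S.slowness_zero]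
    rw [intervalIntegral.integral_const, (S.hasDerivAt_deriv_U₀ 0).deriv, smul_eq_mul, sub_zero,
      div_eq_mul_inv]
  · have hlt : S.U₀ 0 < E := lt_of_le_of_ne hE fun h1 => h h1.symm
    have hR : 0 < √(2 * (E - S.U₀ 0)) := Real.sqrt_pos.2 (by linarith)
    have hle : S.position (-√(2 * (E - S.U₀ 0))) ≤ S.position √(2 * (E - S.U₀ 0)) :=
      (S.strictMono_position (by linarith)).le
    rw [xMinus, xPlus, S.setOf_U₀_eq hlt, csInf_pair, csSup_pair, inf_eq_left.2 hle,
      sup_eq_right.2 hle, ← S.period_integral hR, Real.sq_sqrt (by linarith)]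
    congr 3
    ext x
    ring_nf

/-- The squared angular frequency `(2π / T(E))²`. -/
def freqSq (E : ℝ) : ℝ := (2 * Real.pi / S.radialPeriod √(2 * (E - S.U₀ 0))) ^ 2

theorem freqSq_pos (E : ℝ) : 0 < S.freqSq E :=
  pow_pos (div_pos Real.two_pi_pos (S.radialPeriod_pos _)) 2

theorem freqSq_eq {E : ℝ} (hE : S.U₀ 0 ≤ E) : S.freqSq E = (2 * Real.pi / S.period E) ^ 2 := by
  rw [freqSq, S.period_eq hE]

theorem continuous_freqSq : Continuous S.freqSq := by
  refine Continuous.pow (continuous_const.div ?_ fun _ => (S.radialPeriod_pos _).ne') 2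
  exact S.contDiff_radialPeriod.continuous.comp (by fun_prop)

end PlanarSteadyState

namespace PlanarSteadyState

variable (S : PlanarSteadyState)

/-! Integration by parts for the transport operator. -/

theorem contDiffOn_deriv_α : ContDiffOn ℝ 1 (deriv S.α) (Iio S.E₀) := by
  rcases S.polytrope_or_king with ⟨k, hk, h⟩ | h
  · have key : ∀ E ∈ Iio S.E₀, deriv S.α E = -1 * k * (S.E₀ - E) ^ (k - 1) := by
      intro E hE
      have h1 : S.α =ᶠ[𝓝 E] fun E => (S.E₀ - E) ^ k := by
        filter_upwards [Iio_mem_nhds hE] with y hy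
        rw [h, if_pos (mem_Iio.1 hy)]
      rw [h1.deriv_eq]
      exact (((hasDerivAt_id E).const_sub S.E₀).rpow_const
        (Or.inl (sub_pos.2 hE).ne')).deriv
    refine ContDiffOn.congr (contDiffOn_const.mul ?_) key
    exact (contDiffOn_const.sub contDiffOn_id).rpow_const_of_ne fun E hE => (sub_pos.2 hE).ne'
  · have key : ∀ E ∈ Iio S.E₀, deriv S.α E = Real.exp (S.E₀ - E) * -1 := by
      intro E hE
      have h1 : S.α =ᶠ[𝓝 E] fun E => Real.exp (S.E₀ - E) - 1 := by
        filter_upwards [Iio_mem_nhds hE] with y hy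
        rw [h, max_eq_left]
        have := Real.one_lt_exp_iff.2 (sub_pos.2 hy)
        linarith
      rw [h1.deriv_eq]
      exact ((((hasDerivAt_id E).const_sub S.E₀).exp).sub_const 1).deriv
    refine ContDiffOn.congr ?_ key
    fun_prop

theorem contDiffOn_inv_deriv_α : ContDiffOn ℝ 1 (fun E => (deriv S.α E)⁻¹) (Iio S.E₀) :=
  S.contDiffOn_deriv_α.inv fun E hE => (S.deriv_α.2 E hE).ne

theorem integral_weightMeasure (F : PlanarPhaseSpace → ℝ) :
    ∫ z, F z ∂S.weightMeasure = ∫ z in S.Ω₀, 1 / |S.dφ z| * F z := by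
  rw [weightMeasure, integral_withDensity_eq_integral_toReal_smul S.measurable_weight
    (Eventually.of_forall fun _ => ENNReal.ofReal_lt_top)]
  refine integral_congr_ae (Eventually.of_forall fun z => ?_)
  dsimp only
  rw [ENNReal.toReal_ofReal (by positivity), smul_eq_mul]

theorem integrable_weightMeasure_iff {F : PlanarPhaseSpace → ℝ} :
    Integrable F S.weightMeasure ↔ IntegrableOn (fun z => 1 / |S.dφ z| * F z) S.Ω₀ := by
  rw [weightMeasure, integrable_withDensity_iff_integrable_smul' S.measurable_weight
    (Eventually.of_forall fun _ => ENNReal.ofReal_lt_top)]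
  refine integrable_congr (Eventually.of_forall fun z => ?_)
  dsimp only
  rw [ENNReal.toReal_ofReal (by positivity), smul_eq_mul]

theorem hasFDerivAt_energy (z : PlanarPhaseSpace) :
    HasFDerivAt S.energy
      (z.2.1 • (ContinuousLinearMap.fst ℝ ℝ (ℝ × ℝ)).comp (ContinuousLinearMap.snd ℝ ℝ (ℝ × ℝ × ℝ))
        + deriv S.U₀ z.1 • ContinuousLinearMap.fst ℝ ℝ (ℝ × ℝ × ℝ)) z := by
  have h1 : HasFDerivAt (fun z : PlanarPhaseSpace => z.1)
      (ContinuousLinearMap.fst ℝ ℝ (ℝ × ℝ × ℝ)) z := hasFDerivAt_fst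
  have h2 : HasFDerivAt (fun z : PlanarPhaseSpace => z.2.1)
      ((ContinuousLinearMap.fst ℝ ℝ (ℝ × ℝ)).comp (ContinuousLinearMap.snd ℝ ℝ (ℝ × ℝ × ℝ))) z :=
    hasFDerivAt_fst.comp z hasFDerivAt_snd
  have h3 : HasDerivAt (fun v : ℝ => v ^ 2 / 2) z.2.1 z.2.1 := by
    have := (hasDerivAt_pow 2 z.2.1).div_const 2
    simpa using this
  exact (h3.comp_hasFDerivAt z h2).add ((S.hasDerivAt_U₀ z.1).comp_hasFDerivAt z h1)

/-- The Hamiltonian vector field. -/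
def hamField (z : PlanarPhaseSpace) : PlanarPhaseSpace := (z.2.1, -deriv S.U₀ z.1, 0, 0)

theorem classicalTransport_eq (ξ : PlanarPhaseSpace → ℝ) (z : PlanarPhaseSpace) :
    S.classicalTransport ξ z = fderiv ℝ ξ z (S.hamField z) := by
  have : S.hamField z = z.2.1 • ((1, 0, 0, 0) : PlanarPhaseSpace) +
      (-deriv S.U₀ z.1) • ((0, 1, 0, 0) : PlanarPhaseSpace) := by
    simp [hamField]
  rw [this, map_add, map_smul, map_smul, classicalTransport, smul_eq_mul, smul_eq_mul]
  ring

theorem fderiv_energy_hamField (z : PlanarPhaseSpace) :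
    fderiv ℝ S.energy z (S.hamField z) = 0 := by
  rw [(S.hasFDerivAt_energy z).fderiv]
  simp [hamField]
  ring

instance isAddHaarMeasure_volume_planarPhaseSpace :
    (volume : Measure PlanarPhaseSpace).IsAddHaarMeasure :=
  have _h2 : (volume : Measure (ℝ × ℝ)).IsAddHaarMeasure :=
    Measure.prod.instIsAddHaarMeasure (volume : Measure ℝ) (volume : Measure ℝ)
  have _h3 : (volume : Measure (ℝ × ℝ × ℝ)).IsAddHaarMeasure :=
    Measure.prod.instIsAddHaarMeasure (volume : Measure ℝ) (volume : Measure (ℝ × ℝ))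
  Measure.prod.instIsAddHaarMeasure (volume : Measure ℝ) (volume : Measure (ℝ × ℝ × ℝ))

theorem integrable_of_continuousOn_of_compact {F : PlanarPhaseSpace → ℝ} {K : Set PlanarPhaseSpace}
    (hK : IsCompact K) (hF : ContinuousOn F K) (h0 : ∀ z ∉ K, F z = 0) : Integrable F := by
  rw [← integrableOn_iff_integrable_of_support_subset (s := K)]
  · exact hF.integrableOn_compact hK
  · intro z hz
    by_contra h
    exact hz (h0 z h)

/-- Integration by parts in a coordinate direction against a weight that is constant along it. -/
theorem integral_lineDeriv_weight {η : PlanarPhaseSpace → ℝ} (hη : S.IsTest η)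
    (d : PlanarPhaseSpace)
    {c : PlanarPhaseSpace → ℝ} (hc : Continuous c) (hcd : ∀ z (t : ℝ), c (z + t • d) = c z)
    (hd : d.2.2 = 0) :
    Integrable (fun z => fderiv ℝ η z d *
      (c z * ((deriv S.α (S.energy z))⁻¹ * (S.β z.2.2)⁻¹))) ∧
    ∫ z, fderiv ℝ η z d * (c z * ((deriv S.α (S.energy z))⁻¹ * (S.β z.2.2)⁻¹)) =
      -∫ z, η z * (c z * (deriv (fun E => (deriv S.α E)⁻¹) (S.energy z) *
        fderiv ℝ S.energy z d * (S.β z.2.2)⁻¹)) := by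
  obtain ⟨h1, h2, h3⟩ := hη
  have hΩ : ∀ z ∈ tsupport η, S.energy z ∈ Iio S.E₀ ∧ S.β z.2.2 ≠ 0 := fun z hz =>
    (S.mem_Ω₀_iff z).1 (h3 hz)
  have hcE : Continuous S.energy := S.continuous_energy
  have hβ : ContinuousOn (fun z : PlanarPhaseSpace => (S.β z.2.2)⁻¹) (tsupport η) :=
    (S.continuous_β.comp (by fun_prop)).continuousOn.inv₀ fun z hz => (hΩ z hz).2
  have hκ : ContinuousOn (fun z => (deriv S.α (S.energy z))⁻¹) (tsupport η) :=
    S.contDiffOn_inv_deriv_α.continuousOn.comp hcE.continuousOn fun z hz => (hΩ z hz).1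
  have hκ' : ContinuousOn (fun z => deriv (fun E => (deriv S.α E)⁻¹) (S.energy z))
      (tsupport η) :=
    (S.contDiffOn_inv_deriv_α.continuousOn_deriv_of_isOpen isOpen_Iio le_rfl).comp
      hcE.continuousOn fun z hz => (hΩ z hz).1
  have hEd : Continuous fun z => fderiv ℝ S.energy z d := by
    have : (fun z => fderiv ℝ S.energy z d) = fun z => z.2.1 * d.2.1 + deriv S.U₀ z.1 * d.1 := by
      funext z
      rw [(S.hasFDerivAt_energy z).fderiv]
      simp
    rw [this]
    have := S.contDiff_deriv_U₀.continuous
    fun_prop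
  have hηd : Continuous fun z => fderiv ℝ η z d :=
    (h1.continuous_fderiv one_ne_zero).clm_apply continuous_const
  have hd0 : ∀ z ∉ tsupport η, fderiv ℝ η z d = 0 := fun z hz => by
    have : fderiv ℝ η z = 0 :=
      image_eq_zero_of_notMem_tsupport fun h => hz (tsupport_fderiv_subset ℝ h)
    rw [this]; rfl
  have hη0 : ∀ z ∉ tsupport η, η z = 0 := fun z hz => image_eq_zero_of_notMem_tsupport hz
  have hg : ContinuousOn (fun z => c z * ((deriv S.α (S.energy z))⁻¹ * (S.β z.2.2)⁻¹))
      (tsupport η) := hc.continuousOn.mul (hκ.mul hβ)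
  have hg' : ContinuousOn (fun z => c z * (deriv (fun E => (deriv S.α E)⁻¹) (S.energy z) *
      fderiv ℝ S.energy z d * (S.β z.2.2)⁻¹)) (tsupport η) :=
    hc.continuousOn.mul ((hκ'.mul hEd.continuousOn).mul hβ)
  have hint : Integrable fun z => fderiv ℝ η z d *
      (c z * ((deriv S.α (S.energy z))⁻¹ * (S.β z.2.2)⁻¹)) :=
    integrable_of_continuousOn_of_compact h2 (hηd.continuousOn.mul hg) fun z hz => by
      rw [hd0 z hz]; simp
  refine ⟨hint, ?_⟩
  have key := integral_bilinear_hasLineDerivAt_right_eq_neg_left_of_integrable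
    (μ := (volume : Measure PlanarPhaseSpace)) (f := η) (f' := fun z => fderiv ℝ η z d)
    (g := fun z => c z * ((deriv S.α (S.energy z))⁻¹ * (S.β z.2.2)⁻¹))
    (g' := fun z => c z * (deriv (fun E => (deriv S.α E)⁻¹) (S.energy z) *
      fderiv ℝ S.energy z d * (S.β z.2.2)⁻¹)) (v := d) (B := ContinuousLinearMap.mul ℝ ℝ)
    hint
    (integrable_of_continuousOn_of_compact h2 (h1.continuous.continuousOn.mul hg') fun z hz => by
      rw [hη0 z hz]; simp)
    (integrable_of_continuousOn_of_compact h2 (h1.continuous.continuousOn.mul hg) fun z hz => by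
      rw [hη0 z hz]; simp)
    (fun z _ => (h1.differentiable one_ne_zero z).hasFDerivAt.hasLineDerivAt d) fun z hz => ?_
  · simp only [ContinuousLinearMap.mul_apply'] at key
    linarith
  · have hE : HasLineDerivAt ℝ S.energy (fderiv ℝ S.energy z d) z d :=
      (S.hasFDerivAt_energy z).differentiableAt.hasFDerivAt.hasLineDerivAt d
    have hκd : HasDerivAt (fun E => (deriv S.α E)⁻¹)
        (deriv (fun E => (deriv S.α E)⁻¹) (S.energy z)) (S.energy (z + (0 : ℝ) • d)) := by
      rw [zero_smul, add_zero]
      exact ((S.contDiffOn_inv_deriv_α.differentiableOn one_ne_zero _ (hΩ z hz).1).differentiableAt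
        (Iio_mem_nhds (hΩ z hz).1)).hasDerivAt
    -- Along `d` both `c` and v̄ are constant, so only 1 / α'(E) is differentiated; `β` need not be
    -- differentiable.
    have h4 := ((hκd.comp (0 : ℝ) hE).mul_const (S.β z.2.2)⁻¹).const_mul (c z)
    unfold HasLineDerivAt
    refine h4.congr_of_eventuallyEq (Eventually.of_forall fun t => ?_)
    simp only [hcd, Function.comp_apply, Prod.snd_add, Prod.smul_snd, hd, smul_zero, add_zero]

theorem transport_eq_zero_of_notMem {ξ : PlanarPhaseSpace → ℝ} {z : PlanarPhaseSpace}
    (hz : z ∉ tsupport ξ) : S.classicalTransport ξ z = 0 := by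
  have : fderiv ℝ ξ z = 0 :=
    image_eq_zero_of_notMem_tsupport fun h => hz (tsupport_fderiv_subset ℝ h)
  simp [classicalTransport, this]

/-- The Hamiltonian field is divergence free and tangent to the level sets of E and v̄, hence of the
weight. After integration by parts in x and in v₁ the derivative of 1 / α'(E) appears with the
factors v₁ U₀'(x) and U₀'(x) v₁, which cancel. -/
theorem integral_transport_test {η : PlanarPhaseSpace → ℝ} (hη : S.IsTest η) :
    ∫ z, S.classicalTransport η z ∂S.weightMeasure = 0 := by
  have hU := S.contDiff_deriv_U₀.continuous
  obtain ⟨i1, e1⟩ := S.integral_lineDeriv_weight hη (1, 0, 0, 0) (c := fun z => z.2.1)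
    (by fun_prop) (fun z t => by simp) rfl
  obtain ⟨i2, e2⟩ := S.integral_lineDeriv_weight hη (0, 1, 0, 0) (c := fun z => deriv S.U₀ z.1)
    (by fun_prop) (fun z t => by simp) rfl
  rw [S.integral_weightMeasure, setIntegral_eq_integral_of_forall_compl_eq_zero fun z hz => by
    rw [S.transport_eq_zero_of_notMem fun h => hz (hη.2.2 h), mul_zero]]
  have h1 : ∀ z, 1 / |S.dφ z| * S.classicalTransport η z =
      -(fderiv ℝ η z (1, 0, 0, 0) * (z.2.1 * ((deriv S.α (S.energy z))⁻¹ * (S.β z.2.2)⁻¹)) -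
        fderiv ℝ η z (0, 1, 0, 0) *
          (deriv S.U₀ z.1 * ((deriv S.α (S.energy z))⁻¹ * (S.β z.2.2)⁻¹))) := by
    intro z
    by_cases hz : z ∈ tsupport η
    · obtain ⟨hE, hβ⟩ := (S.mem_Ω₀_iff z).1 (hη.2.2 hz)
      rw [dφ, abs_mul, abs_of_neg (S.deriv_α.2 _ hE), abs_of_nonneg (S.β_nonneg _),
        one_div, mul_inv, inv_neg, classicalTransport]
      ring
    · have h0 : fderiv ℝ η z = 0 :=
        image_eq_zero_of_notMem_tsupport fun h => hz (tsupport_fderiv_subset ℝ h)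
      rw [S.transport_eq_zero_of_notMem hz, h0]
      simp
  rw [integral_congr_ae (Eventually.of_forall h1), integral_neg, integral_sub i1 i2, e1, e2,
    neg_eq_zero, sub_eq_zero, neg_inj]
  refine integral_congr_ae (Eventually.of_forall fun z => ?_)
  dsimp only
  rw [(S.hasFDerivAt_energy z).fderiv]
  simp only [add_apply, smul_apply, ContinuousLinearMap.comp_apply, ContinuousLinearMap.coe_fst',
    ContinuousLinearMap.coe_snd', smul_eq_mul]
  ring

theorem IsTest.mul {S : PlanarSteadyState} {η ξ : PlanarPhaseSpace → ℝ} (hη : S.IsTest η)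
    (hξ : ContDiff ℝ 1 ξ) : S.IsTest fun z => η z * ξ z :=
  ⟨hη.1.mul hξ, hη.2.1.mul_right, (tsupport_mul_subset_left (g := ξ)).trans hη.2.2⟩

theorem transport_mul {η ξ : PlanarPhaseSpace → ℝ} {z : PlanarPhaseSpace}
    (hη : DifferentiableAt ℝ η z) (hξ : DifferentiableAt ℝ ξ z) :
    S.classicalTransport (fun z => η z * ξ z) z =
      S.classicalTransport η z * ξ z + η z * S.classicalTransport ξ z := by
  simp only [S.classicalTransport_eq, fderiv_fun_mul hη hξ]
  simp only [add_apply, smul_apply, smul_eq_mul]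
  ring

/-- The Leibniz rule, and the vanishing of the integral of 𝓓(η ξ). -/
theorem integral_mul_transport_test {η ξ : PlanarPhaseSpace → ℝ} (hη : S.IsTest η)
    (hξ : S.IsTest ξ) :
    ∫ z, η z * S.classicalTransport ξ z ∂S.weightMeasure =
      -∫ z, S.classicalTransport η z * ξ z ∂S.weightMeasure := by
  have h1 := S.integral_transport_test (hη.mul hξ.1)
  have h2 : ∀ z, S.classicalTransport (fun z => η z * ξ z) z =
      S.classicalTransport η z * ξ z + η z * S.classicalTransport ξ z := fun z =>
    S.transport_mul (hη.1.differentiable one_ne_zero z) (hξ.1.differentiable one_ne_zero z)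
  have i1 : Integrable (fun z => S.classicalTransport η z * ξ z) S.weightMeasure :=
    (S.memLp_transport_test hη).integrable_mul (S.memLp_test hξ)
  have i2 : Integrable (fun z => η z * S.classicalTransport ξ z) S.weightMeasure :=
    (S.memLp_test hη).integrable_mul (S.memLp_transport_test hξ)
  rw [integral_congr_ae (Eventually.of_forall h2), integral_add i1 i2] at h1
  linarith

/-- Test functions lie in the domain of the weak transport operator. -/
theorem mem_transportGraph_of_test {w : PlanarPhaseSpace → ℝ} (hw : S.IsTest w) {g h : S.Hilb}
    (hg : g =ᵐ[S.weightMeasure] w) (hh : h =ᵐ[S.weightMeasure] S.classicalTransport w) :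
    (g, h) ∈ S.transportGraph := by
  intro ξ hξ
  have h1 := S.integral_mul_transport_test hw hξ
  have e1 : ∫ z, g z * S.classicalTransport ξ z ∂S.weightMeasure =
      ∫ z, w z * S.classicalTransport ξ z ∂S.weightMeasure := by
    refine integral_congr_ae ?_
    filter_upwards [hg] with z hz
    rw [hz]
  have e2 : ∫ z, h z * ξ z ∂S.weightMeasure =
      ∫ z, S.classicalTransport w z * ξ z ∂S.weightMeasure := by
    refine integral_congr_ae ?_
    filter_upwards [hh] with z hz
    rw [hz]
  change ∫ z, g z * S.classicalTransport ξ z ∂S.weightMeasure =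
      -∫ z, h z * ξ z ∂S.weightMeasure
  rw [e1, e2, h1]

end PlanarSteadyState

namespace PlanarSteadyState

variable (S : PlanarSteadyState)

/-! The angle variable on phase space and the Fourier modes built from it. -/

/-- The complex coordinate `v₁ + i r(x)`. -/
def coord (z : PlanarPhaseSpace) : ℂ := (z.2.1 : ℂ) + (S.radial z.1 : ℂ) * Complex.I

theorem norm_coord_sq (z : PlanarPhaseSpace) : ‖S.coord z‖ ^ 2 = 2 * (S.energy z - S.U₀ 0) := by
  rw [Complex.sq_norm, coord, Complex.normSq_add_mul_I, S.radial_sq, energy]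
  ring

theorem norm_coord (z : PlanarPhaseSpace) : ‖S.coord z‖ = √(2 * (S.energy z - S.U₀ 0)) := by
  rw [← S.norm_coord_sq, Real.sqrt_sq (norm_nonneg _)]

theorem U₀_zero_le_energy (z : PlanarPhaseSpace) : S.U₀ 0 ≤ S.energy z := by
  nlinarith [S.norm_coord_sq z, sq_nonneg ‖S.coord z‖]

theorem coord_ne_zero {z : PlanarPhaseSpace} (hz : S.U₀ 0 < S.energy z) : S.coord z ≠ 0 := by
  rw [← norm_pos_iff, S.norm_coord]
  exact Real.sqrt_pos.2 (by linarith)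

theorem contDiff_coord : ContDiff ℝ 1 S.coord := by
  have h1 : ContDiff ℝ 1 fun z : PlanarPhaseSpace => (z.2.1 : ℂ) :=
    Complex.ofRealCLM.contDiff.comp (by fun_prop)
  have h2 : ContDiff ℝ 1 fun z : PlanarPhaseSpace => (S.radial z.1 : ℂ) :=
    Complex.ofRealCLM.contDiff.comp (S.contDiff_radial.comp contDiff_fst)
  exact h1.add (h2.mul contDiff_const)

/-- Because U₀' = r r', the flow moves v₁ + i r(x) perpendicularly to itself: it is a rotation at
the rate r'(x). -/
theorem fderiv_coord (z : PlanarPhaseSpace) :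
    fderiv ℝ S.coord z (S.hamField z) = (S.radialSpeed z.1 : ℝ) • (S.coord z * Complex.I) := by
  have h1 : HasFDerivAt (fun z : PlanarPhaseSpace => z.1)
      (ContinuousLinearMap.fst ℝ ℝ (ℝ × ℝ × ℝ)) z := hasFDerivAt_fst
  have h2 : HasFDerivAt (fun z : PlanarPhaseSpace => z.2.1)
      ((ContinuousLinearMap.fst ℝ ℝ (ℝ × ℝ)).comp (ContinuousLinearMap.snd ℝ ℝ (ℝ × ℝ × ℝ))) z :=
    hasFDerivAt_fst.comp z hasFDerivAt_snd
  have h3 := (S.hasDerivAt_radial z.1).comp_hasFDerivAt z h1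
  have h4 : HasFDerivAt S.coord _ z := (Complex.ofRealCLM.hasFDerivAt.comp z h2).add
    ((Complex.ofRealCLM.hasFDerivAt.comp z h3).mul_const Complex.I)
  rw [h4.fderiv]
  have h5 := S.radial_mul_radialSpeed z.1
  simp only [hamField, coord, ← h5]
  apply Complex.ext
  · simp
    ring
  · simp

/-- The exponential `exp(2πi θ)` of the angle variable `θ`. -/
def angle (z : PlanarPhaseSpace) : ℂ := S.complexAngleExp (S.coord z)

theorem norm_angle (z : PlanarPhaseSpace) : ‖S.angle z‖ = 1 := S.norm_complexAngleExp _

/-- The angular frequency `2π / T(E)`. -/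
def freq (E : ℝ) : ℝ := 2 * Real.pi / S.radialPeriod √(2 * (E - S.U₀ 0))

theorem freqSq_eq_sq (E : ℝ) : S.freqSq E = S.freq E ^ 2 := rfl

theorem freq_pos (E : ℝ) : 0 < S.freq E := div_pos Real.two_pi_pos (S.radialPeriod_pos _)

theorem contDiffOn_freq : ContDiffOn ℝ 1 S.freq (Ioi (S.U₀ 0)) := by
  refine contDiffOn_const.div (S.contDiff_radialPeriod.comp_contDiffOn ?_)
    fun _ _ => (S.radialPeriod_pos _).ne'
  exact (contDiffOn_const.mul (contDiffOn_id.sub contDiffOn_const)).sqrt fun E hE =>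
    (mul_pos two_pos (sub_pos.2 hE)).ne'

theorem contDiffAt_angle {z : PlanarPhaseSpace} (hz : S.U₀ 0 < S.energy z) :
    ContDiffAt ℝ 1 S.angle z :=
  (S.contDiffAt_complexAngleExp (S.coord_ne_zero hz)).comp z S.contDiff_coord.contDiffAt

/-- The rotation rate r'(x) of the coordinate cancels against the factor `slowness` = 1 / r'(x) in
the derivative of the angle variable; what is left, 2π / T(E), is constant along the orbit. -/
theorem fderiv_angle {z : PlanarPhaseSpace} (hz : S.U₀ 0 < S.energy z) :
    fderiv ℝ S.angle z (S.hamField z) = (S.freq (S.energy z) : ℝ) * Complex.I * S.angle z := by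
  have h1 := S.coord_ne_zero hz
  have h2 : S.angle = S.complexAngleExp ∘ S.coord := rfl
  rw [h2, fderiv_comp z ((S.contDiffAt_complexAngleExp h1).differentiableAt one_ne_zero)
    (S.contDiff_coord.differentiable one_ne_zero z), ContinuousLinearMap.comp_apply,
    S.fderiv_coord, map_smul, S.fderiv_complexAngleExp h1, S.norm_coord, ← freq]
  have h3 : (S.coord z).im = S.radial z.1 := by simp [coord]
  rw [h3, slowness, S.position_radial, Complex.real_smul, Complex.ofReal_inv, ← mul_assoc,
    mul_inv_cancel₀ (Complex.ofReal_ne_zero.2 (S.radialSpeed_pos _).ne'), one_mul]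
  rfl

/-- The conserved quantities `(E, v̄)`. -/
def actions (z : PlanarPhaseSpace) : ℝ × ℝ × ℝ := (S.energy z, z.2.2)

/-- The range of `(E, v̄)` on `Ω₀` without the equilibrium. -/
def actionDomain : Set (ℝ × ℝ × ℝ) := {p | S.U₀ 0 < p.1 ∧ p.1 < S.E₀ ∧ S.β p.2 ≠ 0}

/-- Complex `C¹` functions of `(E, v̄)` with compact support. -/
def IsAction (Ψ : ℝ × ℝ × ℝ → ℂ) : Prop :=
  ContDiff ℝ 1 Ψ ∧ HasCompactSupport Ψ ∧ tsupport Ψ ⊆ S.actionDomain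

theorem contDiff_energy : ContDiff ℝ 1 S.energy := by
  have := S.contDiff_U₀
  unfold energy
  fun_prop

theorem contDiff_actions : ContDiff ℝ 1 S.actions :=
  S.contDiff_energy.prodMk (by fun_prop)

theorem fderiv_actions (z : PlanarPhaseSpace) : fderiv ℝ S.actions z (S.hamField z) = 0 := by
  have h2 : HasFDerivAt (fun z : PlanarPhaseSpace => z.2.2)
      ((ContinuousLinearMap.snd ℝ ℝ (ℝ × ℝ)).comp (ContinuousLinearMap.snd ℝ ℝ (ℝ × ℝ × ℝ))) z :=
    hasFDerivAt_snd.comp z hasFDerivAt_snd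
  have h3 : HasFDerivAt S.actions _ z :=
    (S.contDiff_energy.differentiable one_ne_zero z).hasFDerivAt.prodMk h2
  rw [h3.fderiv, ContinuousLinearMap.prod_apply, S.fderiv_energy_hamField]
  simp [hamField]

/-- Bounded energy bounds |v₁ + i r(x)|, hence v₁ and, r being a homeomorphism, also x. -/
theorem isCompact_preimage_actions {K : Set (ℝ × ℝ × ℝ)} (hK : IsCompact K) :
    IsCompact (S.actions ⁻¹' K) := by
  obtain ⟨C, hC⟩ := hK.exists_bound_of_continuousOn (f := fun p => p.1) (by fun_prop)
  set a := √(2 * (C - S.U₀ 0))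
  have hc : IsCompact ((S.position '' Icc (-a) a) ×ˢ (Icc (-a) a) ×ˢ (Prod.snd '' K)) :=
    (isCompact_Icc.image S.contDiff_position.continuous).prod
      (isCompact_Icc.prod (hK.image continuous_snd))
  refine hc.of_isClosed_subset (hK.isClosed.preimage S.contDiff_actions.continuous) fun z hz => ?_
  have h1 := (le_abs_self _).trans (hC _ hz)
  change S.energy z ≤ C at h1
  have h2 : ‖S.coord z‖ ≤ a := by
    rw [S.norm_coord]
    exact Real.sqrt_le_sqrt (by linarith)
  have hre := abs_le.1 ((Complex.abs_re_le_norm (S.coord z)).trans h2)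
  have him := abs_le.1 ((Complex.abs_im_le_norm (S.coord z)).trans h2)
  have h3 : (S.coord z).im = S.radial z.1 := by simp [coord]
  have h4 : (S.coord z).re = z.2.1 := by simp [coord]
  rw [h3] at him
  rw [h4] at hre
  exact ⟨⟨_, him, S.position_radial _⟩, hre, ⟨_, hz, rfl⟩⟩

theorem isOpen_actionDomain : IsOpen S.actionDomain := by
  have h1 : IsOpen {p : ℝ × ℝ × ℝ | S.β p.2 ≠ 0} :=
    isOpen_ne_fun (S.continuous_β.comp continuous_snd) continuous_const
  exact (isOpen_lt continuous_const continuous_fst).inter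
    ((isOpen_lt continuous_fst continuous_const).inter h1)

theorem IsAction.zero : S.IsAction 0 :=
  ⟨contDiff_const, HasCompactSupport.zero, by simp⟩

theorem IsAction.add {S : PlanarSteadyState} {Φ Ψ : ℝ × ℝ × ℝ → ℂ} (hΦ : S.IsAction Φ)
    (hΨ : S.IsAction Ψ) : S.IsAction fun p => Φ p + Ψ p :=
  ⟨hΦ.1.add hΨ.1, hΦ.2.1.add hΨ.2.1,
    (tsupport_add Φ Ψ).trans (union_subset hΦ.2.2 hΨ.2.2)⟩

theorem IsAction.mul {S : PlanarSteadyState} {g Ψ : ℝ × ℝ × ℝ → ℂ}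
    (hg : ContDiffOn ℝ 1 g S.actionDomain) (hΨ : S.IsAction Ψ) :
    S.IsAction fun p => g p * Ψ p := by
  refine ⟨?_, hΨ.2.1.mul_left, (tsupport_mul_subset_right (f := g)).trans hΨ.2.2⟩
  rw [contDiff_iff_contDiffAt]
  intro p
  by_cases hp : p ∈ tsupport Ψ
  · exact (hg.contDiffAt (S.isOpen_actionDomain.mem_nhds (hΨ.2.2 hp))).mul hΨ.1.contDiffAt
  · have h1 : (fun p => g p * Ψ p) =ᶠ[𝓝 p] fun _ => 0 := by
      filter_upwards [(isClosed_tsupport Ψ).isOpen_compl.mem_nhds hp] with q hq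
      rw [image_eq_zero_of_notMem_tsupport hq, mul_zero]
    exact contDiffAt_const.congr_of_eventuallyEq h1

theorem IsAction.energy_mul {S : PlanarSteadyState} {g : ℝ → ℝ} {Ψ : ℝ × ℝ × ℝ → ℂ}
    (hg : ContDiffOn ℝ 1 g (Ioo (S.U₀ 0) S.E₀)) (hΨ : S.IsAction Ψ) :
    S.IsAction fun p => (g p.1 : ℂ) * Ψ p := by
  refine IsAction.mul (g := fun p => (g p.1 : ℂ)) ?_ hΨ
  exact Complex.ofRealCLM.contDiff.comp_contDiffOn
    (hg.comp contDiff_fst.contDiffOn fun p hp => ⟨hp.1, hp.2.1⟩)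

theorem contDiffOn_freq_Ioo : ContDiffOn ℝ 1 S.freq (Ioo (S.U₀ 0) S.E₀) :=
  S.contDiffOn_freq.mono fun _ h => h.1

/-- The Fourier mode `Re (Ψ(E, v̄) exp(2πi k θ))`. -/
def mode (k : ℕ) (Ψ : ℝ × ℝ × ℝ → ℂ) (z : PlanarPhaseSpace) : ℝ :=
  (Ψ (S.actions z) * S.angle z ^ k).re

theorem tsupport_mode_subset (k : ℕ) (Ψ : ℝ × ℝ × ℝ → ℂ) :
    tsupport (S.mode k Ψ) ⊆ S.actions ⁻¹' tsupport Ψ := by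
  refine closure_minimal (fun z hz => ?_)
    ((isClosed_tsupport Ψ).preimage S.contDiff_actions.continuous)
  by_contra h
  apply hz
  rw [mode, image_eq_zero_of_notMem_tsupport h, zero_mul, Complex.zero_re]

/-- The amplitude vanishes near the equilibrium energy, the only place where the angle may fail to
be C¹, and its compact support keeps the mode away from the boundary of Ω₀. -/
theorem isTest_mode (k : ℕ) {Ψ : ℝ × ℝ × ℝ → ℂ} (hΨ : S.IsAction Ψ) : S.IsTest (S.mode k Ψ) := by
  have hs := S.tsupport_mode_subset k Ψ
  refine ⟨?_, (S.isCompact_preimage_actions hΨ.2.1).of_isClosed_subset (isClosed_tsupport _) hs,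
    fun z hz => ?_⟩
  · rw [contDiff_iff_contDiffAt]
    intro z
    by_cases hz : z ∈ S.actions ⁻¹' tsupport Ψ
    · exact Complex.reCLM.contDiff.contDiffAt.comp z
        ((hΨ.1.comp S.contDiff_actions).contDiffAt.mul
          ((S.contDiffAt_angle (hΨ.2.2 hz).1).pow k))
    · have h1 : S.mode k Ψ =ᶠ[𝓝 z] fun _ => 0 := by
        filter_upwards [((isClosed_tsupport Ψ).preimage
          S.contDiff_actions.continuous).isOpen_compl.mem_nhds hz] with q hq
        rw [mode, image_eq_zero_of_notMem_tsupport hq, zero_mul, Complex.zero_re]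
      exact contDiffAt_const.congr_of_eventuallyEq h1
  · have := hΨ.2.2 (hs hz)
    exact (S.mem_Ω₀_iff z).2 ⟨this.2.1, this.2.2⟩

/-- E and v̄ are constant along the flow, so 𝓓 differentiates only the power of the angle and
multiplies the amplitude by 2πik / T(E). -/
theorem transport_mode (k : ℕ) {Ψ : ℝ × ℝ × ℝ → ℂ} (hΨ : S.IsAction Ψ) :
    S.classicalTransport (S.mode k Ψ) =
      S.mode k fun p => (k * Complex.I) * ((S.freq p.1 : ℂ) * Ψ p) := by
  funext z
  by_cases hz : z ∈ S.actions ⁻¹' tsupport Ψ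
  · have hE := (hΨ.2.2 hz).1
    have h1 := ((S.contDiffAt_angle hE).differentiableAt one_ne_zero).hasFDerivAt.pow k
    have h2 := (hΨ.1.differentiable one_ne_zero (S.actions z)).hasFDerivAt.comp z
      (S.contDiff_actions.differentiable one_ne_zero z).hasFDerivAt
    have h3 : HasFDerivAt (S.mode k Ψ) _ z := Complex.reCLM.hasFDerivAt.comp z (h2.mul h1)
    rw [S.classicalTransport_eq, h3.fderiv]
    simp only [ContinuousLinearMap.comp_apply, add_apply, smul_apply, S.fderiv_actions,
      S.fderiv_angle hE, map_zero, Complex.reCLM_apply, smul_eq_mul,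
      nsmul_eq_mul, mode, Function.comp_apply]
    congr 1
    rcases k with _ | k
    · simp
    · change S.U₀ 0 < S.energy z at hE
      simp only [Nat.add_sub_cancel, actions, pow_succ]
      ring
  · rw [S.transport_eq_zero_of_notMem fun h => hz (S.tsupport_mode_subset k Ψ h), mode,
      image_eq_zero_of_notMem_tsupport hz]
    simp

theorem IsAction.freq_mul {S : PlanarSteadyState} {Ψ : ℝ × ℝ × ℝ → ℂ} (hΨ : S.IsAction Ψ) (k : ℕ) :
    S.IsAction fun p => (k * Complex.I) * ((S.freq p.1 : ℂ) * Ψ p) :=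
  (hΨ.energy_mul S.contDiffOn_freq_Ioo).mul contDiffOn_const

theorem transport_transport_mode (k : ℕ) {Ψ : ℝ × ℝ × ℝ → ℂ} (hΨ : S.IsAction Ψ)
    (z : PlanarPhaseSpace) :
    S.classicalTransport (S.classicalTransport (S.mode k Ψ)) z =
      -(k ^ 2 * S.freqSq (S.energy z)) * S.mode k Ψ z := by
  rw [S.transport_mode k hΨ, S.transport_mode k (hΨ.freq_mul k), freqSq_eq_sq, mode, mode,
    ← Complex.re_ofReal_mul]
  congr 1
  simp only [actions]
  push_cast
  linear_combination (k ^ 2 * S.freq (S.energy z) ^ 2 * Ψ (S.energy z, z.2.2) * S.angle z ^ k : ℂ) *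
    Complex.I_sq

theorem mode_energy_mul (k : ℕ) (g : ℝ → ℝ) (Ψ : ℝ × ℝ × ℝ → ℂ) (z : PlanarPhaseSpace) :
    S.mode k (fun p => (g p.1 : ℂ) * Ψ p) z = g (S.energy z) * S.mode k Ψ z := by
  rw [mode, mode, ← Complex.re_ofReal_mul, mul_assoc]
  rfl

/-- Modes of different order are orthogonal. -/
theorem integral_mode_mul_mode {j k : ℕ} (hjk : j ≠ k) {Φ Ψ : ℝ × ℝ × ℝ → ℂ} (hΦ : S.IsAction Φ)
    (hΨ : S.IsAction Ψ) : ∫ z, S.mode j Φ z * S.mode k Ψ z ∂S.weightMeasure = 0 := by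
  -- Dividing one amplitude by (2π / T(E))² compensates the energy dependence: moving 𝓓² from one
  -- factor to the other then compares the constants -j² and -k².
  have hg : ContDiffOn ℝ 1 (fun E => (S.freqSq E)⁻¹) (Ioo (S.U₀ 0) S.E₀) :=
    (S.contDiffOn_freq_Ioo.pow 2).inv fun E _ => (S.freqSq_pos E).ne'
  have hΨ' := hΨ.energy_mul hg
  set Ψ' : ℝ × ℝ × ℝ → ℂ := fun p => (((S.freqSq p.1)⁻¹ : ℝ) : ℂ) * Ψ p
  have hm : ∀ z, S.mode k Ψ' z = (S.freqSq (S.energy z))⁻¹ * S.mode k Ψ z := fun z =>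
    S.mode_energy_mul k (fun E => (S.freqSq E)⁻¹) Ψ z
  have t1 := S.isTest_mode j hΦ
  have t2 := S.isTest_mode k hΨ'
  have t3 : S.IsTest (S.classicalTransport (S.mode j Φ)) := by
    rw [S.transport_mode j hΦ]; exact S.isTest_mode j (hΦ.freq_mul j)
  have t4 : S.IsTest (S.classicalTransport (S.mode k Ψ')) := by
    rw [S.transport_mode k hΨ']; exact S.isTest_mode k (hΨ'.freq_mul k)
  have e1 := S.integral_mul_transport_test t3 t2
  have e2 := S.integral_mul_transport_test t1 t4
  have e3 : ∀ z, S.mode j Φ z *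
      S.classicalTransport (S.classicalTransport (S.mode k Ψ')) z =
      -(k : ℝ) ^ 2 * (S.mode j Φ z * S.mode k Ψ z) := by
    intro z
    rw [S.transport_transport_mode k hΨ', hm]
    have := (S.freqSq_pos (S.energy z)).ne'
    field_simp
  have e4 : ∀ z, S.classicalTransport (S.classicalTransport (S.mode j Φ)) z * S.mode k Ψ' z =
      -(j : ℝ) ^ 2 * (S.mode j Φ z * S.mode k Ψ z) := by
    intro z
    rw [S.transport_transport_mode j hΦ, hm]
    have := (S.freqSq_pos (S.energy z)).ne'
    field_simp
  rw [integral_congr_ae (Eventually.of_forall e3), integral_const_mul] at e2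
  rw [integral_congr_ae (Eventually.of_forall e4), integral_const_mul] at e1
  have h : ((j : ℝ) ^ 2 - (k : ℝ) ^ 2) *
      ∫ z, S.mode j Φ z * S.mode k Ψ z ∂S.weightMeasure = 0 := by linarith
  refine (mul_eq_zero.1 h).resolve_left ?_
  intro h2
  rw [sub_eq_zero, sq_eq_sq₀ (Nat.cast_nonneg _) (Nat.cast_nonneg _)] at h2
  exact hjk (Nat.cast_injective h2)

end PlanarSteadyState

namespace PlanarSteadyState

variable (S : PlanarSteadyState)

/-! The weak transport operator and its square on the span of the modes. -/

theorem inner_eq_integral (f g : S.Hilb) : ⟪f, g⟫_ℝ = ∫ z, f z * g z ∂S.weightMeasure := by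
  rw [L2.inner_def]
  refine integral_congr_ae (Eventually.of_forall fun z => ?_)
  simp [mul_comm]

theorem exists_transport_iff {g h : S.Hilb} :
    (g, h) ∈ S.transportGraph ↔ ∃ hg : g ∈ S.transport.domain, S.transport ⟨g, hg⟩ = h := by
  rw [← S.transport_graph, LinearPMap.mem_graph_iff]
  constructor
  · rintro ⟨y, rfl, rfl⟩
    exact ⟨y.2, rfl⟩
  · rintro ⟨hg, rfl⟩
    exact ⟨⟨g, hg⟩, rfl, rfl⟩

theorem transportGraph_eq {g h h' : S.Hilb} (h1 : (g, h) ∈ S.transportGraph)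
    (h2 : (g, h') ∈ S.transportGraph) : h = h' := by
  have := S.transportGraph_unique _ (S.transportGraph.sub_mem h1 h2) (sub_self g)
  exact sub_eq_zero.1 this

theorem transportSq_of_graph {g h k : S.Hilb} (h1 : (g, h) ∈ S.transportGraph)
    (h2 : (h, k) ∈ S.transportGraph) :
    ∃ hg : g ∈ (-S.transportSq).domain, (-S.transportSq) ⟨g, hg⟩ = -k := by
  obtain ⟨hg, rfl⟩ := S.exists_transport_iff.1 h1
  obtain ⟨hh, rfl⟩ := S.exists_transport_iff.1 h2
  exact ⟨⟨⟨g, hg⟩, hh, rfl⟩, rfl⟩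

theorem graph_of_transportSq (g : (-S.transportSq).domain) :
    ∃ h : S.Hilb, ((g : S.Hilb), h) ∈ S.transportGraph ∧
      (h, -(-S.transportSq) g) ∈ S.transportGraph := by
  obtain ⟨g, ⟨g', hg'⟩, hh, rfl⟩ := g
  refine ⟨S.transport ⟨g', hg'⟩, S.exists_transport_iff.2 ⟨hg', rfl⟩,
    S.exists_transport_iff.2 ⟨hh, ?_⟩⟩
  rw [LinearPMap.neg_apply, neg_neg]
  rfl

theorem isClosed_transportGraph : IsClosed (S.transportGraph : Set (S.Hilb × S.Hilb)) := by
  have h1 : (S.transportGraph : Set (S.Hilb × S.Hilb)) = ⋂ ξ : {ξ // S.IsTest ξ},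
      {p | ⟪p.1, (S.memLp_transport_test ξ.2).toLp⟫_ℝ = -⟪p.2, (S.memLp_test ξ.2).toLp⟫_ℝ} := by
    ext p
    simp only [mem_iInter, Subtype.forall]
    refine forall_congr' fun ξ => forall_congr' fun hξ => ?_
    have e1 : ⟪p.1, (S.memLp_transport_test hξ).toLp⟫_ℝ =
        ∫ z, p.1 z * S.classicalTransport ξ z ∂S.weightMeasure := by
      rw [inner_eq_integral]
      refine integral_congr_ae ?_
      filter_upwards [(S.memLp_transport_test hξ).coeFn_toLp] with z hz
      rw [hz]
    have e2 : ⟪p.2, (S.memLp_test hξ).toLp⟫_ℝ = ∫ z, p.2 z * ξ z ∂S.weightMeasure := by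
      rw [inner_eq_integral]
      refine integral_congr_ae ?_
      filter_upwards [(S.memLp_test hξ).coeFn_toLp] with z hz
      rw [hz]
    rw [mem_ofPred_eq, e1, e2]
  rw [h1]
  refine isClosed_iInter fun ξ => isClosed_eq ?_ ?_
  · exact continuous_fst.inner continuous_const
  · exact (continuous_snd.inner continuous_const).neg

/-- `w` is (the class of) a twice transportable test function, with first and second transport
derivative `d` and `e`. -/
def IsTestTriple (w d e : S.Hilb) : Prop :=
  ∃ f, S.IsTest f ∧ S.IsTest (S.classicalTransport f) ∧ w =ᵐ[S.weightMeasure] f ∧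
    d =ᵐ[S.weightMeasure] S.classicalTransport f ∧
    e =ᵐ[S.weightMeasure] S.classicalTransport (S.classicalTransport f)

variable {S}

theorem IsTest.add {f g : PlanarPhaseSpace → ℝ} (hf : S.IsTest f) (hg : S.IsTest g) :
    S.IsTest fun z => f z + g z :=
  ⟨hf.1.add hg.1, hf.2.1.add hg.2.1, (tsupport_add f g).trans (union_subset hf.2.2 hg.2.2)⟩

theorem IsTest.const_mul {f : PlanarPhaseSpace → ℝ} (hf : S.IsTest f) (c : ℝ) :
    S.IsTest fun z => c * f z :=
  ⟨contDiff_const.mul hf.1, hf.2.1.mul_left,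
    (tsupport_mul_subset_right (f := fun _ => c)).trans hf.2.2⟩

theorem IsTest.transport_add {f g : PlanarPhaseSpace → ℝ} (hf : S.IsTest f) (hg : S.IsTest g) :
    S.classicalTransport (fun z => f z + g z) =
      fun z => S.classicalTransport f z + S.classicalTransport g z := by
  funext z
  rw [S.classicalTransport_eq, fderiv_fun_add (hf.1.differentiable one_ne_zero z)
    (hg.1.differentiable one_ne_zero z), add_apply, ← S.classicalTransport_eq,
    ← S.classicalTransport_eq]

theorem IsTest.transport_const_mul {f : PlanarPhaseSpace → ℝ} (hf : S.IsTest f) (c : ℝ) :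
    S.classicalTransport (fun z => c * f z) = fun z => c * S.classicalTransport f z := by
  funext z
  rw [S.classicalTransport_eq, fderiv_const_mul (hf.1.differentiable one_ne_zero z), smul_apply,
    ← S.classicalTransport_eq, smul_eq_mul]

theorem IsTestTriple.sub {w d e w' d' e' : S.Hilb} (h : S.IsTestTriple w d e)
    (h' : S.IsTestTriple w' d' e') : S.IsTestTriple (w - w') (d - d') (e - e') := by
  obtain ⟨f, hf, hf1, hw, hd, he⟩ := h
  obtain ⟨g, hg, hg1, hw', hd', he'⟩ := h'
  have t1 := hf.transport_add (hg.const_mul (-1))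
  rw [hg.transport_const_mul] at t1
  have t2 := hf1.transport_add (hg1.const_mul (-1))
  rw [hg1.transport_const_mul] at t2
  refine ⟨fun z => f z + (-1) * g z, hf.add (hg.const_mul _), ?_, ?_, ?_, ?_⟩
  · rw [t1]; exact hf1.add (hg1.const_mul _)
  · filter_upwards [hw, hw', Lp.coeFn_sub w w'] with z h1 h2 h3
    rw [h3, Pi.sub_apply, h1, h2]; ring
  · rw [t1]
    filter_upwards [hd, hd', Lp.coeFn_sub d d'] with z h1 h2 h3
    rw [h3, Pi.sub_apply, h1, h2]; ring
  · rw [t1, t2]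
    filter_upwards [he, he', Lp.coeFn_sub e e'] with z h1 h2 h3
    rw [h3, Pi.sub_apply, h1, h2]; ring

theorem IsTestTriple.fst_mem {w d e : S.Hilb} (h : S.IsTestTriple w d e) :
    (w, d) ∈ S.transportGraph := by
  obtain ⟨f, hf, -, hw, hd, -⟩ := h
  exact S.mem_transportGraph_of_test hf hw hd

theorem IsTestTriple.snd_mem {w d e : S.Hilb} (h : S.IsTestTriple w d e) :
    (d, e) ∈ S.transportGraph := by
  obtain ⟨f, -, hf, -, hd, he⟩ := h
  exact S.mem_transportGraph_of_test hf hd he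

theorem inner_transport_of_test {g h w d : S.Hilb} (hgh : (g, h) ∈ S.transportGraph)
    {f : PlanarPhaseSpace → ℝ} (hf : S.IsTest f) (hw : w =ᵐ[S.weightMeasure] f)
    (hd : d =ᵐ[S.weightMeasure] S.classicalTransport f) : ⟪g, d⟫_ℝ = -⟪h, w⟫_ℝ := by
  have h1 : ∫ z, g z * S.classicalTransport f z ∂S.weightMeasure =
      -∫ z, h z * f z ∂S.weightMeasure := hgh f hf
  rw [S.inner_eq_integral, S.inner_eq_integral]
  have e1 : ∫ z, g z * d z ∂S.weightMeasure =
      ∫ z, g z * S.classicalTransport f z ∂S.weightMeasure := by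
    refine integral_congr_ae ?_
    filter_upwards [hd] with z hz
    rw [hz]
  have e2 : ∫ z, h z * w z ∂S.weightMeasure = ∫ z, h z * f z ∂S.weightMeasure := by
    refine integral_congr_ae ?_
    filter_upwards [hw] with z hz
    rw [hz]
  rw [e1, e2, h1]

theorem IsTestTriple.inner_fst {w d e g h : S.Hilb} (H : S.IsTestTriple w d e)
    (hgh : (g, h) ∈ S.transportGraph) : ⟪g, d⟫_ℝ = -⟪h, w⟫_ℝ := by
  obtain ⟨f, hf, -, hw, hd, -⟩ := H
  exact inner_transport_of_test hgh hf hw hd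

theorem IsTestTriple.inner_snd {w d e g h : S.Hilb} (H : S.IsTestTriple w d e)
    (hgh : (g, h) ∈ S.transportGraph) : ⟪g, e⟫_ℝ = -⟪h, d⟫_ℝ := by
  obtain ⟨f, -, hf, -, hd, he⟩ := H
  exact inner_transport_of_test hgh hf hd he

/-- ‖𝓓w‖² = -⟪𝓓²w, w⟫. This interpolation is what controls first derivatives by the graph norm of
𝓓². -/
theorem IsTestTriple.norm_sq_le {w d e : S.Hilb} (H : S.IsTestTriple w d e) :
    ‖d‖ ^ 2 ≤ ‖e‖ * ‖w‖ := by
  have h1 := H.inner_fst H.snd_mem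
  rw [real_inner_self_eq_norm_sq] at h1
  rw [h1]
  exact (neg_le_abs _).trans (abs_real_inner_le_norm _ _)

/-- The square of the transport operator is closed along sequences of test functions. -/
theorem exists_tendsto_of_testTriple {w d e : ℕ → S.Hilb} {u h : S.Hilb}
    (H : ∀ n, S.IsTestTriple (w n) (d n) (e n)) (hw : Tendsto w atTop (𝓝 u))
    (he : Tendsto e atTop (𝓝 h)) :
    ∃ k, Tendsto d atTop (𝓝 k) ∧ (u, k) ∈ S.transportGraph ∧ (k, h) ∈ S.transportGraph := by
  -- The interpolation inequality, applied to differences, makes the first derivatives converge as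
  -- well.
  have hcau : CauchySeq d := by
    rw [Metric.cauchySeq_iff]
    intro ε hε
    obtain ⟨N, hN⟩ := Metric.cauchySeq_iff.1 hw.cauchySeq ε hε
    obtain ⟨M, hM⟩ := Metric.cauchySeq_iff.1 he.cauchySeq ε hε
    refine ⟨max N M, fun m hm n hn => ?_⟩
    have h1 := hN m ((le_max_left _ _).trans hm) n ((le_max_left _ _).trans hn)
    have h2 := hM m ((le_max_right _ _).trans hm) n ((le_max_right _ _).trans hn)
    have h3 := ((H m).sub (H n)).norm_sq_le
    rw [dist_eq_norm] at h1 h2 ⊢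
    refine lt_of_pow_lt_pow_left₀ 2 hε.le (h3.trans_lt ?_)
    rw [pow_two]
    exact mul_lt_mul'' h2 h1 (norm_nonneg _) (norm_nonneg _)
  obtain ⟨k, hk⟩ := cauchySeq_tendsto_of_complete hcau
  refine ⟨k, hk, ?_, ?_⟩
  · exact S.isClosed_transportGraph.mem_of_tendsto (hw.prodMk_nhds hk)
      (Eventually.of_forall fun n => (H n).fst_mem)
  · exact S.isClosed_transportGraph.mem_of_tendsto (hk.prodMk_nhds he)
      (Eventually.of_forall fun n => (H n).snd_mem)

theorem IsTestTriple.exists_transportSq {w d e : S.Hilb} (H : S.IsTestTriple w d e) :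
    ∃ hw : w ∈ (-S.transportSq).domain, (-S.transportSq) ⟨w, hw⟩ = -e :=
  S.transportSq_of_graph H.fst_mem H.snd_mem

variable (S)

/-- Finite sums of modes. -/
def modeSum (n : ℕ) (Ψ : ℕ → ℝ × ℝ × ℝ → ℂ) (z : PlanarPhaseSpace) : ℝ :=
  ∑ k ∈ Finset.range n, S.mode k (Ψ k) z

/-- Families of amplitudes with values in prescribed subspaces. -/
def IsModeFamily (P : ℕ → Submodule ℝ ℂ) (Ψ : ℕ → ℝ × ℝ × ℝ → ℂ) : Prop :=
  ∀ k, S.IsAction (Ψ k) ∧ ∀ p, Ψ k p ∈ P k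

variable {S}
variable {P : ℕ → Submodule ℝ ℂ} {Ψ Φ : ℕ → ℝ × ℝ × ℝ → ℂ}

/-- Real multipliers preserve the real subspaces `P k`. Orders with `P k = ⊥` carry no amplitude, so
nothing is asked of `g k` there; this admits multipliers such as 1 / (k² freqSq - lam) that may be
singular for excluded orders. -/
theorem IsModeFamily.energy_mul (hΨ : S.IsModeFamily P Ψ) {g : ℕ → ℝ → ℝ}
    (hg : ∀ k, P k ≠ ⊥ → ContDiffOn ℝ 1 (g k) (Ioo (S.U₀ 0) S.E₀)) :
    S.IsModeFamily P fun k p => (g k p.1 : ℂ) * Ψ k p := by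
  intro k
  by_cases hk : P k = ⊥
  · have h0 : ∀ p, Ψ k p = 0 := fun p => by
      have := (hΨ k).2 p
      rwa [hk, Submodule.mem_bot] at this
    simp only [h0, mul_zero]
    exact ⟨IsAction.zero S, fun _ => (P k).zero_mem⟩
  · refine ⟨(hΨ k).1.energy_mul (hg k hk), fun p => ?_⟩
    change ((g k p.1 : ℝ) : ℂ) * Ψ k p ∈ P k
    rw [← Complex.real_smul]
    exact (P k).smul_mem _ ((hΨ k).2 p)

theorem isTest_modeSum (n : ℕ) (hΨ : ∀ k, S.IsAction (Ψ k)) : S.IsTest (S.modeSum n Ψ) := by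
  unfold modeSum
  induction n with
  | zero =>
    simp only [Finset.range_zero, Finset.sum_empty]
    exact ⟨contDiff_const, HasCompactSupport.zero, by
      rw [show (fun _ : PlanarPhaseSpace => (0 : ℝ)) = 0 from rfl]; simp⟩
  | succ n ih =>
    simp only [Finset.sum_range_succ]
    exact ih.add (S.isTest_mode n (hΨ n))

theorem transport_modeSum (n : ℕ) (hΨ : ∀ k, S.IsAction (Ψ k)) :
    S.classicalTransport (S.modeSum n Ψ) =
      S.modeSum n fun k p => (k * Complex.I) * ((S.freq p.1 : ℂ) * Ψ k p) := by
  induction n with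
  | zero =>
    have h0 : ∀ Φ, S.modeSum 0 Φ = fun _ => 0 := fun Φ => by funext z; simp [modeSum]
    rw [h0, h0]
    funext z
    simp [classicalTransport]
  | succ n ih =>
    have h1 : ∀ Φ, S.modeSum (n + 1) Φ = fun z => S.modeSum n Φ z + S.mode n (Φ n) z := fun Φ => by
      funext z
      simp only [modeSum, Finset.sum_range_succ]
    rw [h1, h1, (isTest_modeSum n hΨ).transport_add (S.isTest_mode n (hΨ n)), ih,
      S.transport_mode n (hΨ n)]

theorem transport_transport_modeSum (n : ℕ) (hΨ : ∀ k, S.IsAction (Ψ k)) :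
    S.classicalTransport (S.classicalTransport (S.modeSum n Ψ)) =
      S.modeSum n fun k p => ((-(k ^ 2 * S.freqSq p.1) : ℝ) : ℂ) * Ψ k p := by
  rw [transport_modeSum n hΨ, transport_modeSum n fun k => (hΨ k).freq_mul k]
  funext z
  refine Finset.sum_congr rfl fun k _ => ?_
  congr 1
  funext p
  dsimp only
  rw [freqSq_eq_sq]
  push_cast
  linear_combination (k ^ 2 * S.freq p.1 ^ 2 * Ψ k p : ℂ) * Complex.I_sq

theorem testTriple_modeSum (n : ℕ) (hΨ : ∀ k, S.IsAction (Ψ k)) {g : S.Hilb}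
    (hg : g =ᵐ[S.weightMeasure] S.modeSum n Ψ) :
    ∃ d e : S.Hilb, S.IsTestTriple g d e ∧
      e =ᵐ[S.weightMeasure] S.modeSum n fun k p => ((-(k ^ 2 * S.freqSq p.1) : ℝ) : ℂ) * Ψ k p := by
  have t1 := isTest_modeSum n hΨ
  have t2 : S.IsTest (S.classicalTransport (S.modeSum n Ψ)) := by
    rw [transport_modeSum n hΨ]
    exact isTest_modeSum n fun k => (hΨ k).freq_mul k
  refine ⟨(S.memLp_transport_test t1).toLp, (S.memLp_transport_test t2).toLp,
    ⟨_, t1, t2, hg, MemLp.coeFn_toLp _, MemLp.coeFn_toLp _⟩, ?_⟩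
  rw [← transport_transport_modeSum n hΨ]
  exact MemLp.coeFn_toLp _

/-- Pythagoras for modes of different orders. -/
theorem norm_sq_modeSum (n : ℕ) (hΨ : ∀ k, S.IsAction (Ψ k)) {g : S.Hilb}
    (hg : g =ᵐ[S.weightMeasure] S.modeSum n Ψ) :
    ‖g‖ ^ 2 = ∑ k ∈ Finset.range n, ∫ z, S.mode k (Ψ k) z ^ 2 ∂S.weightMeasure := by
  have hi : ∀ j k, Integrable (fun z => S.mode j (Ψ j) z * S.mode k (Ψ k) z) S.weightMeasure :=
    fun j k => (S.memLp_test (S.isTest_mode j (hΨ j))).integrable_mul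
      (S.memLp_test (S.isTest_mode k (hΨ k)))
  have e1 : ∫ z, g z * g z ∂S.weightMeasure = ∫ z, ∑ j ∈ Finset.range n, ∑ k ∈ Finset.range n,
      S.mode j (Ψ j) z * S.mode k (Ψ k) z ∂S.weightMeasure := by
    refine integral_congr_ae ?_
    filter_upwards [hg] with z hz
    rw [hz, modeSum, Finset.sum_mul_sum]
  rw [← real_inner_self_eq_norm_sq, S.inner_eq_integral, e1,
    integral_finsetSum _ fun j _ => integrable_finsetSum _ fun k _ => hi j k]
  refine Finset.sum_congr rfl fun j hj => ?_
  rw [integral_finsetSum _ fun k _ => hi j k, Finset.sum_eq_single j]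
  · simp only [pow_two]
  · intro k _ hkj
    exact S.integral_mode_mul_mode hkj.symm (hΨ j) (hΨ k)
  · exact fun h => absurd hj h

variable (S)

/-- The span of the modes with amplitudes in prescribed subspaces. -/
def core (P : ℕ → Submodule ℝ ℂ) : Submodule ℝ S.Hilb where
  carrier := {g | ∃ n Ψ, S.IsModeFamily P Ψ ∧ g =ᵐ[S.weightMeasure] S.modeSum n Ψ}
  zero_mem' := ⟨0, fun _ => 0, fun k => ⟨IsAction.zero S, fun _ => (P k).zero_mem⟩, by
    filter_upwards [Lp.coeFn_zero ℝ 2 S.weightMeasure] with z hz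
    rw [hz]; simp [modeSum]⟩
  add_mem' := by
    rintro g h ⟨n, Ψ, hΨ, hg⟩ ⟨m, Φ, hΦ, hh⟩
    -- Sums of different lengths are made comparable by padding with zero amplitudes.
    have htr : ∀ (n N : ℕ) (Ψ : ℕ → ℝ × ℝ × ℝ → ℂ), n ≤ N → ∀ z, S.modeSum n Ψ z =
        S.modeSum N (fun k => if k < n then Ψ k else 0) z := by
      intro n N Ψ hnN z
      rw [modeSum, modeSum]
      have h1 : ∀ k ∈ Finset.range n, S.mode k (Ψ k) z =
          S.mode k (if k < n then Ψ k else 0) z := fun k hk => by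
        rw [if_pos (Finset.mem_range.1 hk)]
      rw [Finset.sum_congr rfl h1]
      refine Finset.sum_subset (Finset.range_mono hnN) fun k _ hk => ?_
      rw [if_neg (by simpa using hk)]
      simp [mode]
    have htf : ∀ (n : ℕ) (Ψ : ℕ → ℝ × ℝ × ℝ → ℂ), S.IsModeFamily P Ψ →
        S.IsModeFamily P fun k => if k < n then Ψ k else 0 := by
      intro n Ψ hΨ k
      by_cases hk : k < n
      · simp only [hk, if_true]
        exact hΨ k
      · simp only [hk, if_false]
        exact ⟨IsAction.zero S, fun _ => (P k).zero_mem⟩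
    refine ⟨max n m, fun k p => (if k < n then Ψ k else 0) p + (if k < m then Φ k else 0) p,
      fun k => ⟨(htf n Ψ hΨ k).1.add (htf m Φ hΦ k).1,
        fun p => (P k).add_mem ((htf n Ψ hΨ k).2 p) ((htf m Φ hΦ k).2 p)⟩, ?_⟩
    filter_upwards [hg, hh, Lp.coeFn_add g h] with z h1 h2 h3
    rw [h3, Pi.add_apply, h1, h2, htr n _ Ψ (le_max_left n m), htr m _ Φ (le_max_right n m)]
    simp only [modeSum, ← Finset.sum_add_distrib]
    refine Finset.sum_congr rfl fun k _ => ?_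
    rw [mode, mode, mode, ← Complex.add_re, ← add_mul]
  smul_mem' := by
    rintro c g ⟨n, Ψ, hΨ, hg⟩
    refine ⟨n, _, hΨ.energy_mul (g := fun _ _ => c) fun _ _ => contDiffOn_const, ?_⟩
    filter_upwards [hg, Lp.coeFn_smul c g] with z h1 h2
    rw [h2, Pi.smul_apply, h1, smul_eq_mul]
    simp only [modeSum, Finset.mul_sum]
    refine Finset.sum_congr rfl fun k _ => ?_
    exact (S.mode_energy_mul k (fun _ => c) (Ψ k) z).symm

variable {S}

theorem exists_testTriple_of_core {g : S.Hilb} (hg : g ∈ S.core P) :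
    ∃ d e : S.Hilb, S.IsTestTriple g d e := by
  obtain ⟨n, Ψ, hΨ, hg⟩ := hg
  obtain ⟨d, e, h, -⟩ := testTriple_modeSum n (fun k => (hΨ k).1) hg
  exact ⟨d, e, h⟩

/-- `-𝓓² - lam` is bounded below on the modes whose frequencies stay away from `lam`. -/
theorem core_bound {lam d : ℝ} (hd : 0 < d) (hP : ∀ k, P k ≠ ⊥ → ∀ E ∈ Icc (S.U₀ 0) S.E₀,
    d ≤ |k ^ 2 * S.freqSq E - lam|) (w : (-S.transportSq).domain) (hw : (w : S.Hilb) ∈ S.core P) :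
    d * ‖(w : S.Hilb)‖ ≤ ‖(-S.transportSq) w - lam • (w : S.Hilb)‖ := by
  obtain ⟨n, Ψ, hΨ, hg⟩ := hw
  obtain ⟨w, hwD⟩ := w
  obtain ⟨d', e, h, he⟩ := testTriple_modeSum n (fun k => (hΨ k).1) hg
  obtain ⟨hw', heq⟩ := h.exists_transportSq
  rw [heq]
  have hfam : S.IsModeFamily P fun k p => ((k ^ 2 * S.freqSq p.1 - lam : ℝ) : ℂ) * Ψ k p :=
    hΨ.energy_mul (g := fun k E => k ^ 2 * S.freqSq E - lam) fun k _ =>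
      (contDiffOn_const.mul (S.contDiffOn_freq_Ioo.pow 2)).sub contDiffOn_const
  have hrep : (-e - lam • w : S.Hilb) =ᵐ[S.weightMeasure]
      S.modeSum n fun k p => ((k ^ 2 * S.freqSq p.1 - lam : ℝ) : ℂ) * Ψ k p := by
    filter_upwards [he, hg, Lp.coeFn_sub (-e) (lam • w), Lp.coeFn_neg e, Lp.coeFn_smul lam w]
      with z h1 h2 h3 h4 h5
    rw [h3, Pi.sub_apply, h4, Pi.neg_apply, h5, Pi.smul_apply, h1, h2, smul_eq_mul]
    simp only [modeSum, Finset.mul_sum, ← Finset.sum_neg_distrib, ← Finset.sum_sub_distrib]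
    refine Finset.sum_congr rfl fun k _ => ?_
    rw [S.mode_energy_mul k (fun E => -(k ^ 2 * S.freqSq E)),
      S.mode_energy_mul k (fun E => k ^ 2 * S.freqSq E - lam)]
    ring
  have n1 := norm_sq_modeSum n (fun k => (hΨ k).1) hg
  have n2 := norm_sq_modeSum n (fun k => (hfam k).1) hrep
  refine le_of_sq_le_sq ?_ (norm_nonneg _)
  rw [mul_pow, n1, n2, Finset.mul_sum]
  refine Finset.sum_le_sum fun k _ => ?_
  rw [← integral_const_mul]
  have hi : ∀ {Φ : ℝ × ℝ × ℝ → ℂ}, S.IsAction Φ →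
      Integrable (fun z => S.mode k Φ z ^ 2) S.weightMeasure := fun hΦ =>
    (S.memLp_test (S.isTest_mode k hΦ)).integrable_sq
  refine integral_mono ((hi (hΨ k).1).const_mul _) (hi (hfam k).1) fun z => ?_
  dsimp only
  rw [S.mode_energy_mul k (fun E => k ^ 2 * S.freqSq E - lam), mul_pow]
  by_cases hz : S.mode k (Ψ k) z = 0
  · rw [hz]; simp
  · have hne : Ψ k (S.actions z) ≠ 0 := fun h0 => hz (by rw [mode, h0]; simp)
    have hk : P k ≠ ⊥ := fun hb => hne (by
      have := (hΨ k).2 (S.actions z)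
      rwa [hb, Submodule.mem_bot] at this)
    have hdom := (hΨ k).1.2.2 (subset_tsupport _ hne)
    refine mul_le_mul_of_nonneg_right ?_ (sq_nonneg _)
    rw [← sq_abs (_ - _)]
    exact pow_le_pow_left₀ hd.le (hP k hk _ ⟨hdom.1.le, hdom.2.1.le⟩) 2

/-- On order k the operator -𝓓² - lam is multiplication by k² freqSq(E) - lam. Where this has no
zero, dividing the amplitudes gives an exact solution inside the core. -/
theorem core_surjective {lam : ℝ} (hP : ∀ k, P k ≠ ⊥ → ∀ E ∈ Icc (S.U₀ 0) S.E₀,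
    k ^ 2 * S.freqSq E ≠ lam) {f : S.Hilb} (hf : f ∈ S.core P) :
    ∃ w : (-S.transportSq).domain, (w : S.Hilb) ∈ S.core P ∧
      (-S.transportSq) w - lam • (w : S.Hilb) = f := by
  obtain ⟨n, Ψ, hΨ, hg⟩ := hf
  have hfam : S.IsModeFamily P fun k p => (((k ^ 2 * S.freqSq p.1 - lam)⁻¹ : ℝ) : ℂ) * Ψ k p :=
    hΨ.energy_mul (g := fun k E => (k ^ 2 * S.freqSq E - lam)⁻¹) fun k hk =>
      ((contDiffOn_const.mul (S.contDiffOn_freq_Ioo.pow 2)).sub contDiffOn_const).inv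
        fun E hE => sub_ne_zero.2 (hP k hk E ⟨hE.1.le, hE.2.le⟩)
  have ht := isTest_modeSum n fun k => (hfam k).1
  obtain ⟨d', e, h, he⟩ := testTriple_modeSum n (fun k => (hfam k).1)
    (S.memLp_test ht).coeFn_toLp
  obtain ⟨hw', heq⟩ := h.exists_transportSq
  refine ⟨⟨_, hw'⟩, ⟨n, _, hfam, (S.memLp_test ht).coeFn_toLp⟩, ?_⟩
  rw [heq]
  refine Lp.ext ?_
  filter_upwards [he, hg, (S.memLp_test ht).coeFn_toLp, Lp.coeFn_neg e,
    Lp.coeFn_sub (-e) (lam • (S.memLp_test ht).toLp), Lp.coeFn_smul lam (S.memLp_test ht).toLp]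
    with z h1 h2 h3 h4 h5 h6
  rw [h5, Pi.sub_apply, h4, Pi.neg_apply, h6, Pi.smul_apply, h1, h2, h3, smul_eq_mul]
  simp only [modeSum, Finset.mul_sum, ← Finset.sum_neg_distrib, ← Finset.sum_sub_distrib]
  refine Finset.sum_congr rfl fun k _ => ?_
  rw [S.mode_energy_mul k (fun E => -(k ^ 2 * S.freqSq E)) fun p =>
      (((k ^ 2 * S.freqSq p.1 - lam)⁻¹ : ℝ) : ℂ) * Ψ k p,
    S.mode_energy_mul k (fun E => (k ^ 2 * S.freqSq E - lam)⁻¹)]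
  by_cases hz : S.mode k (Ψ k) z = 0
  · rw [hz]; simp
  · have hne : Ψ k (S.actions z) ≠ 0 := fun h0 => hz (by rw [mode, h0]; simp)
    have hk : P k ≠ ⊥ := fun hb => hne (by
      have := (hΨ k).2 (S.actions z)
      rwa [hb, Submodule.mem_bot] at this)
    have hdom := (hΨ k).1.2.2 (subset_tsupport _ hne)
    have h0 : (k : ℝ) ^ 2 * S.freqSq (S.energy z) - lam ≠ 0 :=
      sub_ne_zero.2 (hP k hk _ ⟨hdom.1.le, hdom.2.1.le⟩)
    field_simp

/-- Both derivatives are moved onto the smooth function, which needs only the definition of the weak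
derivative. -/
theorem inner_transportSq_of_testTriple {w d e : S.Hilb} (H : S.IsTestTriple w d e)
    (g : (-S.transportSq).domain) : ⟪(-S.transportSq) g, w⟫_ℝ = ⟪(g : S.Hilb), -e⟫_ℝ := by
  obtain ⟨h, h1, h2⟩ := S.graph_of_transportSq g
  have e1 := H.inner_fst h2
  have e2 := H.inner_snd h1
  rw [inner_neg_right, e2, e1, inner_neg_left]
  ring

end PlanarSteadyState

namespace PlanarSteadyState

variable (S : PlanarSteadyState)

/-! The modes are total in the weighted Hilbert space. -/

/-- The span of the modes, as functions. -/
def modeSpan : Submodule ℝ (PlanarPhaseSpace → ℝ) :=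
  Submodule.span ℝ {f | ∃ k Ψ, S.IsAction Ψ ∧ f = S.mode k Ψ}

/-- The functions that map the span of the modes into itself by multiplication. -/
def modeMultiplier : Subalgebra ℝ (PlanarPhaseSpace → ℝ) where
  carrier := {F | ∀ m ∈ S.modeSpan, F * m ∈ S.modeSpan}
  mul_mem' := fun hF hG m hm => by rw [mul_assoc]; exact hF _ (hG _ hm)
  add_mem' := fun hF hG m hm => by rw [add_mul]; exact S.modeSpan.add_mem (hF _ hm) (hG _ hm)
  algebraMap_mem' := fun r m hm => by
    rw [← Algebra.smul_def]; exact S.modeSpan.smul_mem r hm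

variable {S}

theorem mem_modeMultiplier {F : PlanarPhaseSpace → ℝ}
    (h : ∀ k Ψ, S.IsAction Ψ → F * S.mode k Ψ ∈ S.modeSpan) : F ∈ S.modeMultiplier := by
  intro m hm
  induction hm using Submodule.span_induction with
  | mem x hx => obtain ⟨k, Ψ, hΨ, rfl⟩ := hx; exact h k Ψ hΨ
  | zero => rw [mul_zero]; exact S.modeSpan.zero_mem
  | add x y _ _ hx hy => rw [mul_add]; exact S.modeSpan.add_mem hx hy
  | smul a x _ hx => rw [mul_smul_comm]; exact S.modeSpan.smul_mem a hx

theorem mode_mem_modeSpan (k : ℕ) {Ψ : ℝ × ℝ × ℝ → ℂ} (hΨ : S.IsAction Ψ) :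
    S.mode k Ψ ∈ S.modeSpan := Submodule.subset_span ⟨k, Ψ, hΨ, rfl⟩

theorem IsAction.conj {Ψ : ℝ × ℝ × ℝ → ℂ} (hΨ : S.IsAction Ψ) :
    S.IsAction fun p => (starRingEnd ℂ) (Ψ p) := by
  have h : tsupport (fun p => (starRingEnd ℂ) (Ψ p)) ⊆ tsupport Ψ :=
    closure_mono fun p hp h0 => hp (by simp only [h0, map_zero])
  exact ⟨Complex.conjCLE.contDiff.comp hΨ.1, hΨ.2.1.of_isClosed_subset (isClosed_tsupport _) h,
    h.trans hΨ.2.2⟩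

theorem IsAction.const_mul {Ψ : ℝ × ℝ × ℝ → ℂ} (c : ℂ) (hΨ : S.IsAction Ψ) :
    S.IsAction fun p => c * Ψ p := IsAction.mul (g := fun _ => c) contDiffOn_const hΨ

theorem comp_actions_mem_modeMultiplier {f : ℝ × ℝ × ℝ → ℝ} (hf : ContDiff ℝ 1 f) :
    (fun z => f (S.actions z)) ∈ S.modeMultiplier := by
  refine mem_modeMultiplier fun k Ψ hΨ => ?_
  have h1 : S.IsAction fun p => (f p : ℂ) * Ψ p :=
    IsAction.mul (g := fun p => (f p : ℂ)) (Complex.ofRealCLM.contDiff.comp hf).contDiffOn hΨ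
  have h2 : (fun z => f (S.actions z)) * S.mode k Ψ = S.mode k fun p => (f p : ℂ) * Ψ p := by
    funext z
    rw [Pi.mul_apply, mode, mode, ← Complex.re_ofReal_mul, mul_assoc]
  rw [h2]
  exact mode_mem_modeSpan k h1

theorem angle_mul_conj (z : PlanarPhaseSpace) :
    S.angle z * (starRingEnd ℂ) (S.angle z) = 1 := by
  rw [Complex.mul_conj, Complex.normSq_eq_norm_sq, S.norm_angle]
  simp

/-- Re a · Re b = (Re(ab) + Re(āb)) / 2 turns multiplication by the angle into shifts of the order
by ±1. At order 0 no lower order exists, and b is conjugated instead of a. -/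
theorem re_angle_mem_modeMultiplier (c : ℂ) :
    (fun z => (c * S.angle z).re) ∈ S.modeMultiplier := by
  refine mem_modeMultiplier fun k Ψ hΨ => ?_
  have key : ∀ a b : ℂ, a.re * b.re = (1 / 2) * (a * b).re +
      (1 / 2) * ((starRingEnd ℂ) a * b).re := fun a b => by
    simp [Complex.mul_re]; ring
  have key' : ∀ a b : ℂ, a.re * b.re = (1 / 2) * (a * b).re +
      (1 / 2) * (a * (starRingEnd ℂ) b).re := fun a b => by
    simp [Complex.mul_re]; ring
  rcases k with _ | k
  · have h2 : (fun z => (c * S.angle z).re) * S.mode 0 Ψ =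
        (1 / 2 : ℝ) • S.mode 1 (fun p => c * Ψ p) +
        (1 / 2 : ℝ) • S.mode 1 (fun p => c * (starRingEnd ℂ) (Ψ p)) := by
      funext z
      simp only [Pi.mul_apply, Pi.add_apply, Pi.smul_apply, smul_eq_mul, mode, pow_zero, mul_one,
        pow_one, key']
      congr 3 <;> ring
    rw [h2]
    exact S.modeSpan.add_mem (S.modeSpan.smul_mem _ (mode_mem_modeSpan 1 (hΨ.const_mul c)))
      (S.modeSpan.smul_mem _ (mode_mem_modeSpan 1 (hΨ.conj.const_mul c)))
  · have h2 : (fun z => (c * S.angle z).re) * S.mode (k + 1) Ψ =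
        (1 / 2 : ℝ) • S.mode (k + 2) (fun p => c * Ψ p) +
        (1 / 2 : ℝ) • S.mode k (fun p => (starRingEnd ℂ) c * Ψ p) := by
      funext z
      simp only [Pi.mul_apply, Pi.add_apply, Pi.smul_apply, smul_eq_mul, mode, key]
      congr 3
      · ring
      · rw [map_mul]
        linear_combination ((starRingEnd ℂ) c * Ψ (S.actions z) * S.angle z ^ k) *
          S.angle_mul_conj z
    rw [h2]
    exact S.modeSpan.add_mem (S.modeSpan.smul_mem _ (mode_mem_modeSpan _ (hΨ.const_mul c)))
      (S.modeSpan.smul_mem _ (mode_mem_modeSpan _ (hΨ.const_mul _)))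

/-- E determines the modulus of v₁ + i r(x), and on a fixed circle the angle variable determines the
argument. -/
theorem eq_of_actions_eq_of_angle_eq {z w : PlanarPhaseSpace} (h1 : S.actions z = S.actions w)
    (h2 : S.angle z = S.angle w) : z = w := by
  have hE : S.energy z = S.energy w := (Prod.ext_iff.1 h1).1
  have hv : z.2.2 = w.2.2 := (Prod.ext_iff.1 h1).2
  have hc : S.coord z = S.coord w :=
    S.complexAngleExp_injective (by rw [S.norm_coord, S.norm_coord, hE]) h2
  have hre := congrArg Complex.re hc
  have him := congrArg Complex.im hc
  simp only [coord, Complex.add_re, Complex.ofReal_re, Complex.mul_re, Complex.I_re, mul_zero,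
    Complex.ofReal_im, Complex.I_im, zero_mul, sub_zero, add_zero] at hre
  simp only [coord, Complex.add_im, Complex.ofReal_re, Complex.mul_im, Complex.I_re, mul_zero,
    Complex.ofReal_im, Complex.I_im, mul_one, zero_add, add_zero] at him
  exact Prod.ext (S.strictMono_radial.injective him) (Prod.ext hre hv)

theorem continuousOn_angle : ContinuousOn S.angle {z | S.U₀ 0 < S.energy z} := fun _ hz =>
  (S.contDiffAt_angle hz).continuousAt.continuousWithinAt

/-- Uniform approximation by multipliers on compact sets without equilibria. -/
theorem exists_multiplier_near {L : Set PlanarPhaseSpace} (hL : IsCompact L)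
    (hLE : ∀ z ∈ L, S.U₀ 0 < S.energy z) {ξ : PlanarPhaseSpace → ℝ} (hξ : Continuous ξ) {ε : ℝ}
    (hε : 0 < ε) : ∃ F ∈ S.modeMultiplier, ∀ z ∈ L, |F z - ξ z| ≤ ε := by
  have : CompactSpace L := isCompact_iff_compactSpace.1 hL
  -- Stone–Weierstrass: the restrictions of multipliers form an algebra, which separates points
  -- because E, v̄ and the angle determine a point of phase space.
  let A : Subalgebra ℝ C(L, ℝ) :=
    { carrier := {F | ∃ G ∈ S.modeMultiplier, ∀ z : L, F z = G z}
      mul_mem' := by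
        rintro F F' ⟨G, hG, h⟩ ⟨G', hG', h'⟩
        exact ⟨G * G', S.modeMultiplier.mul_mem hG hG', fun z => by simp [h, h']⟩
      add_mem' := by
        rintro F F' ⟨G, hG, h⟩ ⟨G', hG', h'⟩
        exact ⟨G + G', S.modeMultiplier.add_mem hG hG', fun z => by simp [h, h']⟩
      algebraMap_mem' := fun r => ⟨_, S.modeMultiplier.algebraMap_mem r, fun z => rfl⟩ }
  have hact : ∀ (f : ℝ × ℝ × ℝ → ℝ), ContDiff ℝ 1 f → ∃ F ∈ A, ∀ z : L, F z = f (S.actions z) :=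
    fun f hf => ⟨⟨fun z => f (S.actions z), hf.continuous.comp
      (S.contDiff_actions.continuous.comp continuous_subtype_val)⟩,
      ⟨_, comp_actions_mem_modeMultiplier hf, fun z => rfl⟩, fun z => rfl⟩
  have hang : ∀ c : ℂ, ∃ F ∈ A, ∀ z : L, F z = (c * S.angle z).re :=
    fun c => ⟨⟨fun z => (c * S.angle z).re, by
      have : Continuous fun z : L => S.angle z := (continuousOn_angle.mono hLE).domRestrict
      fun_prop⟩, ⟨_, re_angle_mem_modeMultiplier c, fun z => rfl⟩, fun z => rfl⟩
  have hsep : A.SeparatesPoints := by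
    intro z w hzw
    by_contra hcon
    have hA : ∀ F ∈ A, F z = F w := fun F hF => by
      by_contra h
      exact hcon ⟨F, ⟨F, hF, rfl⟩, h⟩
    have h1 : ∀ f : ℝ × ℝ × ℝ → ℝ, ContDiff ℝ 1 f → f (S.actions z) = f (S.actions w) := by
      intro f hf
      obtain ⟨F, hF, h⟩ := hact f hf
      rw [← h, ← h, hA F hF]
    have h2 : ∀ c : ℂ, (c * S.angle z).re = (c * S.angle w).re := by
      intro c
      obtain ⟨F, hF, h⟩ := hang c
      rw [← h, ← h, hA F hF]
    refine hzw (Subtype.ext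
      (eq_of_actions_eq_of_angle_eq (S := S) (Prod.ext ?_ (Prod.ext ?_ ?_)) ?_))
    · exact h1 (fun p => p.1) (by fun_prop)
    · exact h1 (fun p => p.2.1) (by fun_prop)
    · exact h1 (fun p => p.2.2) (by fun_prop)
    · refine Complex.ext (by simpa using h2 1) ?_
      simpa using h2 Complex.I
  obtain ⟨F, hF⟩ := ContinuousMap.exists_mem_subalgebra_near_continuousMap_of_separatesPoints A
    hsep ⟨fun z => ξ z, hξ.comp continuous_subtype_val⟩ ε hε
  obtain ⟨G, hG, h⟩ := F.2
  refine ⟨G, hG, fun z hz => ?_⟩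
  have := (ContinuousMap.norm_coe_le_norm _ (⟨z, hz⟩ : L)).trans hF.le
  rw [← h ⟨z, hz⟩]
  simpa using this

theorem exists_cutoff {K : Set (ℝ × ℝ × ℝ)} (hK : IsCompact K) {U : Set (ℝ × ℝ × ℝ)}
    (hU : IsOpen U) (hKU : K ⊆ U) : ∃ κ : ℝ × ℝ × ℝ → ℝ, ContDiff ℝ 1 κ ∧ HasCompactSupport κ ∧
      tsupport κ ⊆ U ∧ ∀ p ∈ K, κ p = 1 := by
  obtain ⟨L, hL, hKL, hLU⟩ := exists_compact_between hK hU hKU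
  obtain ⟨f, h1, h2, -⟩ := exists_contMDiffMap_one_nhds_of_subset_interior (n := 1)
    (modelWithCornersSelf ℝ (ℝ × ℝ × ℝ)) hK.isClosed hKL
  have hs : tsupport f ⊆ L := closure_minimal (fun p hp => by
    by_contra h; exact hp (h2 p h)) hL.isClosed
  exact ⟨f, f.contMDiff.contDiff, hL.of_isClosed_subset (isClosed_tsupport _) hs, hs.trans hLU,
    fun p hp => h1.self_of_nhdsSet p hp⟩

theorem integrable_mul_modeSpan (g : S.Hilb) {m : PlanarPhaseSpace → ℝ} (hm : m ∈ S.modeSpan) :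
    Integrable (fun z => g z * m z) S.weightMeasure := by
  induction hm using Submodule.span_induction with
  | mem x hx =>
    obtain ⟨k, Ψ, hΨ, rfl⟩ := hx
    exact S.integrable_mul_memLp g (S.memLp_test (S.isTest_mode k hΨ))
  | zero => simp
  | add x y _ _ hx hy =>
    simp only [Pi.add_apply, mul_add]
    exact hx.add hy
  | smul a x _ hx =>
    simp only [Pi.smul_apply, smul_eq_mul, mul_left_comm]
    exact hx.const_mul a

theorem integral_mul_modeSpan {g : S.Hilb}
    (h : ∀ k Ψ, S.IsAction Ψ → ∫ z, g z * S.mode k Ψ z ∂S.weightMeasure = 0)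
    {m : PlanarPhaseSpace → ℝ} (hm : m ∈ S.modeSpan) :
    ∫ z, g z * m z ∂S.weightMeasure = 0 := by
  induction hm using Submodule.span_induction with
  | mem x hx => obtain ⟨k, Ψ, hΨ, rfl⟩ := hx; exact h k Ψ hΨ
  | zero => simp
  | add x y hx' hy' hx hy =>
    simp only [Pi.add_apply, mul_add]
    rw [integral_add (integrable_mul_modeSpan g hx') (integrable_mul_modeSpan g hy'), hx, hy,
      add_zero]
  | smul a x _ hx =>
    simp only [Pi.smul_apply, smul_eq_mul, mul_left_comm]
    rw [integral_const_mul, hx, mul_zero]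

/-- The modes are total. -/
theorem eq_zero_of_integral_mode_eq_zero {g : S.Hilb}
    (h : ∀ k Ψ, S.IsAction Ψ → ∫ z, g z * S.mode k Ψ z ∂S.weightMeasure = 0) : g = 0 := by
  set U := S.actions ⁻¹' S.actionDomain
  have hU : IsOpen U := S.isOpen_actionDomain.preimage S.contDiff_actions.continuous
  have hUΩ : U ⊆ S.Ω₀ := fun z hz => (S.mem_Ω₀_iff z).2 ⟨hz.2.1, hz.2.2⟩
  have hloc : LocallyIntegrableOn g U S.weightMeasure := by
    rw [locallyIntegrableOn_iff hU.isLocallyClosed]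
    intro K hKU hK
    have : IsFiniteMeasure (S.weightMeasure.restrict K) :=
      ⟨by simpa using S.weightMeasure_lt_top hK (hKU.trans hUΩ)⟩
    exact ((Lp.memLp g).restrict K).integrable one_le_two
  have hae : ∀ᵐ z ∂S.weightMeasure, z ∈ U → g z = 0 := by
    refine hU.ae_eq_zero_of_integral_contDiff_smul_eq_zero hloc fun ξ h1 h2 h3 => ?_
    -- One has ξ = ξ κ(E, v̄) with κ an amplitude of order 0. Replacing ξ by a multiplier F that is
    -- ε-close on the support of κ changes the integral by at most ε ∫ |g κ|, and F κ lies in the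
    -- span of the modes, where the integral vanishes.
    obtain ⟨κ, k1, k2, k3, k4⟩ := exists_cutoff (h2.image S.contDiff_actions.continuous)
      S.isOpen_actionDomain (image_subset_iff.2 h3)
    have hκ : S.IsAction fun p => (κ p : ℂ) := by
      have hs : tsupport (fun p => (κ p : ℂ)) ⊆ tsupport κ :=
        closure_mono fun p hp h0 => hp (by simp only [h0, Complex.ofReal_zero])
      exact ⟨Complex.ofRealCLM.contDiff.comp k1, k2.of_isClosed_subset (isClosed_tsupport _) hs,
        hs.trans k3⟩
    have hκm : S.mode 0 (fun p => (κ p : ℂ)) = fun z => κ (S.actions z) := by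
      funext z; simp [mode]
    have hκM := mode_mem_modeSpan 0 hκ
    rw [hκm] at hκM
    have hint := integrable_mul_modeSpan g hκM
    have hL := S.isCompact_preimage_actions k2
    have hzero : ∀ z, z ∉ S.actions ⁻¹' tsupport κ → κ (S.actions z) = 0 := fun z hz =>
      image_eq_zero_of_notMem_tsupport hz
    have hξκ : ∀ z, ξ z * κ (S.actions z) = ξ z := by
      intro z
      by_cases hz : z ∈ tsupport ξ
      · rw [k4 _ (mem_image_of_mem _ hz), mul_one]
      · rw [image_eq_zero_of_notMem_tsupport hz, zero_mul]
    have hbound : ∀ ε > 0, |∫ z, ξ z • g z ∂S.weightMeasure| ≤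
        ε * ∫ z, |g z * κ (S.actions z)| ∂S.weightMeasure := by
      intro ε hε
      obtain ⟨F, hF, hFξ⟩ := exists_multiplier_near hL (fun z hz => (k3 hz).1)
        h1.continuous hε
      have hM := hF _ hκM
      have i1 := integrable_mul_modeSpan g hM
      have i2 := integral_mul_modeSpan h hM
      have i3 : Integrable (fun z => ξ z • g z) S.weightMeasure := by
        have := S.integrable_mul_memLp g (S.memLp_test
          ⟨h1.of_le (by exact_mod_cast le_top), h2, h3.trans hUΩ⟩)
        simpa only [smul_eq_mul, mul_comm] using this
      rw [← sub_zero (∫ z, ξ z • g z ∂S.weightMeasure), ← i2, ← integral_sub i3 i1,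
        ← integral_const_mul]
      refine (abs_integral_le_integral_abs).trans (integral_mono (i3.sub i1).abs
        (hint.abs.const_mul ε) fun z => ?_)
      simp only [Pi.mul_apply, smul_eq_mul]
      by_cases hz : z ∈ S.actions ⁻¹' tsupport κ
      · have e1 : ξ z * g z - g z * (F z * κ (S.actions z)) =
            -(F z - ξ z) * (g z * κ (S.actions z)) := by
          linear_combination (-g z) * hξκ z
        rw [e1, abs_mul, abs_neg]
        exact mul_le_mul_of_nonneg_right (hFξ z hz) (abs_nonneg _)
      · have e1 : ξ z = 0 := by rw [← hξκ z, hzero z hz, mul_zero]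
        rw [e1, hzero z hz]
        simp
    set I := ∫ z, |g z * κ (S.actions z)| ∂S.weightMeasure
    have hI : 0 ≤ I := integral_nonneg fun z => abs_nonneg _
    by_contra hne
    have hpos := abs_pos.2 hne
    have := hbound (|∫ z, ξ z • g z ∂S.weightMeasure| / (2 * (I + 1))) (by positivity)
    rw [div_mul_eq_mul_div, le_div_iff₀ (by positivity)] at this
    nlinarith
  -- Energy U₀(0) occurs only at v₁ = 0, so excluding it costs a null set.
  have hnull : ∀ᵐ z : PlanarPhaseSpace, z.2.1 ≠ 0 := by
    have hq : Measure.QuasiMeasurePreserving (fun z : PlanarPhaseSpace => z.2.1) volume volume :=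
      Measure.quasiMeasurePreserving_fst.comp Measure.quasiMeasurePreserving_snd
    exact hq.ae (Measure.ae_ne volume 0)
  rw [Lp.eq_zero_iff_ae_eq_zero]
  have hU' : ∀ᵐ z ∂S.weightMeasure, z ∈ U := by
    rw [S.ae_weightMeasure_iff]
    filter_upwards [hnull] with z hz hzΩ
    rw [S.mem_Ω₀_iff] at hzΩ
    refine ⟨(S.U₀_zero_le_energy z).lt_of_ne fun hE => hz ?_, hzΩ.1, hzΩ.2⟩
    have h0 := S.norm_coord_sq z
    rw [← hE, sub_self, mul_zero] at h0
    have h1 : S.coord z = 0 := by simpa using h0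
    have := congrArg Complex.re h1
    simpa [coord] using this
  filter_upwards [hae, hU'] with z h1 h2 using h1 h2

end PlanarSteadyState

namespace PlanarSteadyState

variable (S : PlanarSteadyState)

/-! Integrability of the weight `|φ'|`. -/

/-- `|α'|`, extended by zero above the cut-off energy. -/
def slope (E : ℝ) : ℝ := if E < S.E₀ then -deriv S.α E else 0

theorem slope_nonneg (E : ℝ) : 0 ≤ S.slope E := by
  rw [slope]
  split_ifs with h
  · linarith [S.deriv_α.2 E h]
  · exact le_rfl

theorem measurable_slope : Measurable S.slope :=
  Measurable.ite measurableSet_Iio (measurable_deriv _).neg measurable_const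

/-- The factorisation 1 - s²/2 = (√2 - s)(√2 + s)/2 separates the two end-point singularities, each
integrable for p > -1. -/
theorem integrable_one_sub_sq_rpow {p : ℝ} (hp : -1 < p) :
    Integrable fun s : ℝ => if s ^ 2 / 2 < 1 then (1 - s ^ 2 / 2) ^ p else 0 := by
  have h2 : (0 : ℝ) < √2 := by positivity
  have hsq : √2 ^ 2 = (2 : ℝ) := Real.sq_sqrt two_pos.le
  have hset : {s : ℝ | s ^ 2 / 2 < 1} = Ioo (-√2) √2 := by
    ext s
    rw [mem_ofPred_eq, mem_Ioo, ← abs_lt, Real.lt_sqrt (abs_nonneg _), sq_abs]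
    constructor <;> intro h <;> linarith
  have hm : MeasurableSet {s : ℝ | s ^ 2 / 2 < 1} := by rw [hset]; exact measurableSet_Ioo
  have hind : (fun s : ℝ => if s ^ 2 / 2 < 1 then (1 - s ^ 2 / 2) ^ p else 0) =
      {s : ℝ | s ^ 2 / 2 < 1}.indicator fun s => (1 - s ^ 2 / 2) ^ p := by
    funext s; rw [indicator_apply]; rfl
  rw [hind, integrable_indicator_iff hm, hset]
  have hfac : EqOn (fun s : ℝ => (√2 - s) ^ p * (√2 + s) ^ p * (1 / 2) ^ p)
      (fun s => (1 - s ^ 2 / 2) ^ p) (Ioo (-√2) √2) := by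
    intro s hs
    have h1 : 0 ≤ √2 - s := by linarith [hs.2]
    have h3 : 0 ≤ √2 + s := by linarith [hs.1]
    simp only
    rw [← Real.mul_rpow h1 h3, ← Real.mul_rpow (mul_nonneg h1 h3) (by norm_num)]
    congr 1
    linear_combination hsq / 2
  refine IntegrableOn.congr_fun (Integrable.mul_const ?_ _) hfac measurableSet_Ioo
  have hI : IntervalIntegrable (fun s : ℝ => (√2 - s) ^ p * (√2 + s) ^ p) volume (-√2) √2 := by
    have a1 : IntervalIntegrable (fun s : ℝ => (√2 - s) ^ p) volume 0 √2 := by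
      have := (intervalIntegral.intervalIntegrable_rpow' hp (a := √2) (b := 0)).comp_sub_left √2
      simpa using this
    have a2 : IntervalIntegrable (fun s : ℝ => (√2 + s) ^ p) volume (-√2) 0 := by
      have := (intervalIntegral.intervalIntegrable_rpow' hp (a := 0) (b := √2)).comp_add_left √2
      simpa using this
    refine IntervalIntegrable.trans (b := 0) ?_ ?_
    · refine a2.continuousOn_mul ?_
      rw [uIcc_of_le (by linarith)]
      exact ContinuousOn.rpow_const (by fun_prop) fun s hs => Or.inl (by linarith [hs.2])
    · refine a1.mul_continuousOn ?_
      rw [uIcc_of_le h2.le]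
      exact ContinuousOn.rpow_const (by fun_prop) fun s hs => Or.inl (by linarith [hs.1])
  exact (intervalIntegrable_iff_integrableOn_Ioo_of_le (by linarith)).1 hI

/-- The scaling v = √(E₀ - u) s produces a multiple of (E₀ - u)^(k - 1/2), bounded for u ≥ U₀(0)
because k > 1/2. -/
theorem slope_bound_of_polytrope {k : ℝ} (hk : 1 / 2 < k)
    (h : ∀ E, S.α E = if E < S.E₀ then (S.E₀ - E) ^ k else 0) :
    ∃ C, ∀ u, S.U₀ 0 ≤ u → Integrable (fun v : ℝ => S.slope (v ^ 2 / 2 + u)) ∧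
      ∫ v : ℝ, S.slope (v ^ 2 / 2 + u) ≤ C := by
  set σ : ℝ → ℝ := fun s => if s ^ 2 / 2 < 1 then (1 - s ^ 2 / 2) ^ (k - 1) else 0
  have hσ : Integrable σ := integrable_one_sub_sq_rpow (by linarith)
  have hσ0 : 0 ≤ ∫ s, σ s := integral_nonneg fun s => by
    simp only [σ, Pi.zero_apply]
    split_ifs with h1
    · exact Real.rpow_nonneg (by linarith) _
    · exact le_rfl
  have hslope : ∀ E, S.slope E = if E < S.E₀ then k * (S.E₀ - E) ^ (k - 1) else 0 := by
    intro E
    rw [slope]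
    refine if_ctx_congr Iff.rfl (fun hE => ?_) fun _ => rfl
    have h1 : S.α =ᶠ[𝓝 E] fun E => (S.E₀ - E) ^ k := by
      filter_upwards [Iio_mem_nhds hE] with y hy
      rw [h, if_pos (mem_Iio.1 hy)]
    rw [h1.deriv_eq, (((hasDerivAt_id' E).const_sub S.E₀).rpow_const
      (Or.inl (sub_pos.2 hE).ne')).deriv]
    simp
  refine ⟨k * (S.E₀ - S.U₀ 0) ^ (k - 1 / 2) * ∫ s, σ s, fun u hu => ?_⟩
  rcases le_or_gt S.E₀ u with hE | hE
  · have h0 : ∀ v : ℝ, S.slope (v ^ 2 / 2 + u) = 0 := fun v => by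
      rw [slope, if_neg (by nlinarith [sq_nonneg v])]
    simp only [h0, integral_zero]
    refine ⟨integrable_zero _ _ _, mul_nonneg (mul_nonneg (by linarith)
      (Real.rpow_nonneg ?_ _)) hσ0⟩
    linarith [S.U₀_zero_lt]
  · have hW : 0 < S.E₀ - u := by linarith
    have hsq : 0 < √(S.E₀ - u) := Real.sqrt_pos.2 hW
    have h2 : ∀ s, S.slope ((√(S.E₀ - u) * s) ^ 2 / 2 + u) =
        k * (S.E₀ - u) ^ (k - 1) * σ s := by
      intro s
      rw [hslope, mul_pow, Real.sq_sqrt hW.le]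
      simp only [σ]
      by_cases hs : s ^ 2 / 2 < 1
      · rw [if_pos hs, if_pos (by nlinarith), mul_assoc, ← Real.mul_rpow hW.le (by linarith)]
        congr 2
        ring
      · rw [if_neg hs, if_neg (by nlinarith), mul_zero]
    have hi : Integrable fun s => S.slope ((√(S.E₀ - u) * s) ^ 2 / 2 + u) := by
      simp only [h2]
      exact hσ.const_mul _
    have hi' : Integrable (fun v : ℝ => S.slope (v ^ 2 / 2 + u)) :=
      (integrable_comp_mul_left_iff (fun v => S.slope (v ^ 2 / 2 + u)) hsq.ne').1 hi
    refine ⟨hi', ?_⟩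
    have h1 := Measure.integral_comp_mul_left (fun v => S.slope (v ^ 2 / 2 + u)) (√(S.E₀ - u))
    simp only [h2] at h1
    rw [integral_const_mul, abs_of_pos (inv_pos.2 hsq), smul_eq_mul, inv_mul_eq_div,
      eq_div_iff hsq.ne'] at h1
    rw [← h1]
    have h3 : (S.E₀ - u) ^ (k - 1 / 2) = (S.E₀ - u) ^ (k - 1) * √(S.E₀ - u) := by
      rw [Real.sqrt_eq_rpow, ← Real.rpow_add hW]
      congr 1
      ring
    have h4 : (S.E₀ - u) ^ (k - 1 / 2) ≤ (S.E₀ - S.U₀ 0) ^ (k - 1 / 2) :=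
      Real.rpow_le_rpow hW.le (by linarith) (by linarith)
    calc k * (S.E₀ - u) ^ (k - 1) * (∫ s, σ s) * √(S.E₀ - u)
        = k * (S.E₀ - u) ^ (k - 1 / 2) * ∫ s, σ s := by rw [h3]; ring
      _ ≤ _ := mul_le_mul_of_nonneg_right (mul_le_mul_of_nonneg_left h4 (by linarith)) hσ0

/-- The exponential is largest at the energy U₀(0), and velocities below the cut-off stay in a fixed
interval. -/
theorem slope_bound_of_king (h : ∀ E, S.α E = max (Real.exp (S.E₀ - E) - 1) 0) :
    ∃ C, ∀ u, S.U₀ 0 ≤ u → Integrable (fun v : ℝ => S.slope (v ^ 2 / 2 + u)) ∧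
      ∫ v : ℝ, S.slope (v ^ 2 / 2 + u) ≤ C := by
  have hslope : ∀ E, S.slope E = if E < S.E₀ then Real.exp (S.E₀ - E) else 0 := by
    intro E
    rw [slope]
    refine if_ctx_congr Iff.rfl (fun hE => ?_) fun _ => rfl
    have h1 : S.α =ᶠ[𝓝 E] fun E => Real.exp (S.E₀ - E) - 1 := by
      filter_upwards [Iio_mem_nhds hE] with y hy
      rw [h, max_eq_left]
      have := Real.one_lt_exp_iff.2 (sub_pos.2 hy)
      linarith
    rw [h1.deriv_eq, ((((hasDerivAt_id' E).const_sub S.E₀).exp).sub_const 1).deriv]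
    simp
  set V := √(2 * (S.E₀ - S.U₀ 0))
  set B : ℝ → ℝ := (Icc (-V) V).indicator fun _ => Real.exp (S.E₀ - S.U₀ 0)
  have hB : Integrable B := (integrable_indicator_iff measurableSet_Icc).2 (by simp)
  have hle : ∀ u, S.U₀ 0 ≤ u → ∀ v : ℝ, S.slope (v ^ 2 / 2 + u) ≤ B v := by
    intro u hu v
    simp only [hslope, B]
    split_ifs with h1
    · rw [indicator_of_mem]
      · exact Real.exp_le_exp.2 (by nlinarith [sq_nonneg v])
      · exact abs_le.1 (Real.abs_le_sqrt (by linarith))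
    · exact indicator_nonneg (fun _ _ => (Real.exp_pos _).le) _
  refine ⟨∫ v, B v, fun u hu => ?_⟩
  have hi : Integrable (fun v : ℝ => S.slope (v ^ 2 / 2 + u)) := by
    refine hB.mono' (S.measurable_slope.comp (by fun_prop)).aestronglyMeasurable
      (Eventually.of_forall fun v => ?_)
    rw [Real.norm_of_nonneg (S.slope_nonneg _)]
    exact hle u hu v
  exact ⟨hi, integral_mono hi hB (hle u hu)⟩

theorem exists_slope_bound :
    ∃ C, ∀ u, S.U₀ 0 ≤ u → Integrable (fun v : ℝ => S.slope (v ^ 2 / 2 + u)) ∧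
      ∫ v : ℝ, S.slope (v ^ 2 / 2 + u) ≤ C := by
  rcases S.polytrope_or_king with ⟨k, hk, h⟩ | h
  · exact S.slope_bound_of_polytrope hk h
  · exact S.slope_bound_of_king h

theorem exists_bound_of_energy_lt :
    ∃ X, 0 < X ∧ ∀ z, S.energy z < S.E₀ → |z.1| ≤ X ∧ |z.2.1| ≤ X := by
  set a := √(2 * (S.E₀ - S.U₀ 0))
  obtain ⟨C, hC⟩ := (isCompact_Icc (a := -a) (b := a)).exists_bound_of_continuousOn
    S.contDiff_position.continuous.continuousOn
  refine ⟨max C a + 1, ?_, fun z hz => ?_⟩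
  · have : 0 ≤ a := Real.sqrt_nonneg _
    linarith [le_max_right C a]
  · have h2 : ‖S.coord z‖ ≤ a := by
      rw [S.norm_coord]
      exact Real.sqrt_le_sqrt (by linarith)
    have hre := (Complex.abs_re_le_norm (S.coord z)).trans h2
    have him := abs_le.1 ((Complex.abs_im_le_norm (S.coord z)).trans h2)
    have h3 : (S.coord z).im = S.radial z.1 := by simp [coord]
    have h4 : (S.coord z).re = z.2.1 := by simp [coord]
    rw [h3] at him
    rw [h4] at hre
    have h5 := hC _ him
    rw [S.position_radial, Real.norm_eq_abs] at h5
    exact ⟨by linarith [le_max_left C a], by linarith [le_max_right C a]⟩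

/-- `|φ'|` on phase space, extended by zero outside `Ω₀`. -/
def density (z : PlanarPhaseSpace) : ℝ := S.slope (S.energy z) * S.β z.2.2

theorem density_nonneg (z : PlanarPhaseSpace) : 0 ≤ S.density z :=
  mul_nonneg (S.slope_nonneg _) (S.β_nonneg _)

theorem measurable_density : Measurable S.density :=
  (S.measurable_slope.comp S.continuous_energy.measurable).mul
    (S.continuous_β.measurable.comp (by fun_prop))

theorem density_eq {z : PlanarPhaseSpace} (hz : z ∈ S.Ω₀) : S.density z = |S.dφ z| := by
  have hE := ((S.mem_Ω₀_iff z).1 hz).1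
  rw [density, slope, if_pos hE, dφ, abs_mul, abs_of_neg (S.deriv_α.2 _ hE),
    abs_of_nonneg (S.β_nonneg _)]

theorem density_eq_zero {z : PlanarPhaseSpace} (hz : z ∉ S.Ω₀) : S.density z = 0 := by
  rw [S.mem_Ω₀_iff, not_and_or, not_not] at hz
  rcases hz with h | h
  · rw [density, slope, if_neg h, zero_mul]
  · rw [density, h, mul_zero]

/-- β integrates to 1, so only the v₁-integral of |α'| is left. Uniformity in x is what lets 𝓑 act
in the weighted space. -/
theorem exists_fiber_bound : ∃ C, ∀ x, Integrable (fun v : ℝ × ℝ × ℝ => S.density (x, v)) ∧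
    ∫ v : ℝ × ℝ × ℝ, S.density (x, v) ≤ C := by
  obtain ⟨C, hC⟩ := S.exists_slope_bound
  refine ⟨C, fun x => ?_⟩
  have hu : S.U₀ 0 ≤ S.U₀ x := by simpa [energy] using S.U₀_zero_le_energy (x, 0, 0, 0)
  obtain ⟨h1, h2⟩ := hC _ hu
  have hβ : Integrable S.β :=
    S.continuous_β.integrable_of_hasCompactSupport S.hasCompactSupport_β
  constructor
  · exact h1.mul_prod hβ
  · rw [Measure.volume_eq_prod]
    have : ∫ v : ℝ × ℝ × ℝ, S.density (x, v) ∂(volume.prod volume) =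
        (∫ v : ℝ, S.slope (v ^ 2 / 2 + S.U₀ x)) * ∫ w, S.β w :=
      integral_prod_mul (fun v : ℝ => S.slope (v ^ 2 / 2 + S.U₀ x)) S.β
    rw [this, S.integral_β, mul_one]
    exact h2

theorem integrable_density : Integrable S.density := by
  obtain ⟨C, hC⟩ := S.exists_fiber_bound
  obtain ⟨X, -, hX⟩ := S.exists_bound_of_energy_lt
  have hm : AEStronglyMeasurable S.density (volume.prod volume) :=
    S.measurable_density.aestronglyMeasurable
  rw [Measure.volume_eq_prod, integrable_prod_iff hm]
  refine ⟨Eventually.of_forall fun x => (hC x).1, ?_⟩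
  have hC0 : Integrable ((Icc (-X) X).indicator fun _ : ℝ => C) :=
    (integrable_indicator_iff measurableSet_Icc).2 (by simp)
  refine hC0.mono' hm.norm.integral_prod_right' (Eventually.of_forall fun x => ?_)
  simp only [Real.norm_of_nonneg (S.density_nonneg _)]
  rw [Real.norm_of_nonneg (integral_nonneg fun v => S.density_nonneg _)]
  by_cases hx : x ∈ Icc (-X) X
  · rw [indicator_of_mem hx]
    exact (hC x).2
  · rw [indicator_of_notMem hx]
    refine le_of_eq (integral_eq_zero_of_ae (Eventually.of_forall fun v => ?_))
    refine S.density_eq_zero fun hz => hx ?_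
    exact abs_le.1 (hX _ ((S.mem_Ω₀_iff _).1 hz).1).1

/-- On Ω₀ the factor |φ'| cancels the weight, so pairings with functions of the form |φ'| c become
Lebesgue integrals. -/
theorem integral_weightMeasure_density_mul (F : PlanarPhaseSpace → ℝ) :
    ∫ z, S.density z * F z ∂S.weightMeasure = ∫ z, S.Ω₀.indicator F z := by
  rw [S.integral_weightMeasure, integral_indicator S.measurableSet_Ω₀]
  refine setIntegral_congr_fun S.measurableSet_Ω₀ fun z hz => ?_
  rw [S.density_eq hz, ← mul_assoc, one_div_mul_cancel (abs_ne_zero.2 (S.dφ_ne_zero hz)), one_mul]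

theorem integrable_weightMeasure_density_mul {F : PlanarPhaseSpace → ℝ} :
    Integrable (fun z => S.density z * F z) S.weightMeasure ↔ Integrable (S.Ω₀.indicator F) := by
  rw [S.integrable_weightMeasure_iff, integrable_indicator_iff S.measurableSet_Ω₀]
  refine integrableOn_congr_fun (fun z hz => ?_) S.measurableSet_Ω₀
  rw [S.density_eq hz, ← mul_assoc, one_div_mul_cancel (abs_ne_zero.2 (S.dφ_ne_zero hz)), one_mul]

theorem memLp_density_mul {c : PlanarPhaseSpace → ℝ} (hc : AEStronglyMeasurable c)
    (hi : Integrable fun z => S.density z * c z ^ 2) :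
    MemLp (fun z => S.density z * c z) 2 S.weightMeasure := by
  have hac : S.weightMeasure ≪ volume :=
    (withDensity_absolutelyContinuous _ _).trans Measure.restrict_le_self.absolutelyContinuous
  have hm : AEStronglyMeasurable (fun z => S.density z * c z) S.weightMeasure :=
    S.measurable_density.aestronglyMeasurable.mul (hc.mono_ac hac)
  rw [memLp_two_iff_integrable_sq hm]
  have h1 : ∀ z, (S.density z * c z) ^ 2 = S.density z * (S.density z * c z ^ 2) := fun z => by ring
  simp only [h1]
  rw [S.integrable_weightMeasure_density_mul]
  exact hi.indicator S.measurableSet_Ω₀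

theorem memLp_density_mul_of_bound {c : PlanarPhaseSpace → ℝ} (hc : Measurable c) {M : ℝ}
    (hM : ∀ z ∈ S.Ω₀, |c z| ≤ M) :
    MemLp (fun z => S.density z * c z) 2 S.weightMeasure := by
  refine S.memLp_density_mul hc.aestronglyMeasurable ((S.integrable_density.mul_const (M ^ 2)).mono'
    (S.measurable_density.mul (hc.pow_const 2)).aestronglyMeasurable
    (Eventually.of_forall fun z => ?_))
  rw [norm_mul, Real.norm_of_nonneg (S.density_nonneg z), Real.norm_of_nonneg (sq_nonneg _)]
  by_cases hz : z ∈ S.Ω₀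
  · refine mul_le_mul_of_nonneg_left ?_ (S.density_nonneg z)
    rw [← sq_abs]
    exact pow_le_pow_left₀ (abs_nonneg _) (hM z hz) 2
  · rw [S.density_eq_zero hz, zero_mul, zero_mul]

end PlanarSteadyState

namespace PlanarSteadyState

variable (S : PlanarSteadyState)

/-! The response operator is bounded, everywhere defined and symmetric. -/

theorem ae_mem_Ω₀ : ∀ᵐ z ∂S.weightMeasure, z ∈ S.Ω₀ :=
  S.ae_weightMeasure_iff.2 (Eventually.of_forall fun _ h => h)

variable {S}

theorem integrable_indicator_mul_of_memLp {c : PlanarPhaseSpace → ℝ}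
    (hc : MemLp (fun z => S.density z * c z) 2 S.weightMeasure) (g : S.Hilb) :
    Integrable (S.Ω₀.indicator fun z => c z * g z) := by
  rw [← S.integrable_weightMeasure_density_mul]
  refine (hc.integrable_mul (Lp.memLp g)).congr (Eventually.of_forall fun z => ?_)
  simp only [Pi.mul_apply]
  ring

theorem integral_mul_of_ae_eq_density_mul {c : PlanarPhaseSpace → ℝ} {f : S.Hilb}
    (hf : f =ᵐ[S.weightMeasure] fun z => S.density z * c z) (g : S.Hilb) :
    ⟪f, g⟫_ℝ = ∫ z, S.Ω₀.indicator (fun z => c z * g z) z := by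
  rw [S.inner_eq_integral, ← S.integral_weightMeasure_density_mul]
  refine integral_congr_ae ?_
  filter_upwards [hf] with z hz
  rw [hz]
  ring

variable (S)

theorem memLp_density_velocity :
    MemLp (fun z => S.density z * z.2.1) 2 S.weightMeasure := by
  obtain ⟨X, -, hX⟩ := S.exists_bound_of_energy_lt
  exact S.memLp_density_mul_of_bound (by fun_prop) fun z hz =>
    (hX z ((S.mem_Ω₀_iff z).1 hz).1).2

theorem currentIntegrand_eq (g : PlanarPhaseSpace → ℝ) (x : ℝ) (v : ℝ × ℝ × ℝ) :
    S.currentIntegrand g x v = S.Ω₀.indicator (fun z => z.2.1 * g z) (x, v) := by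
  rw [currentIntegrand]
  by_cases hz : (x, v) ∈ S.Ω₀
  · rw [indicator_of_mem hz, indicator_of_mem hz]
  · rw [indicator_of_notMem hz, indicator_of_notMem hz, mul_zero]

theorem integrable_currentIntegrand_prod (g : S.Hilb) :
    Integrable (fun z : ℝ × ℝ × ℝ × ℝ => S.currentIntegrand g z.1 z.2)
      ((volume : Measure ℝ).prod volume) := by
  simp only [currentIntegrand_eq, Prod.mk.eta]
  exact integrable_indicator_mul_of_memLp S.memLp_density_velocity g

theorem ae_integrable_currentIntegrand (g : S.Hilb) :
    ∀ᵐ x : ℝ, Integrable (S.currentIntegrand g x) :=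
  (S.integrable_currentIntegrand_prod g).prod_right_ae

theorem integrable_current (g : S.Hilb) : Integrable (S.current g) :=
  (S.integrable_currentIntegrand_prod g).integral_prod_left

/-- Optimising in t, that is t = |j| / K, turns the family of Young inequalities into the
Cauchy–Schwarz inequality. -/
theorem sq_le_of_forall_le {j K G : ℝ} (hK : 0 < K)
    (h : ∀ t > 0, 2 * |j| ≤ t * K + t⁻¹ * G) : j ^ 2 ≤ K * G := by
  rcases eq_or_ne j 0 with rfl | hj
  · have := h (1 : ℝ) one_pos
    have h2 : ∀ t > 0, 0 ≤ t * K + t⁻¹ * G := fun t ht => by simpa using h t ht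
    by_contra hcon
    have hG : G < 0 := by
      by_contra hG
      exact hcon (by simpa using mul_nonneg hK.le (not_lt.1 hG))
    -- For j = 0 only the sign of G is at stake: with t² K = -G / 2, a negative G would give t² K +
    -- G = G / 2 < 0.
    have ht : 0 < √(-G / (2 * K)) := Real.sqrt_pos.2 (div_pos (by linarith) (by linarith))
    have h3 := mul_nonneg ht.le (h2 _ ht)
    rw [mul_add, ← mul_assoc, ← mul_assoc, mul_inv_cancel₀ ht.ne', ← pow_two,
      Real.sq_sqrt (div_nonneg (by linarith) (by linarith)), one_mul] at h3
    have h4 : -G / (2 * K) * K = -G / 2 := by field_simp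
    linarith
  · have hj' := abs_pos.2 hj
    have h1 := h (|j| / K) (div_pos hj' hK)
    rw [div_mul_cancel₀ _ hK.ne', inv_div] at h1
    have h2 : |j| ≤ K / |j| * G := by linarith
    rw [div_mul_eq_mul_div, le_div_iff₀ hj', ← pow_two, sq_abs] at h2
    exact h2

theorem exists_velocity_fiber_bound : ∃ K > 0, ∀ x,
    Integrable (fun v : ℝ × ℝ × ℝ => S.density (x, v) * v.1 ^ 2) ∧
      ∫ v : ℝ × ℝ × ℝ, S.density (x, v) * v.1 ^ 2 ≤ K := by
  obtain ⟨C, hC⟩ := S.exists_fiber_bound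
  obtain ⟨X, hX0, hX⟩ := S.exists_bound_of_energy_lt
  refine ⟨max (C * X ^ 2) 1, lt_max_of_lt_right one_pos, fun x => ?_⟩
  have hle : ∀ v : ℝ × ℝ × ℝ, S.density (x, v) * v.1 ^ 2 ≤ S.density (x, v) * X ^ 2 := fun v => by
    by_cases hz : (x, v) ∈ S.Ω₀
    · refine mul_le_mul_of_nonneg_left ?_ (S.density_nonneg _)
      rw [← sq_abs]
      exact pow_le_pow_left₀ (abs_nonneg _) (hX _ ((S.mem_Ω₀_iff _).1 hz).1).2 2
    · rw [S.density_eq_zero hz, zero_mul, zero_mul]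
  have hi : Integrable (fun v : ℝ × ℝ × ℝ => S.density (x, v) * v.1 ^ 2) := by
    refine ((hC x).1.mul_const (X ^ 2)).mono' ?_ (Eventually.of_forall fun v => ?_)
    · exact ((S.measurable_density.comp measurable_prodMk_left).mul
        (measurable_fst.pow_const 2)).aestronglyMeasurable
    · rw [Real.norm_of_nonneg (mul_nonneg (S.density_nonneg _) (sq_nonneg _))]
      exact hle v
  refine ⟨hi, le_max_of_le_left ?_⟩
  refine (integral_mono hi ((hC x).1.mul_const _) hle).trans ?_
  rw [integral_mul_const]
  exact mul_le_mul_of_nonneg_right (hC x).2 (sq_nonneg _)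

/-- Cauchy–Schwarz on each fibre: 𝓙(g)(x)² ≤ ∫ |φ'| v₁² dv · ∫ g² / |φ'| dv. The first factor is
bounded in x, the second integrable. -/
theorem integrable_current_sq (g : S.Hilb) : Integrable fun x => S.current g x ^ 2 := by
  obtain ⟨K, hK0, hK⟩ := S.exists_velocity_fiber_bound
  set q : PlanarPhaseSpace → ℝ := S.Ω₀.indicator fun z => 1 / |S.dφ z| * g z ^ 2
  have hq : Integrable q ((volume : Measure ℝ).prod volume) := by
    have h1 := (Lp.memLp g).integrable_sq
    rw [S.integrable_weightMeasure_iff, ← integrable_indicator_iff S.measurableSet_Ω₀] at h1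
    exact h1
  refine (hq.integral_prod_left.const_mul K).mono'
    ((S.integrable_current g).aestronglyMeasurable.pow 2) ?_
  filter_upwards [S.ae_integrable_currentIntegrand g, hq.prod_right_ae] with x h1 h2
  rw [Real.norm_of_nonneg (sq_nonneg _)]
  refine sq_le_of_forall_le hK0 fun t ht => ?_
  have hpt : ∀ v, 2 * |S.currentIntegrand g x v| ≤
      t * (S.density (x, v) * v.1 ^ 2) + t⁻¹ * q (x, v) := by
    intro v
    rw [S.currentIntegrand_eq]
    by_cases hz : (x, v) ∈ S.Ω₀
    · have hd := abs_pos.2 (S.dφ_ne_zero hz)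
      rw [indicator_of_mem hz, S.density_eq hz]
      simp only [q, indicator_of_mem hz]
      set d := |S.dφ (x, v)|
      -- Young's inequality as a complete square.
      have h3 : t * (d * v.1 ^ 2) + t⁻¹ * (1 / d * g (x, v) ^ 2) - 2 * |v.1 * g (x, v)| =
          (t * d)⁻¹ * (t * d * |v.1| - |g (x, v)|) ^ 2 := by
        rw [abs_mul, ← sq_abs v.1, ← sq_abs (g (x, v))]
        field_simp
        ring
      have h4 : 0 ≤ (t * d)⁻¹ * (t * d * |v.1| - |g (x, v)|) ^ 2 := by positivity
      linarith
    · rw [indicator_of_notMem hz, S.density_eq_zero hz]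
      simp [q, indicator_of_notMem hz]
  calc 2 * |S.current g x| ≤ ∫ v, 2 * |S.currentIntegrand g x v| := by
        rw [integral_const_mul]
        exact mul_le_mul_of_nonneg_left abs_integral_le_integral_abs two_pos.le
    _ ≤ ∫ v, (t * (S.density (x, v) * v.1 ^ 2) + t⁻¹ * q (x, v)) :=
        integral_mono (h1.abs.const_mul 2) (((hK x).1.const_mul t).add (h2.const_mul _)) hpt
    _ = t * (∫ v : ℝ × ℝ × ℝ, S.density (x, v) * v.1 ^ 2) + t⁻¹ * ∫ v, q (x, v) := by
        rw [integral_add ((hK x).1.const_mul t) (h2.const_mul _), integral_const_mul,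
          integral_const_mul]
    _ ≤ t * K + t⁻¹ * ∫ v, q (x, v) := by
        have := mul_le_mul_of_nonneg_left (hK x).2 ht.le
        linarith

/-- The squared weighted norm of 𝓑 g is (4π)² ∫ 𝓙(g)(x)² ∫ |φ'| v₁² dv dx, where the inner integral
is bounded in x. -/
theorem memLp_response (g : S.Hilb) :
    MemLp (fun z => S.density z * (4 * Real.pi * z.2.1 * S.current g z.1)) 2 S.weightMeasure := by
  have hJ : AEStronglyMeasurable (fun z : PlanarPhaseSpace => S.current g z.1) :=
    (S.integrable_current g).aestronglyMeasurable.comp_quasiMeasurePreserving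
      Measure.quasiMeasurePreserving_fst
  have hv : AEStronglyMeasurable (fun z : PlanarPhaseSpace => 4 * Real.pi * z.2.1) :=
    (by fun_prop : Continuous fun z : PlanarPhaseSpace => 4 * Real.pi * z.2.1).aestronglyMeasurable
  refine S.memLp_density_mul (hv.mul hJ) ?_
  obtain ⟨K, hK0, hK⟩ := S.exists_velocity_fiber_bound
  have h1 : ∀ z : PlanarPhaseSpace, S.density z * (4 * Real.pi * z.2.1 * S.current g z.1) ^ 2 =
      (4 * Real.pi) ^ 2 * (S.density z * z.2.1 ^ 2 * S.current g z.1 ^ 2) := fun z => by ring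
  simp only [h1]
  refine Integrable.const_mul ?_ _
  have hm : AEStronglyMeasurable
      (fun z : PlanarPhaseSpace => S.density z * z.2.1 ^ 2 * S.current g z.1 ^ 2)
      ((volume : Measure ℝ).prod volume) :=
    (S.measurable_density.mul (by fun_prop :
      Measurable fun z : PlanarPhaseSpace => z.2.1 ^ 2)).aestronglyMeasurable.mul (hJ.pow 2)
  rw [Measure.volume_eq_prod, integrable_prod_iff hm]
  refine ⟨Eventually.of_forall fun x => (hK x).1.mul_const (S.current g x ^ 2), ?_⟩
  refine ((S.integrable_current_sq g).const_mul K).mono' hm.norm.integral_prod_right'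
    (Eventually.of_forall fun x => ?_)
  have h2 : ∀ v : ℝ × ℝ × ℝ, ‖S.density (x, v) * v.1 ^ 2 * S.current g x ^ 2‖ =
      S.density (x, v) * v.1 ^ 2 * S.current g x ^ 2 := fun v =>
    Real.norm_of_nonneg (mul_nonneg (mul_nonneg (S.density_nonneg _) (sq_nonneg _)) (sq_nonneg _))
  simp only [h2]
  rw [integral_mul_const, Real.norm_of_nonneg (mul_nonneg (integral_nonneg fun v =>
    mul_nonneg (S.density_nonneg _) (sq_nonneg _)) (sq_nonneg _))]
  exact mul_le_mul_of_nonneg_right (hK x).2 (sq_nonneg _)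

theorem mem_responseGraph {g h : S.Hilb} (hh : h =ᵐ[S.weightMeasure]
    fun z => S.density z * (4 * Real.pi * z.2.1 * S.current g z.1)) : (g, h) ∈ S.responseGraph := by
  refine ⟨S.ae_integrable_currentIntegrand g, ?_⟩
  filter_upwards [hh, S.ae_mem_Ω₀] with z h1 h2
  rw [h1, S.density_eq h2]
  ring

theorem response_domain : S.response.domain = ⊤ := by
  refine eq_top_iff.2 fun g _ => ?_
  have h := S.mem_responseGraph (S.memLp_response g).coeFn_toLp
  rw [← S.response_graph, LinearPMap.mem_graph_iff] at h
  obtain ⟨y, hy, -⟩ := h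
  have h1 : (y : S.Hilb) = g := hy
  rw [← h1]
  exact y.2

theorem mem_response_domain (g : S.Hilb) : g ∈ S.response.domain := by
  rw [S.response_domain]
  exact Submodule.mem_top

theorem response_ae (g : S.Hilb) : S.response ⟨g, S.mem_response_domain g⟩ =ᵐ[S.weightMeasure]
    fun z => S.density z * (4 * Real.pi * z.2.1 * S.current g z.1) := by
  have h := S.response.mem_graph ⟨g, S.mem_response_domain g⟩
  rw [S.response_graph] at h
  filter_upwards [h.2, S.ae_mem_Ω₀] with z h1 h2
  rw [S.density_eq h2]
  refine h1.trans ?_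
  ring

/-- The factor |φ'| in 𝓑 cancels the weight, and Fubini leaves the product of the two currents, an
expression symmetric in g and h. -/
theorem inner_response (g h : S.Hilb) : ⟪S.response ⟨g, S.mem_response_domain g⟩, h⟫_ℝ =
    4 * Real.pi * ∫ x, S.current g x * S.current h x := by
  rw [integral_mul_of_ae_eq_density_mul (S.response_ae g) h]
  have hi := integrable_indicator_mul_of_memLp (S.memLp_response g) h
  rw [Measure.volume_eq_prod] at hi ⊢
  rw [integral_prod _ hi, ← integral_const_mul]
  refine integral_congr_ae (Eventually.of_forall fun x => ?_)
  have h1 : ∀ v : ℝ × ℝ × ℝ,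
      S.Ω₀.indicator (fun z => 4 * Real.pi * z.2.1 * S.current g z.1 * h z) (x, v) =
        4 * Real.pi * S.current g x * S.currentIntegrand h x v := by
    intro v
    rw [S.currentIntegrand_eq]
    by_cases hz : (x, v) ∈ S.Ω₀
    · rw [indicator_of_mem hz, indicator_of_mem hz]
      ring
    · rw [indicator_of_notMem hz, indicator_of_notMem hz, mul_zero]
  simp only [h1]
  rw [integral_const_mul, mul_assoc]
  rfl

/-- The response operator as a linear map on the whole space. -/
def responseLin : S.Hilb →ₗ[ℝ] S.Hilb where
  toFun g := S.response ⟨g, S.mem_response_domain g⟩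
  map_add' g h := S.response.map_add ⟨g, S.mem_response_domain g⟩ ⟨h, S.mem_response_domain h⟩
  map_smul' c g := S.response.map_smul c ⟨g, S.mem_response_domain g⟩

/-- By the Hellinger–Toeplitz theorem an everywhere defined symmetric operator is bounded; this is
how `responseCLM` becomes continuous. -/
theorem isSymmetric_responseLin : S.responseLin.IsSymmetric := by
  intro g h
  rw [real_inner_comm]
  have h1 := S.inner_response g h
  have h2 := S.inner_response h g
  rw [real_inner_comm]
  refine h1.trans ?_
  rw [real_inner_comm]
  refine Eq.trans ?_ h2.symm
  simp only [mul_comm]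

/-- The response operator as a bounded operator. -/
def responseCLM : S.Hilb →L[ℝ] S.Hilb := ⟨S.responseLin, S.isSymmetric_responseLin.continuous⟩

theorem responseCLM_apply (g : S.Hilb) :
    S.responseCLM g = S.response ⟨g, S.mem_response_domain g⟩ := rfl

theorem inner_responseCLM_comm (g h : S.Hilb) : ⟪S.responseCLM g, h⟫_ℝ = ⟪g, S.responseCLM h⟫_ℝ :=
  S.isSymmetric_responseLin g h

end PlanarSteadyState

namespace PlanarSteadyState

variable (S : PlanarSteadyState)

/-! The response operator factors as `4π 𝓓 N` with a compact operator `N`. -/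

/-- The velocity, cut off to the left of `x`. -/
def leftVelocity (x : ℝ) (z : PlanarPhaseSpace) : ℝ := if z.1 < x then z.2.1 else 0

theorem measurable_leftVelocity (x : ℝ) : Measurable (leftVelocity x) :=
  Measurable.ite (measurableSet_lt measurable_fst measurable_const) (by fun_prop) measurable_const

theorem abs_leftVelocity_le (x : ℝ) (z : PlanarPhaseSpace) : |leftVelocity x z| ≤ |z.2.1| := by
  rw [leftVelocity]
  split_ifs <;> simp

theorem memLp_density_leftVelocity (x : ℝ) :
    MemLp (fun z => S.density z * leftVelocity x z) 2 S.weightMeasure := by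
  obtain ⟨X, -, hX⟩ := S.exists_bound_of_energy_lt
  exact S.memLp_density_mul_of_bound (measurable_leftVelocity x) fun z hz =>
    (abs_leftVelocity_le x z).trans (hX z ((S.mem_Ω₀_iff z).1 hz).1).2

/-- The kernel representing the integrated current `g ↦ ∫_{y < x} 𝓙(g)(y) dy`. -/
def halfKernel (x : ℝ) : S.Hilb := (S.memLp_density_leftVelocity x).toLp

theorem halfKernel_ae (x : ℝ) :
    S.halfKernel x =ᵐ[S.weightMeasure] fun z => S.density z * leftVelocity x z :=
  MemLp.coeFn_toLp _

theorem integrable_density_mul_velocity_sq :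
    Integrable fun z : PlanarPhaseSpace => S.density z * z.2.1 ^ 2 := by
  obtain ⟨X, -, hX⟩ := S.exists_bound_of_energy_lt
  refine (S.integrable_density.mul_const (X ^ 2)).mono' (S.measurable_density.mul (by fun_prop :
    Measurable fun z : PlanarPhaseSpace => z.2.1 ^ 2)).aestronglyMeasurable
    (Eventually.of_forall fun z => ?_)
  rw [Real.norm_of_nonneg (mul_nonneg (S.density_nonneg z) (sq_nonneg _))]
  by_cases hz : z ∈ S.Ω₀
  · refine mul_le_mul_of_nonneg_left ?_ (S.density_nonneg z)
    rw [← sq_abs]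
    exact pow_le_pow_left₀ (abs_nonneg _) (hX z ((S.mem_Ω₀_iff z).1 hz).1).2 2
  · rw [S.density_eq_zero hz, zero_mul, zero_mul]

/-- The squared distance of the kernels at y and x is the integral of |φ'| v₁² over the strip
between them, which shrinks to a null set as y → x. -/
theorem continuous_halfKernel : Continuous S.halfKernel := by
  rw [continuous_iff_continuousAt]
  intro x
  rw [ContinuousAt, tendsto_iff_norm_sub_tendsto_zero]
  have hnorm : ∀ y, ‖S.halfKernel y - S.halfKernel x‖ ^ 2 =
      ∫ z, S.density z * (leftVelocity y z - leftVelocity x z) ^ 2 := by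
    intro y
    have h1 : (S.halfKernel y - S.halfKernel x : S.Hilb) =ᵐ[S.weightMeasure]
        fun z => S.density z * (leftVelocity y z - leftVelocity x z) := by
      filter_upwards [Lp.coeFn_sub (S.halfKernel y) (S.halfKernel x), S.halfKernel_ae y,
        S.halfKernel_ae x] with z h1 h2 h3
      rw [h1, Pi.sub_apply, h2, h3, mul_sub]
    rw [← real_inner_self_eq_norm_sq, S.inner_eq_integral]
    have h2 : ∫ z, (S.halfKernel y - S.halfKernel x : S.Hilb) z *
        (S.halfKernel y - S.halfKernel x : S.Hilb) z ∂S.weightMeasure =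
        ∫ z, S.density z * (S.density z * (leftVelocity y z - leftVelocity x z) ^ 2)
          ∂S.weightMeasure := by
      refine integral_congr_ae ?_
      filter_upwards [h1] with z hz
      rw [hz]
      ring
    rw [h2, S.integral_weightMeasure_density_mul]
    refine integral_congr_ae (Eventually.of_forall fun z => ?_)
    by_cases hz : z ∈ S.Ω₀
    · exact indicator_of_mem hz _
    · simp only [indicator_of_notMem hz, S.density_eq_zero hz, zero_mul]
  have hlim : Tendsto (fun y => ∫ z, S.density z * (leftVelocity y z - leftVelocity x z) ^ 2)
      (𝓝 x) (𝓝 (∫ _ : PlanarPhaseSpace, (0 : ℝ))) := by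
    refine tendsto_integral_filter_of_dominated_convergence
      (fun z : PlanarPhaseSpace => S.density z * z.2.1 ^ 2) (Eventually.of_forall fun y => ?_)
      (Eventually.of_forall fun y => Eventually.of_forall fun z => ?_)
      S.integrable_density_mul_velocity_sq ?_
    · exact (S.measurable_density.mul (((measurable_leftVelocity y).sub
        (measurable_leftVelocity x)).pow_const 2)).aestronglyMeasurable
    · rw [Real.norm_of_nonneg (mul_nonneg (S.density_nonneg z) (sq_nonneg _))]
      refine mul_le_mul_of_nonneg_left ?_ (S.density_nonneg z)
      rw [leftVelocity, leftVelocity]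
      split_ifs
      · simpa using sq_nonneg z.2.1
      · simp
      · simp
      · simpa using sq_nonneg z.2.1
    · have hne : ∀ᵐ z : PlanarPhaseSpace, z.1 ≠ x :=
        Measure.quasiMeasurePreserving_fst.ae (Measure.ae_ne volume x)
      filter_upwards [hne] with z hz
      refine tendsto_const_nhds.congr' ?_
      rcases hz.lt_or_gt with h | h
      · filter_upwards [Ioi_mem_nhds h] with y hy
        rw [leftVelocity, leftVelocity, if_pos h, if_pos (mem_Ioi.1 hy)]
        simp
      · filter_upwards [Iio_mem_nhds h] with y hy
        rw [leftVelocity, leftVelocity, if_neg (not_lt.2 h.le), if_neg (not_lt.2 (le_of_lt hy))]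
        simp
  simp only [← hnorm, integral_zero] at hlim
  have := (Real.continuous_sqrt.tendsto 0).comp hlim
  rw [Real.sqrt_zero] at this
  exact this.congr fun y => Real.sqrt_sq (norm_nonneg _)

/-- There is a compact operator with `(N g)(x, v) = |φ'| ∫_{y < x} 𝓙(g)(y) dy`. -/
theorem exists_integratedResponse : ∃ N : S.Hilb →L[ℝ] S.Hilb, IsCompactOperator N ∧
    ∀ g, N g =ᵐ[S.weightMeasure] fun z => S.density z * ⟪S.halfKernel z.1, g⟫_ℝ := by
  obtain ⟨X, hX0, hX⟩ := S.exists_bound_of_energy_lt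
  have hXX : -X ≤ X := by linarith
  -- N is the pairing with the kernels into C([-X, X]), compact by Arzelà–Ascoli, followed by
  -- multiplication by |φ'|. Since Ω₀ lies above [-X, X], the extension by `projIcc` has no
  -- influence.
  obtain ⟨L, hL, hLc⟩ := exists_isCompactOperator_inner
    (S.continuous_halfKernel.comp (continuous_subtype_val (p := (· ∈ Icc (-X) X))))
  have hmeas : ∀ c : BoundedContinuousFunction (Icc (-X) X) ℝ,
      Measurable fun z : PlanarPhaseSpace => c (projIcc (-X) X hXX z.1) := fun c =>
    (c.continuous.comp (continuous_projIcc.comp continuous_fst)).measurable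
  have hmem : ∀ c : BoundedContinuousFunction (Icc (-X) X) ℝ,
      MemLp (fun z => S.density z * c (projIcc (-X) X hXX z.1)) 2 S.weightMeasure := fun c =>
    S.memLp_density_mul_of_bound (hmeas c) fun z _ => c.norm_coe_le_norm _
  have hone : MemLp (fun z => S.density z * 1) 2 S.weightMeasure :=
    S.memLp_density_mul_of_bound measurable_const fun _ _ => le_refl |(1 : ℝ)|
  let V : BoundedContinuousFunction (Icc (-X) X) ℝ →L[ℝ] S.Hilb := LinearMap.mkContinuous
    { toFun := fun c => (hmem c).toLp
      map_add' := fun c d => by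
        refine Lp.ext ?_
        filter_upwards [(hmem (c + d)).coeFn_toLp, (hmem c).coeFn_toLp, (hmem d).coeFn_toLp,
          Lp.coeFn_add (hmem c).toLp (hmem d).toLp] with z h1 h2 h3 h4
        rw [h1, h4, Pi.add_apply, h2, h3, ← mul_add]
        rfl
      map_smul' := fun r c => by
        refine Lp.ext ?_
        filter_upwards [(hmem (r • c)).coeFn_toLp, (hmem c).coeFn_toLp,
          Lp.coeFn_smul r (hmem c).toLp] with z h1 h2 h4
        rw [h1, RingHom.id_apply, h4, Pi.smul_apply, h2, smul_eq_mul, mul_left_comm]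
        rfl } ‖hone.toLp‖ fun c => by
      rw [mul_comm]
      refine Lp.norm_le_mul_norm_of_ae_le_mul ?_
      filter_upwards [(hmem c).coeFn_toLp, hone.coeFn_toLp] with z h1 h2
      change ‖((hmem c).toLp : S.Hilb) z‖ ≤ _
      rw [h1, h2, mul_one, norm_mul, mul_comm]
      exact mul_le_mul_of_nonneg_right (c.norm_coe_le_norm _) (norm_nonneg _)
  refine ⟨V.comp L, hLc.clm_comp V, fun g => ?_⟩
  have hV : V (L g) =ᵐ[S.weightMeasure] fun z => S.density z * L g (projIcc (-X) X hXX z.1) :=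
    (hmem (L g)).coeFn_toLp
  filter_upwards [hV, S.ae_mem_Ω₀] with z h1 h2
  have h3 : z.1 ∈ Icc (-X) X := abs_le.1 (hX z ((S.mem_Ω₀_iff z).1 h2).1).1
  refine h1.trans ?_
  rw [hL, projIcc_of_mem hXX h3]
  rfl

/-- The v₁-derivative integrates to zero, its coefficient being independent of v₁; the x-derivative
over (y, ∞) leaves the boundary value at y. -/
theorem integral_right_transport_test {ξ : PlanarPhaseSpace → ℝ} (hξ : S.IsTest ξ) (y : ℝ) :
    ∫ z, (if y < z.1 then S.classicalTransport ξ z else 0) = -∫ v : ℝ × ℝ × ℝ, v.1 * ξ (y, v) := by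
  obtain ⟨h1, h2, -⟩ := hξ
  have hfd : ∀ d, Continuous fun z => fderiv ℝ ξ z d := fun d =>
    (h1.continuous_fderiv one_ne_zero).clm_apply continuous_const
  have hfs : ∀ d, ∀ z ∉ tsupport ξ, fderiv ℝ ξ z d = 0 := fun d z hz => by
    have : fderiv ℝ ξ z = 0 :=
      image_eq_zero_of_notMem_tsupport fun h => hz (tsupport_fderiv_subset ℝ h)
    rw [this]; rfl
  have hH : MeasurableSet {z : PlanarPhaseSpace | y < z.1} :=
    measurableSet_lt measurable_const measurable_fst
  have hU := S.contDiff_deriv_U₀.continuous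
  have i1 : Integrable fun z : PlanarPhaseSpace =>
      if y < z.1 then z.2.1 * fderiv ℝ ξ z (1, 0, 0, 0) else 0 := by
    refine Integrable.indicator (s := {z : PlanarPhaseSpace | y < z.1})
      (integrable_of_continuousOn_of_compact h2 ?_ fun z hz => ?_) hH
    · exact ((by fun_prop : Continuous fun z : PlanarPhaseSpace => z.2.1).mul (hfd _)).continuousOn
    · rw [hfs _ z hz, mul_zero]
  have i2 : Integrable fun z : PlanarPhaseSpace =>
      if y < z.1 then deriv S.U₀ z.1 * fderiv ℝ ξ z (0, 1, 0, 0) else 0 := by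
    refine Integrable.indicator (s := {z : PlanarPhaseSpace | y < z.1})
      (integrable_of_continuousOn_of_compact h2 ?_ fun z hz => ?_) hH
    · exact ((hU.comp continuous_fst).mul (hfd _)).continuousOn
    · rw [hfs _ z hz, mul_zero]
  have i3 : Integrable fun z : PlanarPhaseSpace =>
      if y < z.1 then deriv S.U₀ z.1 * ξ z else 0 := by
    refine Integrable.indicator (s := {z : PlanarPhaseSpace | y < z.1})
      (integrable_of_continuousOn_of_compact h2 ?_ fun z hz => ?_) hH
    · exact ((hU.comp continuous_fst).mul h1.continuous).continuousOn
    · rw [image_eq_zero_of_notMem_tsupport hz, mul_zero]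
  have e2 : ∫ z : PlanarPhaseSpace,
      (if y < z.1 then deriv S.U₀ z.1 * fderiv ℝ ξ z (0, 1, 0, 0) else 0) = 0 := by
    have hcomm : ∀ (z : PlanarPhaseSpace) (r : ℝ), r * (if y < z.1 then deriv S.U₀ z.1 else 0) =
        if y < z.1 then deriv S.U₀ z.1 * r else 0 := fun z r => by
      split_ifs <;> ring
    have key := integral_bilinear_hasLineDerivAt_right_eq_neg_left_of_integrable
      (μ := (volume : Measure PlanarPhaseSpace)) (f := ξ)
      (f' := fun z => fderiv ℝ ξ z (0, 1, 0, 0))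
      (g := fun z => if y < z.1 then deriv S.U₀ z.1 else 0)
      (g' := fun _ => 0) (v := (0, 1, 0, 0)) (B := ContinuousLinearMap.mul ℝ ℝ)
      (by simpa only [ContinuousLinearMap.mul_apply', hcomm] using i2)
      (by simp)
      (by simpa only [ContinuousLinearMap.mul_apply', hcomm] using i3)
      (fun z _ => (h1.differentiable one_ne_zero z).hasFDerivAt.hasLineDerivAt _)
      fun z _ => ?_
    · simp only [ContinuousLinearMap.mul_apply', hcomm, mul_zero, integral_zero] at key
      linarith
    · unfold HasLineDerivAt
      refine (hasDerivAt_const (0 : ℝ)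
        (if y < z.1 then deriv S.U₀ z.1 else 0)).congr_of_eventuallyEq
        (Eventually.of_forall fun t => ?_)
      simp
  have hsplit : ∀ z : PlanarPhaseSpace, (if y < z.1 then S.classicalTransport ξ z else 0) =
      (if y < z.1 then z.2.1 * fderiv ℝ ξ z (1, 0, 0, 0) else 0) -
        if y < z.1 then deriv S.U₀ z.1 * fderiv ℝ ξ z (0, 1, 0, 0) else 0 := fun z => by
    split_ifs
    · rfl
    · ring
  simp only [hsplit]
  rw [integral_sub i1 i2, e2, sub_zero]
  rw [Measure.volume_eq_prod] at i1 ⊢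
  rw [integral_prod_symm _ i1, ← integral_neg]
  refine integral_congr_ae (Eventually.of_forall fun v => ?_)
  dsimp only
  have hslice : ContDiff ℝ 1 fun x : ℝ => ξ (x, v) := h1.comp (by fun_prop)
  have hsupp : HasCompactSupport fun x : ℝ => ξ (x, v) := by
    refine HasCompactSupport.of_support_subset_isCompact (h2.image continuous_fst) fun x hx => ?_
    exact ⟨(x, v), subset_tsupport _ hx, rfl⟩
  have hder : ∀ x : ℝ, fderiv ℝ ξ (x, v) (1, 0, 0, 0) = deriv (fun x : ℝ => ξ (x, v)) x := by
    intro x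
    have h3 : HasFDerivAt ξ (fderiv ℝ ξ (x, v)) (x, v) :=
      (h1.differentiable one_ne_zero (x, v)).hasFDerivAt
    have h4 : HasDerivAt (fun x : ℝ => ((x, v) : ℝ × ℝ × ℝ × ℝ)) (1, 0) x :=
      (hasDerivAt_id x).prodMk (hasDerivAt_const x v)
    exact (h3.comp_hasDerivAt x h4).deriv.symm
  have h5 : ∀ x : ℝ, (if y < x then v.1 * fderiv ℝ ξ (x, v) (1, 0, 0, 0) else 0) =
      (Ioi y).indicator (fun x => v.1 * deriv (fun x : ℝ => ξ (x, v)) x) x := fun x => by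
    rw [hder, indicator_apply]
    rfl
  simp only [h5]
  rw [integral_indicator measurableSet_Ioi, integral_const_mul,
    hsupp.integral_Ioi_deriv_eq hslice]
  ring

theorem inner_halfKernel (g : S.Hilb) (x : ℝ) : ⟪S.halfKernel x, g⟫_ℝ =
    ∫ w : PlanarPhaseSpace, if w.1 < x then S.currentIntegrand g w.1 w.2 else 0 := by
  rw [integral_mul_of_ae_eq_density_mul (S.halfKernel_ae x)]
  refine integral_congr_ae (Eventually.of_forall fun w => ?_)
  dsimp only
  rw [S.currentIntegrand_eq, Prod.mk.eta]
  by_cases hw : w ∈ S.Ω₀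
  · rw [indicator_of_mem hw, indicator_of_mem hw, leftVelocity]
    split_ifs <;> ring
  · rw [indicator_of_notMem hw, indicator_of_notMem hw, ite_self]

/-- `𝓑 = 4π 𝓓 N`. -/
theorem response_mem_transportGraph {g n : S.Hilb} (hn : n =ᵐ[S.weightMeasure]
    fun z => S.density z * ⟪S.halfKernel z.1, g⟫_ℝ) :
    ((4 * Real.pi) • n, S.responseCLM g) ∈ S.transportGraph := by
  intro ξ hξ
  change ∫ z, ((4 * Real.pi) • n : S.Hilb) z * S.classicalTransport ξ z ∂S.weightMeasure =
    -∫ z, S.responseCLM g z * ξ z ∂S.weightMeasure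
  set q : PlanarPhaseSpace → ℝ := fun w => S.currentIntegrand g w.1 w.2
  set P : ℝ → ℝ := fun y => ∫ v : ℝ × ℝ × ℝ, v.1 * ξ (y, v)
  have hq : Integrable q := S.integrable_currentIntegrand_prod g
  have hDi : Integrable (S.classicalTransport ξ) := by
    have hU := S.contDiff_deriv_U₀.continuous
    have hfd : ∀ d, Continuous fun z => fderiv ℝ ξ z d := fun d =>
      (hξ.1.continuous_fderiv one_ne_zero).clm_apply continuous_const
    refine integrable_of_continuousOn_of_compact hξ.2.1 ?_ fun z hz =>
      S.transport_eq_zero_of_notMem hz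
    exact (((by fun_prop : Continuous fun z : PlanarPhaseSpace => z.2.1).mul (hfd _)).sub
      ((hU.comp continuous_fst).mul (hfd _))).continuousOn
  -- Fubini on pairs with w to the left of z: integrating in w first produces the integrated current
  -- of g paired with 𝓓ξ, integrating in z first produces the current of ξ at the position of w.
  set F : PlanarPhaseSpace × PlanarPhaseSpace → ℝ := fun p =>
    if p.2.1 < p.1.1 then S.classicalTransport ξ p.1 * q p.2 else 0
  have hF : Integrable F ((volume : Measure PlanarPhaseSpace).prod volume) :=
    (hDi.mul_prod hq).indicator (s := {p : PlanarPhaseSpace × PlanarPhaseSpace | p.2.1 < p.1.1})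
      (measurableSet_lt (by fun_prop) (by fun_prop))
  have hF1 : ∀ z, ∫ w, F (z, w) = S.classicalTransport ξ z * ⟪S.halfKernel z.1, g⟫_ℝ := by
    intro z
    rw [S.inner_halfKernel, ← integral_const_mul]
    refine integral_congr_ae (Eventually.of_forall fun w => ?_)
    simp only [F, q]
    split_ifs <;> ring
  have hF2 : ∀ w, ∫ z, F (z, w) = -(q w * P w.1) := by
    intro w
    rw [← mul_neg, ← S.integral_right_transport_test hξ, ← integral_const_mul]
    refine integral_congr_ae (Eventually.of_forall fun z => ?_)
    simp only [F]
    split_ifs <;> ring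
  have hqP : Integrable fun w => q w * P w.1 := by
    have := hF.integral_prod_right
    simp only [hF2] at this
    simpa using this.neg
  have hl : ∫ z, ((4 * Real.pi) • n : S.Hilb) z * S.classicalTransport ξ z ∂S.weightMeasure =
      4 * Real.pi * ∫ z, S.classicalTransport ξ z * ⟪S.halfKernel z.1, g⟫_ℝ := by
    have h1 : ∫ z, ((4 * Real.pi) • n : S.Hilb) z * S.classicalTransport ξ z ∂S.weightMeasure =
        ∫ z, S.density z * (4 * Real.pi * (S.classicalTransport ξ z * ⟪S.halfKernel z.1, g⟫_ℝ))
          ∂S.weightMeasure := by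
      refine integral_congr_ae ?_
      filter_upwards [hn, Lp.coeFn_smul (4 * Real.pi) n] with z h1 h2
      rw [h2, Pi.smul_apply, h1, smul_eq_mul]
      ring
    rw [h1, S.integral_weightMeasure_density_mul, ← integral_const_mul]
    refine integral_congr_ae (Eventually.of_forall fun z => ?_)
    by_cases hz : z ∈ S.Ω₀
    · exact indicator_of_mem hz _
    · simp only [indicator_of_notMem hz,
        S.transport_eq_zero_of_notMem fun h => hz (hξ.2.2 h), zero_mul, mul_zero]
  have hr : ∫ z, S.responseCLM g z * ξ z ∂S.weightMeasure =
      4 * Real.pi * ∫ x, S.current g x * P x := by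
    have hB := S.response_ae g
    rw [← responseCLM_apply] at hB
    have h1 : ∫ z, S.responseCLM g z * ξ z ∂S.weightMeasure =
        ∫ z, S.density z * (4 * Real.pi * (z.2.1 * S.current g z.1 * ξ z)) ∂S.weightMeasure := by
      refine integral_congr_ae ?_
      filter_upwards [hB] with z h1
      rw [h1]
      ring
    have hi : Integrable (S.Ω₀.indicator fun z =>
        4 * Real.pi * (z.2.1 * S.current g z.1 * ξ z)) := by
      rw [← S.integrable_weightMeasure_density_mul]
      refine ((S.memLp_response g).integrable_mul (S.memLp_test hξ)).congr
        (Eventually.of_forall fun z => ?_)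
      simp only [Pi.mul_apply]
      ring
    rw [h1, S.integral_weightMeasure_density_mul]
    rw [Measure.volume_eq_prod] at hi ⊢
    rw [integral_prod _ hi, ← integral_const_mul]
    refine integral_congr_ae (Eventually.of_forall fun x => ?_)
    simp only [P]
    rw [← mul_assoc, ← integral_const_mul]
    refine integral_congr_ae (Eventually.of_forall fun v => ?_)
    dsimp only
    by_cases hz : (x, v) ∈ S.Ω₀
    · rw [indicator_of_mem hz]
      ring
    · rw [indicator_of_notMem hz, image_eq_zero_of_notMem_tsupport fun h => hz (hξ.2.2 h)]
      ring
  have hsw : ∫ z, S.classicalTransport ξ z * ⟪S.halfKernel z.1, g⟫_ℝ = -∫ w, q w * P w.1 := by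
    have h1 : ∫ z, ∫ w, F (z, w) = ∫ w, ∫ z, F (z, w) :=
      integral_integral_swap (f := fun z w => F (z, w)) hF
    simp only [hF1, hF2] at h1
    rw [h1, integral_neg]
  have hfin : ∫ w, q w * P w.1 = ∫ x, S.current g x * P x := by
    rw [Measure.volume_eq_prod] at hqP ⊢
    rw [integral_prod _ hqP]
    refine integral_congr_ae (Eventually.of_forall fun x => ?_)
    simp only [q]
    rw [integral_mul_const]
    rfl
  rw [hl, hr, hsw, hfin]
  ring

end PlanarSteadyState

namespace PlanarSteadyState

variable (S : PlanarSteadyState)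

/-! Resolvents of `-𝓓²` on subspaces spanned by modes. -/

/-- The values `(2πk / T(E))²` of the squared frequencies of the admitted modes. -/
def bandSet (P : ℕ → Submodule ℝ ℂ) : Set ℝ :=
  {lam | ∃ k : ℕ, P k ≠ ⊥ ∧ ∃ E ∈ Icc (S.U₀ 0) S.E₀, lam = k ^ 2 * S.freqSq E}

/-- The band of order k lies above k² min freqSq, so only finitely many bands come near lam, and
each is the continuous image of a compact interval. -/
theorem exists_gap {P : ℕ → Submodule ℝ ℂ} {lam : ℝ} (hlam : lam ∉ S.bandSet P) :
    ∃ d > 0, ∀ k, P k ≠ ⊥ → ∀ E ∈ Icc (S.U₀ 0) S.E₀, d ≤ |k ^ 2 * S.freqSq E - lam| := by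
  have hne : (Icc (S.U₀ 0) S.E₀).Nonempty := nonempty_Icc.2 S.U₀_zero_lt.le
  obtain ⟨E₁, -, hmin⟩ := isCompact_Icc.exists_isMinOn hne S.continuous_freqSq.continuousOn
  have hm : ∀ E ∈ Icc (S.U₀ 0) S.E₀, S.freqSq E₁ ≤ S.freqSq E := fun E hE => hmin hE
  have hm0 := S.freqSq_pos E₁
  have hone : ∀ k : ℕ, P k ≠ ⊥ → ∃ d > 0, ∀ E ∈ Icc (S.U₀ 0) S.E₀,
      d ≤ |k ^ 2 * S.freqSq E - lam| := by
    intro k hk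
    have hc : Continuous fun E => |(k : ℝ) ^ 2 * S.freqSq E - lam| :=
      ((continuous_const.mul S.continuous_freqSq).sub continuous_const).abs
    obtain ⟨E₂, hE₂, hmin₂⟩ := isCompact_Icc.exists_isMinOn hne hc.continuousOn
    exact ⟨|(k : ℝ) ^ 2 * S.freqSq E₂ - lam|, abs_pos.2 fun h =>
      hlam ⟨k, hk, E₂, hE₂, (sub_eq_zero.1 h).symm⟩, fun E hE => hmin₂ hE⟩
  have hfin : ∀ n : ℕ, ∃ d > 0, ∀ k < n, P k ≠ ⊥ → ∀ E ∈ Icc (S.U₀ 0) S.E₀,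
      d ≤ |(k : ℝ) ^ 2 * S.freqSq E - lam| := by
    intro n
    induction n with
    | zero => exact ⟨1, one_pos, fun k hk => absurd hk (Nat.not_lt_zero k)⟩
    | succ n ih =>
      obtain ⟨d, hd, h⟩ := ih
      by_cases hn : P n = ⊥
      · refine ⟨d, hd, fun k hk hPk => h k ?_ hPk⟩
        refine lt_of_le_of_ne (Nat.lt_succ_iff.1 hk) ?_
        rintro rfl
        exact hPk hn
      · obtain ⟨d', hd', h'⟩ := hone n hn
        refine ⟨min d d', lt_min hd hd', fun k hk hPk E hE => ?_⟩
        rcases (Nat.lt_succ_iff.1 hk).lt_or_eq with hlt | rfl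
        · exact (min_le_left _ _).trans (h k hlt hPk E hE)
        · exact (min_le_right _ _).trans (h' E hE)
  -- For orders k > n every value k² freqSq(E) is at least lam + 1.
  obtain ⟨n, hn⟩ := exists_nat_ge ((lam + 1) / S.freqSq E₁)
  rw [div_le_iff₀ hm0] at hn
  obtain ⟨d, hd, h⟩ := hfin (n + 1)
  refine ⟨min d 1, lt_min hd one_pos, fun k hk E hE => ?_⟩
  rcases lt_or_ge k (n + 1) with hkn | hkn
  · exact (min_le_left _ _).trans (h k hkn hk E hE)
  · refine (min_le_right _ _).trans (le_trans ?_ (le_abs_self _))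
    have h1 : (n : ℝ) + 1 ≤ k := by exact_mod_cast hkn
    have h2 : (n : ℝ) ≤ (k : ℝ) ^ 2 := by nlinarith [Nat.cast_nonneg (α := ℝ) n]
    have h3 : (n : ℝ) * S.freqSq E₁ ≤ (k : ℝ) ^ 2 * S.freqSq E :=
      mul_le_mul h2 (hm E hE) hm0.le (sq_nonneg _)
    linarith

theorem isClosed_bandSet (P : ℕ → Submodule ℝ ℂ) : IsClosed (S.bandSet P) := by
  rw [← isOpen_compl_iff, Metric.isOpen_iff]
  intro lam hlam
  obtain ⟨d, hd, h⟩ := S.exists_gap hlam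
  refine ⟨d, hd, fun mu hmu hmem => ?_⟩
  obtain ⟨k, hk, E, hE, rfl⟩ := hmem
  rw [Metric.mem_ball, Real.dist_eq] at hmu
  exact absurd hmu (not_lt.2 (h k hk E hE))

theorem neg_one_notMem_bandSet (P : ℕ → Submodule ℝ ℂ) : (-1 : ℝ) ∉ S.bandSet P := by
  rintro ⟨k, -, E, -, h⟩
  have := mul_nonneg (sq_nonneg (k : ℝ)) (S.freqSq_pos E).le
  linarith

variable {S}

theorem toLp_mode_mem_core {P : ℕ → Submodule ℝ ℂ} {k : ℕ} {Ψ : ℝ × ℝ × ℝ → ℂ}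
    (hΨ : S.IsAction Ψ) (hP : ∀ p, Ψ p ∈ P k) :
    (S.memLp_test (S.isTest_mode k hΨ)).toLp ∈ S.core P := by
  refine ⟨k + 1, fun j => if j = k then Ψ else 0, fun j => ?_, ?_⟩
  · by_cases hj : j = k
    · subst hj
      simp only [if_true]
      exact ⟨hΨ, hP⟩
    · simp only [hj, if_false]
      exact ⟨IsAction.zero S, fun _ => (P j).zero_mem⟩
  · filter_upwards [(S.memLp_test (S.isTest_mode k hΨ)).coeFn_toLp] with z hz
    rw [hz, modeSum, Finset.sum_eq_single k]
    · rw [if_pos rfl]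
    · intro j _ hj
      rw [if_neg hj]
      simp [mode]
    · exact fun h => absurd (Finset.mem_range.2 (Nat.lt_succ_self k)) h

/-- `T` is the part of `-𝓓²` in the subspace spanned by the modes with amplitudes in `P`. -/
structure IsModePart {K : Type*} [NormedAddCommGroup K] [InnerProductSpace ℝ K]
    (ι : K →ₗᵢ[ℝ] S.Hilb) (P : ℕ → Submodule ℝ ℂ) (T : K →ₗ.[ℝ] K) : Prop where
  mem_domain_iff : ∀ g, g ∈ T.domain ↔ ι g ∈ (-S.transportSq).domain
  map_apply : ∀ (g : T.domain) (h : ι g ∈ (-S.transportSq).domain),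
    ι (T g) = (-S.transportSq) ⟨ι g, h⟩
  core_le : S.core P ≤ LinearMap.range ι.toLinearMap
  total : ∀ g : K, (∀ k Ψ, S.IsAction Ψ → (∀ p, Ψ p ∈ P k) →
    ∫ z, ι g z * S.mode k Ψ z ∂S.weightMeasure = 0) → g = 0
  amplitude : ∀ k, P k ≠ ⊥ → ∃ c ∈ P k, c ≠ 0 ∧ (k = 0 → c.re ≠ 0)

namespace IsModePart

variable {K : Type*} [NormedAddCommGroup K] [InnerProductSpace ℝ K]
  {ι : K →ₗᵢ[ℝ] S.Hilb} {P : ℕ → Submodule ℝ ℂ} {T : K →ₗ.[ℝ] K}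

theorem map_apply' (hT : S.IsModePart ι P T) (g : T.domain) :
    ∃ h : ι g ∈ (-S.transportSq).domain, (-S.transportSq) ⟨ι g, h⟩ = ι (T g) := by
  have h := (hT.mem_domain_iff g).1 g.2
  exact ⟨h, (hT.map_apply g h).symm⟩

theorem exists_of_map (hT : S.IsModePart ι P T) {g f : K}
    {hg : ι g ∈ (-S.transportSq).domain} (h : (-S.transportSq) ⟨ι g, hg⟩ = ι f) :
    ∃ hg' : g ∈ T.domain, T ⟨g, hg'⟩ = f := by
  have hg' := (hT.mem_domain_iff g).2 hg
  exact ⟨hg', ι.injective ((hT.map_apply ⟨g, hg'⟩ hg).trans h)⟩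

/-- Totality says precisely that the core has trivial orthogonal complement in `K`. -/
theorem exists_core_near [CompleteSpace K] (hT : S.IsModePart ι P T) (f : K) {ε : ℝ} (hε : 0 < ε) :
    ∃ w : K, ι w ∈ S.core P ∧ ‖w - f‖ < ε := by
  set W : Submodule ℝ K := (S.core P).comap ι.toLinearMap
  have hW : Wᗮ = ⊥ := by
    refine (Submodule.eq_bot_iff _).2 fun g hg => hT.total g fun k Ψ hΨ hP => ?_
    obtain ⟨w, hw⟩ := hT.core_le (toLp_mode_mem_core hΨ hP)
    have hw' : ι w = (S.memLp_test (S.isTest_mode k hΨ)).toLp := hw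
    have h1 : ⟪w, g⟫_ℝ = 0 := hg w (by
      change ι w ∈ S.core P
      rw [hw']
      exact toLp_mode_mem_core hΨ hP)
    rw [real_inner_comm, ← ι.inner_map_map, S.inner_eq_integral] at h1
    rw [← h1]
    refine integral_congr_ae ?_
    filter_upwards [(S.memLp_test (S.isTest_mode k hΨ)).coeFn_toLp] with z hz
    rw [hw', hz]
  have htop := Submodule.topologicalClosure_eq_top_iff.2 hW
  have hf : f ∈ closure (W : Set K) := by
    rw [← Submodule.topologicalClosure_coe, htop]
    trivial
  obtain ⟨w, hw, hd⟩ := Metric.mem_closure_iff.1 hf ε hε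
  exact ⟨w, hw, by rwa [← dist_eq_norm, dist_comm]⟩

theorem exists_testTriple (hT : S.IsModePart ι P T) {w : T.domain} (hw : ι w ∈ S.core P) :
    ∃ d, S.IsTestTriple (ι w) d (-ι (T w)) := by
  obtain ⟨d, e, h⟩ := exists_testTriple_of_core hw
  obtain ⟨h1, h2⟩ := h.exists_transportSq
  refine ⟨d, ?_⟩
  rw [hT.map_apply w h1, h2, neg_neg]
  exact h

/-- On the core -𝓓² - lam is bounded below by the gap and maps onto the core, which is dense.
Symmetry against the core is the definition of the weak derivative, and closedness along core
sequences comes from interpolation. The approximation statement says that the modes are a core of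
the weakly defined operator. -/
theorem exists_isResolventAt [CompleteSpace K] (hT : S.IsModePart ι P T) {lam : ℝ}
    (hlam : lam ∉ S.bandSet P) : ∃ R : K →L[ℝ] K, T.IsResolventAt lam R ∧
      ∀ g : T.domain, ∃ w : ℕ → T.domain, (∀ n, ι (w n) ∈ S.core P) ∧
        Tendsto (fun n => (w n : K)) atTop (𝓝 g) ∧
        Tendsto (fun n => T (w n)) atTop (𝓝 (T g)) := by
  obtain ⟨d, hd, hgap⟩ := S.exists_gap hlam
  refine LinearPMap.exists_isResolventAt_of_core (W := (S.core P).comap ι.toLinearMap) hd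
    (fun w u h hw hu hh => ?_) (fun g w hw => ?_) (fun f ε hε => ?_) fun w hw => ?_
  · choose e he using fun n => hT.exists_testTriple (hw n)
    have hh' : Tendsto (fun n => -ι (T (w n))) atTop (𝓝 (-ι h)) :=
      ((ι.continuous.tendsto h).comp hh).neg
    obtain ⟨k, -, h1, h2⟩ := exists_tendsto_of_testTriple he
      ((ι.continuous.tendsto u).comp hu) hh'
    obtain ⟨h3, h4⟩ := S.transportSq_of_graph h1 h2
    rw [neg_neg] at h4
    exact hT.exists_of_map h4
  · obtain ⟨e, he⟩ := hT.exists_testTriple hw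
    obtain ⟨hg, hg'⟩ := hT.map_apply' g
    have h1 := inner_transportSq_of_testTriple he ⟨ι g, hg⟩
    rw [hg', neg_neg, ι.inner_map_map, ι.inner_map_map] at h1
    exact h1
  · obtain ⟨f', hf', hd'⟩ := hT.exists_core_near f hε
    obtain ⟨v, hv, hv'⟩ := core_surjective (lam := lam)
      (fun k hk E hE h => hlam ⟨k, hk, E, hE, h.symm⟩) hf'
    obtain ⟨v0, hv0⟩ := hT.core_le hv
    have hv0' : ι v0 = v := hv0
    have hdom : ι v0 ∈ (-S.transportSq).domain := hv0' ▸ v.2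
    have hv2 : (-S.transportSq) ⟨ι v0, hdom⟩ = ι (f' + lam • v0) := by
      have h2 : (⟨ι v0, hdom⟩ : (-S.transportSq).domain) = v := Subtype.ext hv0'
      rw [h2, map_add, map_smul, hv0', ← hv']
      abel
    obtain ⟨h3, h4⟩ := hT.exists_of_map hv2
    refine ⟨⟨v0, h3⟩, ?_, ?_⟩
    · change ι v0 ∈ S.core P
      rw [hv0']
      exact hv
    · rw [h4]
      simpa using hd'
  · obtain ⟨hw1, hw2⟩ := hT.map_apply' w
    have h1 := core_bound hd hgap ⟨ι w, hw1⟩ hw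
    rw [hw2] at h1
    have h2 : ι (T w) - lam • ι (w : K) = ι (T w - lam • (w : K)) := by
      rw [map_sub, map_smul]
    rw [h2, ι.norm_map, ι.norm_map] at h1
    exact h1

/-- Against elements of the core this is integration by parts, and the core reaches the whole domain
in the graph norm. The point -1 serves because the bands are nonnegative. -/
theorem isSymmetric [CompleteSpace K] (hT : S.IsModePart ι P T) (g h : T.domain) :
    ⟪T g, h⟫_ℝ = ⟪(g : K), T h⟫_ℝ := by
  obtain ⟨-, -, hcore⟩ := hT.exists_isResolventAt (S.neg_one_notMem_bandSet P)
  obtain ⟨w, hw, hw1, hw2⟩ := hcore h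
  have key : ∀ n, ⟪T g, w n⟫_ℝ = ⟪(g : K), T (w n)⟫_ℝ := fun n => by
    obtain ⟨e, he⟩ := hT.exists_testTriple (hw n)
    obtain ⟨hg, hg'⟩ := hT.map_apply' g
    have h1 := inner_transportSq_of_testTriple he ⟨ι g, hg⟩
    rw [hg', neg_neg, ι.inner_map_map, ι.inner_map_map] at h1
    exact h1
  have l1 : Tendsto (fun n => ⟪T g, (w n : K)⟫_ℝ) atTop (𝓝 ⟪T g, (h : K)⟫_ℝ) :=
    tendsto_const_nhds.inner hw1
  have l2 : Tendsto (fun n => ⟪(g : K), T (w n)⟫_ℝ) atTop (𝓝 ⟪(g : K), T h⟫_ℝ) :=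
    tendsto_const_nhds.inner hw2
  simp only [key] at l1
  exact tendsto_nhds_unique l1 l2

end IsModePart

variable (S)

theorem isModePart_top : S.IsModePart LinearIsometry.id (fun _ => ⊤) (-S.transportSq) where
  mem_domain_iff _ := Iff.rfl
  map_apply _ _ := rfl
  core_le := fun g _ => ⟨g, rfl⟩
  total g hg := eq_zero_of_integral_mode_eq_zero fun k Ψ hΨ => hg k Ψ hΨ fun _ => trivial
  amplitude _ _ := ⟨1, trivial, one_ne_zero, fun _ => by simp⟩

/-- Elements of the domain of `𝓓²` are limits of smooth functions in the graph norm. -/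
theorem exists_tendsto_testTriple {g h k : S.Hilb} (h1 : (g, h) ∈ S.transportGraph)
    (h2 : (h, k) ∈ S.transportGraph) : ∃ w d e : ℕ → S.Hilb,
      (∀ n, S.IsTestTriple (w n) (d n) (e n)) ∧ Tendsto w atTop (𝓝 g) ∧ Tendsto d atTop (𝓝 h) ∧
        Tendsto e atTop (𝓝 k) := by
  obtain ⟨hg, hgk⟩ := S.transportSq_of_graph h1 h2
  obtain ⟨-, -, hcore⟩ := S.isModePart_top.exists_isResolventAt (S.neg_one_notMem_bandSet _)
  obtain ⟨w, hw, hw1, hw2⟩ := hcore ⟨g, hg⟩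
  choose d hd using fun n => S.isModePart_top.exists_testTriple (hw n)
  rw [hgk] at hw2
  have hw3 : Tendsto (fun n => -(-S.transportSq) (w n)) atTop (𝓝 k) := by
    simpa only [neg_neg] using hw2.neg
  obtain ⟨h', hd', h3, -⟩ := exists_tendsto_of_testTriple hd hw1 hw3
  have := S.transportGraph_eq h3 h1
  subst this
  exact ⟨_, d, _, hd, hw1, hd', hw3⟩

theorem norm_sq_le_of_transportGraph {g h k : S.Hilb} (h1 : (g, h) ∈ S.transportGraph)
    (h2 : (h, k) ∈ S.transportGraph) : ‖h‖ ^ 2 ≤ ‖k‖ * ‖g‖ := by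
  obtain ⟨w, d, e, H, hw, hd, he⟩ := S.exists_tendsto_testTriple h1 h2
  exact le_of_tendsto_of_tendsto' (hd.norm.pow 2) (he.norm.mul hw.norm) fun n => (H n).norm_sq_le

/-- The transport operator is antisymmetric. -/
theorem inner_transport_eq_neg {g h k n m : S.Hilb} (h1 : (g, h) ∈ S.transportGraph)
    (h2 : (h, k) ∈ S.transportGraph) (hn : (n, m) ∈ S.transportGraph) :
    ⟪m, g⟫_ℝ = -⟪n, h⟫_ℝ := by
  obtain ⟨w, d, e, H, hw, hd, -⟩ := S.exists_tendsto_testTriple h1 h2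
  have key : ∀ j, ⟪m, w j⟫_ℝ = -⟪n, d j⟫_ℝ := fun j => by rw [(H j).inner_fst hn, neg_neg]
  have l1 : Tendsto (fun j => ⟪m, w j⟫_ℝ) atTop (𝓝 ⟪m, g⟫_ℝ) := tendsto_const_nhds.inner hw
  have l2 : Tendsto (fun j => -⟪n, d j⟫_ℝ) atTop (𝓝 (-⟪n, h⟫_ℝ)) :=
    (tendsto_const_nhds.inner hd).neg
  simp only [key] at l1
  exact tendsto_nhds_unique l1 l2

/-- The response operator is compact on the domain of `𝓓²` with the graph norm. -/
theorem isCompactOperator_response_comp {E : Type*} [NormedAddCommGroup E] [NormedSpace ℝ E]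
    (R : E →L[ℝ] S.Hilb) (hR : ∀ f, R f ∈ (-S.transportSq).domain) {C : ℝ}
    (hC : ∀ f, ‖(-S.transportSq) ⟨R f, hR f⟩‖ ≤ C * ‖f‖) :
    IsCompactOperator (S.responseCLM.comp R) := by
  choose d hd1 hd2 using fun f => S.graph_of_transportSq ⟨R f, hR f⟩
  -- Interpolation between R f and 𝓓² R f: the map f ↦ 𝓓 R f is bounded.
  have hCR : ∀ f, ‖d f‖ ≤ √(|C| * ‖R‖) * ‖f‖ := by
    intro f
    have h1 := S.norm_sq_le_of_transportGraph (hd1 f) (hd2 f)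
    rw [norm_neg] at h1
    have h2 : ‖d f‖ ^ 2 ≤ (|C| * ‖R‖) * ‖f‖ ^ 2 := by
      refine h1.trans ((mul_le_mul ((hC f).trans (mul_le_mul_of_nonneg_right (le_abs_self C)
        (norm_nonneg _))) (R.le_opNorm f) (norm_nonneg _) (by positivity)).trans (le_of_eq ?_))
      ring
    rw [← Real.sqrt_sq (norm_nonneg f), ← Real.sqrt_mul (by positivity)]
    exact Real.le_sqrt_of_sq_le h2
  let D : E →L[ℝ] S.Hilb := LinearMap.mkContinuous
    { toFun := d
      map_add' := fun f g => S.transportGraph_eq (hd1 (f + g)) (by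
        change (R (f + g), d f + d g) ∈ S.transportGraph
        rw [map_add]
        exact S.transportGraph.add_mem (hd1 f) (hd1 g))
      map_smul' := fun c f => S.transportGraph_eq (hd1 (c • f)) (by
        change (R (c • f), c • d f) ∈ S.transportGraph
        rw [map_smul]
        exact S.transportGraph.smul_mem c (hd1 f)) } _ hCR
  obtain ⟨N, hN, hNae⟩ := S.exists_integratedResponse
  -- ⟪h, 𝓑 R f⟫ = ⟪4π 𝓓 N h, R f⟫ = -4π ⟪N h, 𝓓 R f⟫, hence 𝓑 R = -4π N* 𝓓 R, and N* is compact with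
  -- N.
  have heq : S.responseCLM.comp R =
      (-(4 * Real.pi)) • (ContinuousLinearMap.adjoint N).comp D := by
    ext1 f
    refine ext_inner_left ℝ fun h => ?_
    have h1 := S.inner_transport_eq_neg (hd1 f) (hd2 f) (S.response_mem_transportGraph (hNae h))
    have h2 : D f = d f := rfl
    rw [ContinuousLinearMap.comp_apply, ← S.inner_responseCLM_comm, smul_apply,
      ContinuousLinearMap.comp_apply, inner_smul_right, ContinuousLinearMap.adjoint_inner_right, h2]
    refine h1.trans ?_
    rw [inner_smul_left]
    simp
  rw [heq]
  exact (hN.adjoint.comp_clm D).smul (-(4 * Real.pi))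

end PlanarSteadyState

namespace PlanarSteadyState

variable (S : PlanarSteadyState)

/-! Modes without response, and the essential spectrum. -/

/-- A bump function times y₁ - m, where m is the mean of y₁ weighted by the bump. -/
theorem exists_integral_eq_zero_of_isOpen {U : Set (ℝ × ℝ)} (hU : IsOpen U) (hne : U.Nonempty) :
    ∃ ψ : ℝ × ℝ → ℝ, ContDiff ℝ 1 ψ ∧ HasCompactSupport ψ ∧ tsupport ψ ⊆ U ∧ ∫ w, ψ w = 0 ∧
      ∃ w, ψ w ≠ 0 := by
  obtain ⟨w, hw⟩ := hne
  obtain ⟨φ, h1, h2, h3, h4, h5⟩ := exists_contDiff_tsupport_subset (n := 1) (hU.mem_nhds hw)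
  have hφ0 : ∀ y, 0 ≤ φ y := fun y => (h4 (mem_range_self y)).1
  have hφi : Integrable φ := h3.continuous.integrable_of_hasCompactSupport h2
  have hpos : 0 < ∫ y, φ y :=
    h3.continuous.integral_pos_of_hasCompactSupport_nonneg_nonzero h2 hφ0 (x := w) (by simp [h5])
  have hi : Integrable fun y : ℝ × ℝ => φ y * y.1 :=
    (h3.continuous.mul continuous_fst).integrable_of_hasCompactSupport h2.mul_right
  set m := (∫ y : ℝ × ℝ, φ y * y.1) / ∫ y, φ y
  have hs : tsupport (fun y : ℝ × ℝ => φ y * (y.1 - m)) ⊆ tsupport φ :=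
    tsupport_mul_subset_left (g := fun y : ℝ × ℝ => y.1 - m)
  refine ⟨fun y => φ y * (y.1 - m), (h3.of_le le_rfl).mul (by fun_prop), h2.mul_right,
    hs.trans h1, ?_, ?_⟩
  · simp only [mul_sub]
    rw [integral_sub hi (hφi.mul_const m), integral_mul_const]
    simp only [m]
    rw [mul_div_cancel₀ _ hpos.ne', sub_self]
  -- Otherwise y₁ = m would hold on a neighbourhood of w, where the bump does not vanish.
  · by_contra hcon
    push Not at hcon
    have hev : ∀ᶠ t : ℝ in 𝓝 0, φ (w + t • (1, 0)) ≠ 0 := by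
      have hc : Continuous fun t : ℝ => φ (w + t • (1, 0)) := h3.continuous.comp (by fun_prop)
      refine hc.continuousAt.eventually_ne ?_
      simp [h5]
    have h6 : ∀ᶠ t : ℝ in 𝓝 0, t = m - w.1 := by
      filter_upwards [hev] with t ht
      have := (mul_eq_zero.1 (hcon (w + t • (1, 0)))).resolve_left ht
      simp only [Prod.fst_add, Prod.smul_fst, smul_eq_mul, mul_one] at this
      linarith
    have h7 : ∀ᶠ t : ℝ in 𝓝[≠] 0, t = m - w.1 := h6.filter_mono nhdsWithin_le_nhds
    have h8 : (0 : ℝ) = m - w.1 := h6.self_of_nhds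
    obtain ⟨t, ht, ht'⟩ := (h7.and self_mem_nhdsWithin).exists
    exact ht' (ht.trans h8.symm)

/-- Used as the v̄-factor of amplitudes: the resulting modes are annihilated by 𝓑, so -𝓓² and 𝓐
agree on them. -/
theorem exists_zero_mean : ∃ ψ : ℝ × ℝ → ℝ, ContDiff ℝ 1 ψ ∧ HasCompactSupport ψ ∧
    tsupport ψ ⊆ {w | S.β w ≠ 0} ∧ ∫ w, ψ w = 0 ∧ ∃ w, ψ w ≠ 0 := by
  refine exists_integral_eq_zero_of_isOpen (isOpen_ne_fun S.continuous_β continuous_const) ?_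
  by_contra h
  rw [not_nonempty_iff_eq_empty, eq_empty_iff_forall_notMem] at h
  have h0 : ∀ w, S.β w = 0 := fun w => by
    by_contra hw
    exact h w hw
  have := S.integral_β
  simp [h0] at this

theorem exists_actions_eq {p : ℝ × ℝ × ℝ} (hp : S.U₀ 0 < p.1) : ∃ z, S.actions z = p := by
  refine ⟨(0, √(2 * (p.1 - S.U₀ 0)), p.2), ?_⟩
  rw [actions, energy]
  dsimp only
  rw [Real.sq_sqrt (by linarith)]
  exact Prod.ext (by dsimp only; ring) rfl

/-- Amplitudes of product form. -/
def productAmplitude (χ : ℝ → ℝ) (ψ : ℝ × ℝ → ℝ) (c : ℂ) (p : ℝ × ℝ × ℝ) : ℂ :=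
  ((χ p.1 * ψ p.2 : ℝ) : ℂ) * c

variable {S}

theorem isAction_productAmplitude {χ : ℝ → ℝ} {ψ : ℝ × ℝ → ℝ} (c : ℂ) (h1 : ContDiff ℝ 1 χ)
    (h2 : HasCompactSupport χ) (h3 : tsupport χ ⊆ Ioo (S.U₀ 0) S.E₀) (h4 : ContDiff ℝ 1 ψ)
    (h5 : HasCompactSupport ψ) (h6 : tsupport ψ ⊆ {w | S.β w ≠ 0}) :
    S.IsAction (productAmplitude χ ψ c) := by
  have hs : tsupport (productAmplitude χ ψ c) ⊆ tsupport χ ×ˢ tsupport ψ := by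
    refine closure_minimal (fun p hp => ?_) ((isClosed_tsupport χ).prod (isClosed_tsupport ψ))
    refine ⟨subset_tsupport _ fun h => hp ?_, subset_tsupport _ fun h => hp ?_⟩
    · rw [productAmplitude, h, zero_mul, Complex.ofReal_zero, zero_mul]
    · rw [productAmplitude, h, mul_zero, Complex.ofReal_zero, zero_mul]
  have hr : ContDiff ℝ 1 fun p : ℝ × ℝ × ℝ => χ p.1 * ψ p.2 :=
    (h1.comp contDiff_fst).mul (h4.comp contDiff_snd)
  refine ⟨(Complex.ofRealCLM.contDiff.comp hr).mul contDiff_const,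
    (h2.prod h5).of_isClosed_subset (isClosed_tsupport _) hs, fun p hp => ?_⟩
  have := hs hp
  exact ⟨(h3 this.1).1, (h3 this.1).2, h6 this.2⟩

/-- Modes whose amplitude has mean zero in `v̄` generate no current. -/
theorem response_mode_eq_zero {χ : ℝ → ℝ} {ψ : ℝ × ℝ → ℝ} {c : ℂ} {k : ℕ}
    (hΨ : S.IsAction (productAmplitude χ ψ c)) (hψ : ∫ w, ψ w = 0) {g : S.Hilb}
    (hg : g =ᵐ[S.weightMeasure] S.mode k (productAmplitude χ ψ c)) : S.responseCLM g = 0 := by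
  have hzero : ∀ x, S.current (S.mode k (productAmplitude χ ψ c)) x = 0 := by
    intro x
    have h1 : ∀ v : ℝ × ℝ × ℝ, S.currentIntegrand (S.mode k (productAmplitude χ ψ c)) x v =
        v.1 * χ (S.energy (x, v.1, 0)) * (c * S.angle (x, v.1, 0) ^ k).re * ψ v.2 := by
      intro v
      have h2 : S.mode k (productAmplitude χ ψ c) (x, v) =
          χ (S.energy (x, v.1, 0)) * (c * S.angle (x, v.1, 0) ^ k).re * ψ v.2 := by
        rw [mode, productAmplitude, mul_assoc, Complex.re_ofReal_mul]
        change χ (S.energy (x, v.1, 0)) * ψ v.2 * (c * S.angle (x, v.1, 0) ^ k).re = _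
        ring
      rw [currentIntegrand]
      by_cases hz : (x, v) ∈ S.Ω₀
      · rw [indicator_of_mem hz, h2]
        ring
      · have h3 : S.mode k (productAmplitude χ ψ c) (x, v) = 0 :=
          image_eq_zero_of_notMem_tsupport fun h => hz ((S.isTest_mode k hΨ).2.2 h)
        rw [indicator_of_notMem hz]
        rw [h2] at h3
        linear_combination (-v.1) * h3
    have h4 := integral_prod_mul (μ := (volume : Measure ℝ)) (ν := (volume : Measure (ℝ × ℝ)))
      (fun v₁ : ℝ => v₁ * χ (S.energy (x, v₁, 0)) * (c * S.angle (x, v₁, 0) ^ k).re) ψ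
    rw [hψ, mul_zero] at h4
    rw [current, Measure.volume_eq_prod]
    simp only [h1]
    exact h4
  have hcur : ∀ᵐ x : ℝ, S.current g x = 0 := by
    filter_upwards [S.currentIntegrand_congr hg] with x hx
    rw [current, integral_congr_ae hx]
    exact hzero x
  rw [responseCLM_apply, Lp.eq_zero_iff_ae_eq_zero]
  filter_upwards [S.response_ae g, S.ae_fst hcur] with z h1 h2
  rw [h1, h2]
  simp

/-- A mode vanishing almost everywhere vanishes identically, and so does its transport derivative,
which for k > 0 exposes the imaginary part of the amplitude times the power of the angle. For k = 0
only the real part of the amplitude is visible, whence the extra hypothesis. -/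
theorem mode_ne_zero {k : ℕ} {Ψ : ℝ × ℝ × ℝ → ℂ} (hΨ : S.IsAction Ψ) {p : ℝ × ℝ × ℝ}
    (hp : Ψ p ≠ 0) (h0 : k = 0 → (Ψ p).re ≠ 0) {g : S.Hilb}
    (hg : g =ᵐ[S.weightMeasure] S.mode k Ψ) : g ≠ 0 := by
  rintro rfl
  have hae : ∀ᵐ z : PlanarPhaseSpace, S.mode k Ψ z = 0 := by
    have h1 : ∀ᵐ z ∂S.weightMeasure, S.mode k Ψ z = 0 := by
      filter_upwards [hg, Lp.coeFn_zero ℝ 2 S.weightMeasure] with z h1 h2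
      rw [← h1, h2]
      rfl
    filter_upwards [S.ae_weightMeasure_iff.1 h1] with z hz
    by_cases hzΩ : z ∈ S.Ω₀
    · exact hz hzΩ
    · exact image_eq_zero_of_notMem_tsupport fun h => hzΩ ((S.isTest_mode k hΨ).2.2 h)
  have hall : S.mode k Ψ = fun _ => 0 :=
    (Continuous.ae_eq_iff_eq volume (S.isTest_mode k hΨ).1.continuous continuous_const).1 hae
  obtain ⟨z, hz⟩ := S.exists_actions_eq (hΨ.2.2 (subset_tsupport _ hp)).1
  have hre : (Ψ p * S.angle z ^ k).re = 0 := by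
    have := congrFun hall z
    rwa [mode, hz] at this
  rcases Nat.eq_zero_or_pos k with hk | hk
  · subst hk
    rw [pow_zero, mul_one] at hre
    exact h0 rfl hre
  · have him : (Ψ p * S.angle z ^ k).im = 0 := by
      have h1 := congrFun (S.transport_mode k hΨ) z
      rw [hall, mode, hz] at h1
      have h2 : S.classicalTransport (fun _ => 0) z = 0 := by simp [classicalTransport]
      have h3 : (k * Complex.I * ((S.freq p.1 : ℂ) * Ψ p) * S.angle z ^ k).re =
          -((k * S.freq p.1) * (Ψ p * S.angle z ^ k).im) := by
        have : (k * Complex.I * ((S.freq p.1 : ℂ) * Ψ p) * S.angle z ^ k) =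
            ((k * S.freq p.1 : ℝ) : ℂ) * (Complex.I * (Ψ p * S.angle z ^ k)) := by
          push_cast; ring
        rw [this, Complex.re_ofReal_mul, Complex.I_mul_re]
        ring
      rw [h2, h3, eq_comm, neg_eq_zero] at h1
      exact (mul_eq_zero.1 h1).resolve_left
        (mul_ne_zero (Nat.cast_ne_zero.2 hk.ne') (S.freq_pos _).ne')
    have hprod : Ψ p * S.angle z ^ k = 0 := Complex.ext hre him
    rcases mul_eq_zero.1 hprod with h | h
    · exact hp h
    · have h1 := S.norm_angle z
      rw [eq_zero_of_pow_eq_zero h] at h1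
      simp at h1

namespace IsModePart

variable {K : Type*} [NormedAddCommGroup K] [InnerProductSpace ℝ K]
  {ι : K →ₗᵢ[ℝ] S.Hilb} {P : ℕ → Submodule ℝ ℂ} {T : K →ₗ.[ℝ] K}

theorem exists_mode (hT : S.IsModePart ι P T) {k : ℕ} {Ψ : ℝ × ℝ × ℝ → ℂ} (hΨ : S.IsAction Ψ)
    (hP : ∀ p, Ψ p ∈ P k) : ∃ u : T.domain, ι u =ᵐ[S.weightMeasure] S.mode k Ψ ∧
      ι (T u) =ᵐ[S.weightMeasure] fun z => k ^ 2 * S.freqSq (S.energy z) * S.mode k Ψ z := by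
  have t1 := S.isTest_mode k hΨ
  have t2 : S.IsTest (S.classicalTransport (S.mode k Ψ)) := by
    rw [S.transport_mode k hΨ]
    exact S.isTest_mode k (hΨ.freq_mul k)
  obtain ⟨u, hu⟩ := hT.core_le (toLp_mode_mem_core hΨ hP)
  have hu' : ι u = (S.memLp_test t1).toLp := hu
  have hae : ι u =ᵐ[S.weightMeasure] S.mode k Ψ := by
    rw [hu']
    exact MemLp.coeFn_toLp _
  have htr : S.IsTestTriple (ι u) (S.memLp_transport_test t1).toLp
      (S.memLp_transport_test t2).toLp :=
    ⟨_, t1, t2, hae, MemLp.coeFn_toLp _, MemLp.coeFn_toLp _⟩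
  obtain ⟨h1, h2⟩ := htr.exists_transportSq
  have h3 := (hT.mem_domain_iff u).2 h1
  refine ⟨⟨u, h3⟩, hae, ?_⟩
  rw [hT.map_apply ⟨u, h3⟩ h1, h2]
  filter_upwards [Lp.coeFn_neg (S.memLp_transport_test t2).toLp,
    (S.memLp_transport_test t2).coeFn_toLp] with z h4 h5
  rw [h4, Pi.neg_apply, h5, S.transport_transport_mode k hΨ]
  ring

/-- T R = 1 + lam R is bounded, so 𝓑 ι R is compact by the factorisation of 𝓑. As ι is isometric, C
R = ι* (s 𝓑 ι R). -/
theorem isCompactOperator_comp_resolvent [CompleteSpace K] (hT : S.IsModePart ι P T)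
    {C : K →L[ℝ] K} {s : ℝ} (hC : ∀ g, ι (C g) = s • S.responseCLM (ι g)) {lam : ℝ}
    {R : K →L[ℝ] K} (hR : T.IsResolventAt lam R) : IsCompactOperator (C.comp R) := by
  set J : K →L[ℝ] S.Hilb := ι.toContinuousLinearMap
  have hdom : ∀ f, (J.comp R) f ∈ (-S.transportSq).domain := fun f => by
    obtain ⟨h, -⟩ := hR.1 f
    exact (hT.mem_domain_iff _).1 h
  have hbound : ∀ f, ‖(-S.transportSq) ⟨(J.comp R) f, hdom f⟩‖ ≤ (1 + |lam| * ‖R‖) * ‖f‖ := by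
    intro f
    obtain ⟨h, hf⟩ := hR.1 f
    have h1 := hT.map_apply ⟨R f, h⟩ (hdom f)
    have h2 : (-S.transportSq) ⟨(J.comp R) f, hdom f⟩ = ι (T ⟨R f, h⟩) := h1.symm
    rw [h2, ι.norm_map, eq_add_of_sub_eq hf]
    refine (norm_add_le _ _).trans ?_
    rw [norm_smul, Real.norm_eq_abs]
    have := mul_le_mul_of_nonneg_left (R.le_opNorm f) (abs_nonneg lam)
    linarith
  have hc := S.isCompactOperator_response_comp (J.comp R) hdom hbound
  have heq : C.comp R = (ContinuousLinearMap.adjoint J).comp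
      (s • S.responseCLM.comp (J.comp R)) := by
    ext1 f
    refine ext_inner_left ℝ fun h => ?_
    rw [ContinuousLinearMap.comp_apply, ContinuousLinearMap.comp_apply,
      ContinuousLinearMap.adjoint_inner_right, ← ι.inner_map_map, hC]
    rfl
  rw [heq]
  have hs : IsCompactOperator (s • S.responseCLM.comp (J.comp R)) := hc.smul s
  exact hs.clm_comp (ContinuousLinearMap.adjoint J)

/-- End-point energies are limits of interior ones, so E can be moved into the open interval while
the squared frequency stays close to lam. -/
theorem exists_isOpen_near {lam ε : ℝ} (hε : 0 < ε) {k : ℕ} {E : ℝ}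
    (hE : E ∈ Icc (S.U₀ 0) S.E₀) (hlam : lam = k ^ 2 * S.freqSq E) :
    ∃ a b, a < b ∧ ∀ y ∈ Ioo a b, y ∈ Ioo (S.U₀ 0) S.E₀ ∧ |k ^ 2 * S.freqSq y - lam| < ε := by
  have hc : Continuous fun y => |(k : ℝ) ^ 2 * S.freqSq y - lam| :=
    ((continuous_const.mul S.continuous_freqSq).sub continuous_const).abs
  have hO : IsOpen {y | |(k : ℝ) ^ 2 * S.freqSq y - lam| < ε} := isOpen_lt hc continuous_const
  have hcl : E ∈ closure (Ioo (S.U₀ 0) S.E₀) := by rwa [closure_Ioo S.U₀_zero_lt.ne]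
  obtain ⟨y, hy1, hy2⟩ := mem_closure_iff.1 hcl _ hO (by simp [hlam, hε])
  obtain ⟨l, u, hy, hlu⟩ := mem_nhds_iff_exists_Ioo_subset.1
    ((hO.inter isOpen_Ioo).mem_nhds ⟨hy1, hy2⟩)
  exact ⟨l, u, hy.1.trans hy.2, fun x hx => ⟨(hlu hx).2, (hlu hx).1⟩⟩

theorem exists_bump {a b : ℝ} (hab : a < b) : ∃ χ : ℝ → ℝ, ContDiff ℝ 1 χ ∧
    HasCompactSupport χ ∧ tsupport χ ⊆ Ioo a b ∧ ∃ E, χ E ≠ 0 := by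
  obtain ⟨E, hE⟩ := nonempty_Ioo.2 hab
  obtain ⟨χ, h1, h2, h3, -, h5⟩ := exists_contDiff_tsupport_subset (n := 1) (isOpen_Ioo.mem_nhds hE)
  exact ⟨χ, h3, h2, h1, E, by rw [h5]; exact one_ne_zero⟩

/-- The part of `-𝓓² - s 𝓑` in a subspace spanned by modes has the essential spectrum given by the
squared frequencies. -/
theorem essentialSpectrum_eq [CompleteSpace K] (hT : S.IsModePart ι P T)
    {C : K →L[ℝ] K} {s : ℝ} (hC : ∀ g, ι (C g) = s • S.responseCLM (ι g)) {A : K →ₗ.[ℝ] K}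
    (hdom : ∀ g, g ∈ A.domain ↔ g ∈ T.domain)
    (hA : ∀ (g : A.domain) (h : (g : K) ∈ T.domain), A g = T ⟨g, h⟩ - C g) :
    A.essentialSpectrum = S.bandSet P := by
  have hCsymm : ∀ f g, ⟪C f, g⟫_ℝ = ⟪f, C g⟫_ℝ := fun f g => by
    rw [← ι.inner_map_map, ← ι.inner_map_map, hC, hC, inner_smul_left, inner_smul_right,
      S.inner_responseCLM_comm]
    simp
  obtain ⟨ψ, hψ1, hψ2, hψ3, hψ4, w, hw⟩ := S.exists_zero_mean
  -- The zero-mean factor ψ makes C vanish on these modes, so A acts on them exactly as T.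
  have hmode : ∀ {k : ℕ} {c : ℂ} {χ : ℝ → ℝ}, c ∈ P k → c ≠ 0 → (k = 0 → c.re ≠ 0) →
      ContDiff ℝ 1 χ → HasCompactSupport χ → tsupport χ ⊆ Ioo (S.U₀ 0) S.E₀ → (∃ E, χ E ≠ 0) →
      ∃ u : A.domain, (u : K) ≠ 0 ∧
        ι u =ᵐ[S.weightMeasure] S.mode k (productAmplitude χ ψ c) ∧
        ι (A u) =ᵐ[S.weightMeasure]
          fun z => k ^ 2 * S.freqSq (S.energy z) * S.mode k (productAmplitude χ ψ c) z := by
    intro k c χ hc hc0 hck h1 h2 h3 ⟨E, hE⟩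
    have hact := isAction_productAmplitude (S := S) c h1 h2 h3 hψ1 hψ2 hψ3
    obtain ⟨u, hu1, hu2⟩ := hT.exists_mode (k := k) hact fun p => by
      rw [productAmplitude, ← Complex.real_smul]
      exact (P k).smul_mem _ hc
    have hval : productAmplitude χ ψ c (E, w) = ((χ E * ψ w : ℝ) : ℂ) * c := rfl
    have hne : χ E * ψ w ≠ 0 := mul_ne_zero hE hw
    have hu0 : ι u ≠ 0 := by
      refine mode_ne_zero hact (p := (E, w)) ?_ (fun hk => ?_) hu1
      · rw [hval]
        exact mul_ne_zero (Complex.ofReal_ne_zero.2 hne) hc0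
      · rw [hval, Complex.re_ofReal_mul]
        exact mul_ne_zero hne (hck hk)
    refine ⟨⟨u, (hdom u).2 u.2⟩, fun h => hu0 ?_, hu1, ?_⟩
    · have h' : (u : K) = 0 := h
      rw [h', map_zero]
    · have hCu : C u = 0 := by
        apply ι.injective
        rw [hC, response_mode_eq_zero hact hψ4 hu1, smul_zero, map_zero]
      have hAu : A ⟨u, (hdom u).2 u.2⟩ = T u := by
        rw [hA _ u.2, hCu, sub_zero]
      rw [hAu]
      exact hu2
  refine LinearPMap.essentialSpectrum_eq_of_compact (fun u v => ?_) (S.isClosed_bandSet P)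
    (fun lam hlam => ?_) ?_ ?_
  · have hu := (hdom u).1 u.2
    have hv := (hdom v).1 v.2
    rw [hA u hu, hA v hv, inner_sub_left, inner_sub_right, hCsymm,
      hT.isSymmetric ⟨u, hu⟩ ⟨v, hv⟩]
  · obtain ⟨R, hR, -⟩ := hT.exists_isResolventAt hlam
    have hRsymm : ∀ f g, ⟪R f, g⟫_ℝ = ⟪f, R g⟫_ℝ := by
      intro f g
      obtain ⟨hf, hf'⟩ := hR.1 f
      obtain ⟨hg, hg'⟩ := hR.1 g
      have h1 := hT.isSymmetric ⟨R f, hf⟩ ⟨R g, hg⟩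
      conv_lhs => rw [← hg']
      conv_rhs => rw [← hf']
      rw [inner_sub_right, inner_sub_left, inner_smul_left, inner_smul_right, h1]
      simp
    -- Relative compactness concerns C R, whereas A u - lam u = f reads u - R C u = R f. Symmetry of
    -- both operators transfers compactness to R C = (C R)*.
    have hadj : R.comp C = ContinuousLinearMap.adjoint (C.comp R) := by
      rw [ContinuousLinearMap.eq_adjoint_iff]
      intro f g
      rw [ContinuousLinearMap.comp_apply, ContinuousLinearMap.comp_apply, hRsymm, hCsymm]
    refine ⟨R, R.comp C, ?_, fun u => ?_, fun u f huf => ?_⟩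
    · rw [hadj]
      exact (hT.isCompactOperator_comp_resolvent hC hR).adjoint
    · have hu := (hdom u).1 u.2
      have h1 := hR.2 ⟨u, hu⟩
      have h2 : A u - lam • (u : K) = (T ⟨u, hu⟩ - lam • (u : K)) - C u := by
        rw [hA u hu]
        abel
      rw [h2, map_sub, ContinuousLinearMap.comp_apply]
      exact congrArg (· - R (C u)) h1.symm
    · rw [ContinuousLinearMap.comp_apply, sub_eq_iff_eq_add, ← map_add] at huf
      obtain ⟨h, hh⟩ := hR.1 (f + C u)
      have hu : u ∈ T.domain := by rw [huf]; exact h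
      refine ⟨(hdom u).2 hu, ?_⟩
      have h1 : T ⟨u, hu⟩ - lam • u = f + C u := by
        have h2 : (⟨R (f + C u), h⟩ : T.domain) = ⟨u, hu⟩ := Subtype.ext huf.symm
        rw [h2, ← huf] at hh
        exact hh
      rw [hA ⟨u, (hdom u).2 hu⟩ hu, sub_right_comm, h1, add_sub_cancel_right]
  -- Approximate eigenvectors: modes whose energies are confined to an interval where the squared
  -- frequency is ε-close to lam.
  · rintro lam ⟨k, hk, E, hE, hlam⟩ ε hε
    obtain ⟨c, hc, hc0, hck⟩ := hT.amplitude k hk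
    obtain ⟨a, b, hab, hO⟩ := exists_isOpen_near hε hE hlam
    obtain ⟨χ, h1, h2, h3, h4⟩ := exists_bump hab
    obtain ⟨u, hu0, hu1, hu2⟩ := hmode hc hc0 hck h1 h2 (h3.trans fun y hy => (hO y hy).1) h4
    refine ⟨u, hu0, ?_⟩
    have hd : ι (A u - lam • (u : K)) = ι (A u) - lam • ι u := by rw [map_sub, map_smul]
    rw [← ι.norm_map, ← ι.norm_map (u : K), hd]
    refine Lp.norm_le_mul_norm_of_ae_le_mul ?_
    filter_upwards [hu1, hu2, Lp.coeFn_sub (ι (A u)) (lam • ι u), Lp.coeFn_smul lam (ι u)]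
      with z e1 e2 e3 e4
    rw [e3, Pi.sub_apply, e4, Pi.smul_apply, e1, e2, smul_eq_mul, ← sub_mul, norm_mul]
    by_cases hz : S.energy z ∈ Ioo a b
    · exact mul_le_mul_of_nonneg_right (hO _ hz).2.le (norm_nonneg _)
    · have hχ : χ (S.energy z) = 0 := image_eq_zero_of_notMem_tsupport fun h => hz (h3 h)
      have h0 : S.mode k (productAmplitude χ ψ c) z = 0 := by
        rw [mode, productAmplitude]
        simp [actions, hχ]
      rw [h0, norm_zero, mul_zero, mul_zero]
  -- If lam is isolated in the band set, the squared frequency equals lam on a whole energy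
  -- interval; bumps on disjoint subintervals then give infinitely many orthogonal eigenvectors.
  · rintro lam ⟨k, hk, E, hE, hlam⟩ ⟨ε, hε, hiso⟩ hfin
    obtain ⟨c, hc, hc0, hck⟩ := hT.amplitude k hk
    obtain ⟨a, b, hab, hO⟩ := exists_isOpen_near hε hE hlam
    have hfreq : ∀ y ∈ Ioo a b, (k : ℝ) ^ 2 * S.freqSq y = lam := fun y hy =>
      hiso _ ⟨k, hk, y, ⟨(hO y hy).1.1.le, (hO y hy).1.2.le⟩, rfl⟩ (hO y hy).2
    -- The denominator n + 2 keeps every t n, including t 0, strictly between a and b.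
    set t : ℕ → ℝ := fun n => a + (b - a) / (n + 2)
    have ht : ∀ n, t (n + 1) < t n := fun n => by
      simp only [t]
      push_cast
      gcongr
      linarith
    have hanti : StrictAnti t := strictAnti_nat_of_succ_lt ht
    have hta : ∀ n, a < t n := fun n => by
      have : 0 < (b - a) / ((n : ℝ) + 2) := div_pos (by linarith) (by positivity)
      simp only [t]
      linarith
    have htb : ∀ n, t n < b := fun n => by
      have : (b - a) / ((n : ℝ) + 2) < b - a := by
        rw [div_lt_iff₀ (by positivity)]
        nlinarith [Nat.cast_nonneg (α := ℝ) n]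
      simp only [t]
      linarith
    have hsub : ∀ n, Ioo (t (n + 1)) (t n) ⊆ Ioo a b := fun n =>
      Ioo_subset_Ioo (hta _).le (htb _).le
    choose χ c1 c2 c3 c4 using fun n => exists_bump (ht n)
    choose u hu0 hu1 hu2 using fun n => hmode hc hc0 hck (c1 n) (c2 n)
      ((c3 n).trans fun y hy => (hO y (hsub n hy)).1) (c4 n)
    have hχ0 : ∀ n y, y ∉ Ioo (t (n + 1)) (t n) → χ n y = 0 := fun n y hy =>
      image_eq_zero_of_notMem_tsupport fun h => hy (c3 n h)
    have hm0 : ∀ n z, χ n (S.energy z) = 0 → S.mode k (productAmplitude (χ n) ψ c) z = 0 := by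
      intro n z hz
      rw [mode, productAmplitude]
      simp [actions, hz]
    have heig : ∀ n, u n ∈ A.eigenspace lam := by
      intro n
      rw [LinearPMap.mem_eigenspace_iff]
      apply ι.injective
      rw [map_smul]
      refine Lp.ext ?_
      filter_upwards [hu1 n, hu2 n, Lp.coeFn_smul lam (ι (u n))] with z e1 e2 e3
      rw [e2, e3, Pi.smul_apply, e1, smul_eq_mul]
      by_cases hz : S.energy z ∈ Ioo (t (n + 1)) (t n)
      · rw [hfreq _ (hsub n hz)]
      · rw [hm0 n z (hχ0 n _ hz), mul_zero, mul_zero]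
    have hlin : LinearIndependent ℝ fun n => (u n : K) := by
      refine linearIndependent_of_ne_zero_of_inner_eq_zero (𝕜 := ℝ) hu0 fun i j hij => ?_
      dsimp only
      rw [← ι.inner_map_map, S.inner_eq_integral]
      refine integral_eq_zero_of_ae ?_
      filter_upwards [hu1 i, hu1 j] with z e1 e2
      rw [e1, e2, Pi.zero_apply]
      by_cases hi : S.energy z ∈ Ioo (t (i + 1)) (t i)
      · rw [hm0 j z (hχ0 j _ fun hj => ?_), mul_zero]
        rcases lt_or_gt_of_ne hij with h | h
        · exact absurd (hi.1.trans hj.2) (not_lt.2 (hanti.antitone h))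
        · exact absurd (hj.1.trans hi.2) (not_lt.2 (hanti.antitone h))
      · rw [hm0 i z (hχ0 i _ hi), zero_mul]
    have hlin' : LinearIndependent ℝ fun n => (⟨u n, heig n⟩ : A.eigenspace lam) :=
      LinearIndependent.of_comp (A.domain.subtype.comp (A.eigenspace lam).subtype) hlin
    exact not_finite_iff_infinite.2 inferInstance hlin'.finite

end IsModePart

end PlanarSteadyState

namespace PlanarSteadyState

variable (S : PlanarSteadyState)

/-! Reflections of phase space. -/

/-- Linear involutions of phase space that preserve volume, `E` and `v̄` and reverse the flow. -/
structure IsReflection (r : PlanarPhaseSpace ≃L[ℝ] PlanarPhaseSpace) : Prop where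
  apply_apply : ∀ z, r (r z) = z
  measurePreserving_volume : MeasurePreserving r volume volume
  actions_apply : ∀ z, S.actions (r z) = S.actions z
  hamField_apply : ∀ z, S.hamField (r z) = -r (S.hamField z)

variable {S}

namespace IsReflection

variable {r : PlanarPhaseSpace ≃L[ℝ] PlanarPhaseSpace}

theorem energy_apply (hr : S.IsReflection r) (z : PlanarPhaseSpace) :
    S.energy (r z) = S.energy z := congrArg Prod.fst (hr.actions_apply z)

theorem velocity_apply (hr : S.IsReflection r) (z : PlanarPhaseSpace) : (r z).2.2 = z.2.2 :=
  (Prod.ext_iff.1 (hr.actions_apply z)).2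

theorem preimage_Ω₀ (hr : S.IsReflection r) : r ⁻¹' S.Ω₀ = S.Ω₀ := by
  ext z
  rw [mem_preimage, S.mem_Ω₀_iff, S.mem_Ω₀_iff, hr.energy_apply, hr.velocity_apply]

/-- The weight and Ω₀ depend on (E, v̄) only. -/
theorem measurePreserving (hr : S.IsReflection r) :
    MeasurePreserving r S.weightMeasure S.weightMeasure := by
  have hm : Measurable r := r.continuous.measurable
  have h1 := hr.measurePreserving_volume.restrict_preimage S.measurableSet_Ω₀
  rw [hr.preimage_Ω₀] at h1
  refine ⟨hm, Measure.ext fun s hs => ?_⟩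
  rw [Measure.map_apply hm hs, weightMeasure, withDensity_apply _ (hm hs), withDensity_apply _ hs,
    ← (h1.restrict_preimage hs).lintegral_comp S.measurable_weight]
  simp only [dφ, hr.energy_apply, hr.velocity_apply]

theorem integral_comp (hr : S.IsReflection r) (F : PlanarPhaseSpace → ℝ) :
    ∫ z, F (r z) ∂S.weightMeasure = ∫ z, F z ∂S.weightMeasure :=
  hr.measurePreserving.integral_comp r.toHomeomorph.measurableEmbedding F

theorem isTest_comp (hr : S.IsReflection r) {ξ : PlanarPhaseSpace → ℝ} (hξ : S.IsTest ξ) :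
    S.IsTest (ξ ∘ r) := by
  refine ⟨hξ.1.comp r.contDiff, hξ.2.1.comp_homeomorph r.toHomeomorph, ?_⟩
  have h := tsupport_comp_subset_preimage ξ r.continuous
  exact h.trans ((preimage_mono hξ.2.2).trans hr.preimage_Ω₀.subset)

theorem transport_comp (hr : S.IsReflection r) {ξ : PlanarPhaseSpace → ℝ} (hξ : S.IsTest ξ)
    (z : PlanarPhaseSpace) :
    S.classicalTransport (ξ ∘ r) z = -S.classicalTransport ξ (r z) := by
  rw [S.classicalTransport_eq, S.classicalTransport_eq, fderiv_comp z
    (hξ.1.differentiable one_ne_zero _) r.differentiableAt, r.fderiv, hr.hamField_apply, map_neg,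
    neg_neg]
  rfl

/-- Composition with a reflection. -/
def pullback (hr : S.IsReflection r) : S.Hilb →+ S.Hilb :=
  Lp.compMeasurePreserving r hr.measurePreserving

theorem pullback_ae (hr : S.IsReflection r) (g : S.Hilb) :
    hr.pullback g =ᵐ[S.weightMeasure] fun z => g (r z) :=
  Lp.coeFn_compMeasurePreserving g hr.measurePreserving

theorem continuous_pullback (hr : S.IsReflection r) : Continuous hr.pullback :=
  (Lp.isometry_compMeasurePreserving hr.measurePreserving).continuous

theorem integral_pullback_mul (hr : S.IsReflection r) (g : S.Hilb) (F : PlanarPhaseSpace → ℝ) :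
    ∫ z, hr.pullback g z * F z ∂S.weightMeasure = ∫ z, g z * F (r z) ∂S.weightMeasure := by
  rw [← hr.integral_comp fun z => g z * F (r z)]
  refine integral_congr_ae ?_
  filter_upwards [hr.pullback_ae g] with z hz
  rw [hz, hr.apply_apply]

/-- A reflection reverses the flow and so anticommutes with 𝓓, first on test functions and then, by
duality, weakly. Hence it commutes with 𝓓². -/
theorem pullback_mem_transportGraph (hr : S.IsReflection r) {g h : S.Hilb}
    (hgh : (g, h) ∈ S.transportGraph) :
    (hr.pullback g, -hr.pullback h) ∈ S.transportGraph := by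
  intro ξ hξ
  have h1 : ∫ z, g z * S.classicalTransport (ξ ∘ r) z ∂S.weightMeasure =
      -∫ z, h z * ξ (r z) ∂S.weightMeasure := hgh _ (hr.isTest_comp hξ)
  simp only [hr.transport_comp hξ, mul_neg, integral_neg, neg_inj] at h1
  have h2 : ∫ z, (-hr.pullback h : S.Hilb) z * ξ z ∂S.weightMeasure =
      -∫ z, hr.pullback h z * ξ z ∂S.weightMeasure := by
    rw [← integral_neg]
    refine integral_congr_ae ?_
    filter_upwards [Lp.coeFn_neg (hr.pullback h)] with z hz
    rw [hz, Pi.neg_apply, neg_mul]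
  dsimp only
  rw [h2, neg_neg, hr.integral_pullback_mul, hr.integral_pullback_mul, h1]

theorem pullback_transportSq (hr : S.IsReflection r) (g : (-S.transportSq).domain)
    (hg : hr.pullback g = -(g : S.Hilb)) :
    hr.pullback ((-S.transportSq) g) = -(-S.transportSq) g := by
  obtain ⟨h, h1, h2⟩ := S.graph_of_transportSq g
  have h3 := hr.pullback_mem_transportGraph h1
  rw [hg] at h3
  -- 𝓓 turns odd functions into even ones.
  have h4 : hr.pullback h = h := by
    have := S.transportGraph_eq h3 (S.transportGraph.neg_mem h1)
    exact neg_injective this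
  have h5 := hr.pullback_mem_transportGraph h2
  rw [h4, map_neg, neg_neg] at h5
  exact S.transportGraph_eq h5 h2

theorem ae_eq_neg_iff (hr : S.IsReflection r) (g : S.Hilb) :
    hr.pullback g = -g ↔ ∀ᵐ z ∂S.weightMeasure, g z = -g (r z) := by
  rw [Lp.ext_iff]
  refine eventually_congr ?_
  filter_upwards [hr.pullback_ae g, Lp.coeFn_neg g] with z h1 h2
  rw [h1, h2, Pi.neg_apply, eq_neg_iff_add_eq_zero, eq_neg_iff_add_eq_zero, add_comm]

end IsReflection

/-- The linear equivalence `reflX`. -/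
def reflXEquiv : PlanarPhaseSpace ≃L[ℝ] PlanarPhaseSpace :=
  (ContinuousLinearEquiv.neg ℝ).prodCongr (ContinuousLinearEquiv.refl ℝ (ℝ × ℝ × ℝ))

/-- The linear equivalence `reflV`. -/
def reflVEquiv : PlanarPhaseSpace ≃L[ℝ] PlanarPhaseSpace :=
  (ContinuousLinearEquiv.refl ℝ ℝ).prodCongr
    ((ContinuousLinearEquiv.neg ℝ).prodCongr (ContinuousLinearEquiv.refl ℝ (ℝ × ℝ)))

theorem coe_reflXEquiv : ⇑reflXEquiv = reflX := rfl

theorem coe_reflVEquiv : ⇑reflVEquiv = reflV := rfl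

variable (S)

theorem deriv_U₀_neg (x : ℝ) : deriv S.U₀ (-x) = -deriv S.U₀ x := by
  rw [S.deriv_U₀, S.deriv_U₀, S.forceQuot_neg, neg_mul]

theorem isReflection_reflX : S.IsReflection reflXEquiv where
  apply_apply z := by simp [coe_reflXEquiv, reflX]
  measurePreserving_volume := (Measure.measurePreserving_neg (volume : Measure ℝ)).prod
    (MeasurePreserving.id (volume : Measure (ℝ × ℝ × ℝ)))
  actions_apply z := by simp [coe_reflXEquiv, reflX, actions, energy, S.U₀_neg]
  hamField_apply z := by simp [coe_reflXEquiv, reflX, hamField, S.deriv_U₀_neg]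

theorem isReflection_reflV : S.IsReflection reflVEquiv where
  apply_apply z := by simp [coe_reflVEquiv, reflV]
  measurePreserving_volume := (MeasurePreserving.id (volume : Measure ℝ)).prod
      ((Measure.measurePreserving_neg (volume : Measure ℝ)).prod
        (MeasurePreserving.id (volume : Measure (ℝ × ℝ))))
  actions_apply z := by simp [coe_reflVEquiv, reflV, actions, energy]
  hamField_apply z := by simp [coe_reflVEquiv, reflV, hamField]

theorem mem_oddSubspace_iff (g : S.Hilb) : g ∈ S.oddSubspace ↔
    S.isReflection_reflX.pullback g = -g ∧ S.isReflection_reflV.pullback g = -g := by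
  rw [S.isReflection_reflX.ae_eq_neg_iff, S.isReflection_reflV.ae_eq_neg_iff]
  change (∀ᵐ z ∂S.weightMeasure, g z = -g (reflX z) ∧ g z = -g (reflV z)) ↔ _
  exact eventually_and

theorem isClosed_oddSubspace : IsClosed (S.oddSubspace : Set S.Hilb) := by
  have : (S.oddSubspace : Set S.Hilb) = {g | S.isReflection_reflX.pullback g = -g} ∩
      {g | S.isReflection_reflV.pullback g = -g} := ext S.mem_oddSubspace_iff
  rw [this]
  exact (isClosed_eq S.isReflection_reflX.continuous_pullback continuous_neg).inter
    (isClosed_eq S.isReflection_reflV.continuous_pullback continuous_neg)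

instance : CompleteSpace S.oddSubspace := S.isClosed_oddSubspace.completeSpace_coe

theorem transportSq_mem_oddSubspace (g : (-S.transportSq).domain)
    (hg : (g : S.Hilb) ∈ S.oddSubspace) : (-S.transportSq) g ∈ S.oddSubspace := by
  rw [mem_oddSubspace_iff] at hg ⊢
  exact ⟨S.isReflection_reflX.pullback_transportSq g hg.1,
    S.isReflection_reflV.pullback_transportSq g hg.2⟩

theorem current_neg_of_odd {g : S.Hilb} (hg : g ∈ S.oddSubspace) :
    ∀ᵐ x : ℝ, S.current g (-x) = -S.current g x := by
  have h1 : g =ᵐ[S.weightMeasure] fun z => -g (reflX z) :=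
    (S.isReflection_reflX.ae_eq_neg_iff g).1 ((S.mem_oddSubspace_iff g).1 hg).1
  have h2 := S.currentIntegrand_congr h1
  filter_upwards [h2] with x hx
  rw [current, current, integral_congr_ae hx, ← integral_neg]
  refine integral_congr_ae (Eventually.of_forall fun v => ?_)
  have h3 : (-x, v) ∈ S.Ω₀ ↔ (x, v) ∈ S.Ω₀ := by
    rw [mem_Ω₀_iff, mem_Ω₀_iff, energy, energy, S.U₀_neg]
  simp only [currentIntegrand]
  by_cases hz : (x, v) ∈ S.Ω₀
  · rw [indicator_of_mem hz, indicator_of_mem (h3.2 hz), reflX]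
    ring
  · rw [indicator_of_notMem hz, indicator_of_notMem fun h => hz (h3.1 h), mul_zero, neg_zero]

/-- |φ'| is even in x and in v₁, the explicit factor v₁ is odd in v₁, and the current of an odd
function is odd in x. -/
theorem response_mem_oddSubspace {g : S.Hilb} (hg : g ∈ S.oddSubspace) :
    S.responseCLM g ∈ S.oddSubspace := by
  have h1 : ∀ z, S.density (reflX z) = S.density z := fun z => by
    rw [density, density, energy, reflX, S.U₀_neg, energy]
  have h2 : ∀ z, S.density (reflV z) = S.density z := fun z => by
    rw [density, density, energy, reflV, energy, neg_sq]
  have h3 : S.responseCLM g =ᵐ[S.weightMeasure] _ := S.response_ae g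
  filter_upwards [h3, S.ae_reflX h3, S.ae_reflV h3, S.ae_fst (S.current_neg_of_odd hg)]
    with z h4 h5 h6 h7
  rw [h4, h5, h6, h1, h2]
  simp only [reflX, reflV, h7]
  constructor <;> ring

end PlanarSteadyState

namespace PlanarSteadyState

variable (S : PlanarSteadyState)

/-! The modes in the odd subspace. -/

/-- r is odd, so reflection in x conjugates v₁ + i r(x), and elapsed time is odd in the polar angle.
-/
theorem angle_reflX {z : PlanarPhaseSpace} (hz : S.U₀ 0 < S.energy z) :
    S.angle (reflX z) = (starRingEnd ℂ) (S.angle z) := by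
  rw [angle, angle, ← S.complexAngleExp_conj (S.coord_ne_zero hz)]
  congr 1
  simp [coord, reflX, S.radial_neg]

theorem angle_reflV {z : PlanarPhaseSpace} (hz : S.U₀ 0 < S.energy z) :
    S.angle (reflV z) = -(starRingEnd ℂ) (S.angle z) := by
  rw [angle, angle, ← S.complexAngleExp_neg_conj (S.coord_ne_zero hz)]
  congr 1
  simp [coord, reflV]
  ring

variable {S}

theorem mode_reflX (k : ℕ) {Ψ : ℝ × ℝ × ℝ → ℂ} (hΨ : S.IsAction Ψ) (z : PlanarPhaseSpace) :
    S.mode k Ψ (reflX z) = S.mode k (fun p => (starRingEnd ℂ) (Ψ p)) z := by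
  have h := S.isReflection_reflX.actions_apply z
  rw [coe_reflXEquiv] at h
  rw [mode, mode, h]
  by_cases h0 : Ψ (S.actions z) = 0
  · rw [h0, map_zero, zero_mul, zero_mul]
  · rw [S.angle_reflX (hΨ.2.2 (subset_tsupport _ h0)).1, ← Complex.conj_re, map_mul, ← map_pow,
      Complex.conj_conj]

theorem mode_reflV (k : ℕ) {Ψ : ℝ × ℝ × ℝ → ℂ} (hΨ : S.IsAction Ψ) (z : PlanarPhaseSpace) :
    S.mode k Ψ (reflV z) = (-1) ^ k * S.mode k (fun p => (starRingEnd ℂ) (Ψ p)) z := by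
  have h := S.isReflection_reflV.actions_apply z
  rw [coe_reflVEquiv] at h
  rw [mode, mode, h]
  by_cases h0 : Ψ (S.actions z) = 0
  · rw [h0, map_zero, zero_mul, zero_mul, Complex.zero_re, mul_zero]
  · rw [S.angle_reflV (hΨ.2.2 (subset_tsupport _ h0)).1, neg_pow, ← Complex.conj_re, map_mul,
      map_mul, ← map_pow, Complex.conj_conj, mul_left_comm]
    rcases neg_one_pow_eq_or ℂ k with h1 | h1 <;> rcases neg_one_pow_eq_or ℝ k with h2 | h2
    · simp [h1, h2]
    · exfalso
      have := congrArg (Complex.ofReal) h2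
      push_cast at this
      rw [h1] at this
      norm_num at this
    · exfalso
      have := congrArg (Complex.ofReal) h2
      push_cast at this
      rw [h1] at this
      norm_num at this
    · simp [h1, h2]

/-- The amplitudes of the modes that are odd in `x` and in `v₁`. -/
def oddAmplitude (k : ℕ) : Submodule ℝ ℂ :=
  if Even k ∧ 0 < k then LinearMap.ker Complex.reLm else ⊥

theorem conj_of_mem_oddAmplitude {k : ℕ} {c : ℂ} (hc : c ∈ oddAmplitude k) :
    (starRingEnd ℂ) c = -c ∧ (-1) ^ k * (starRingEnd ℂ) c = -c := by
  unfold oddAmplitude at hc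
  split_ifs at hc with h
  · have h1 : c.re = 0 := hc
    have h2 : (starRingEnd ℂ) c = -c := Complex.ext (by simp [h1]) (by simp)
    rw [h.1.neg_one_pow, one_mul, h2]
    exact ⟨rfl, rfl⟩
  · have h1 : c = 0 := hc
    simp [h1]

theorem oddAmplitude_ne_bot_iff (k : ℕ) : oddAmplitude k ≠ ⊥ ↔ Even k ∧ 0 < k := by
  unfold oddAmplitude
  constructor
  · intro h
    by_contra h1
    rw [if_neg h1] at h
    exact h rfl
  · intro h h1
    rw [if_pos h] at h1
    have h2 : Complex.I ∈ LinearMap.ker Complex.reLm := by simp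
    rw [h1] at h2
    exact Complex.I_ne_zero h2

/-- Both reflections conjugate amplitudes, the one in v₁ with an additional sign (-1)^k. Imaginary
amplitudes of even order therefore change sign under both. Order 0 is left out because its modes
with imaginary amplitude vanish. -/
theorem core_oddAmplitude_le : S.core oddAmplitude ≤ S.oddSubspace := by
  rintro g ⟨n, Ψ, hΨ, hg⟩
  have h1 : ∀ z, S.modeSum n Ψ (reflX z) = -S.modeSum n Ψ z := by
    intro z
    rw [modeSum, modeSum, ← Finset.sum_neg_distrib]
    refine Finset.sum_congr rfl fun k _ => ?_
    rw [mode_reflX k (hΨ k).1, mode, mode, (conj_of_mem_oddAmplitude ((hΨ k).2 _)).1, neg_mul,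
      Complex.neg_re]
  have h2 : ∀ z, S.modeSum n Ψ (reflV z) = -S.modeSum n Ψ z := by
    intro z
    rw [modeSum, modeSum, ← Finset.sum_neg_distrib]
    refine Finset.sum_congr rfl fun k _ => ?_
    rw [mode_reflV k (hΨ k).1, mode, mode, ← Complex.neg_re, ← neg_mul,
      ← (conj_of_mem_oddAmplitude ((hΨ k).2 (S.actions z))).2, ← Complex.re_ofReal_mul, mul_assoc]
    push_cast
    rfl
  filter_upwards [hg, S.ae_reflX hg, S.ae_reflV hg] with z h3 h4 h5
  rw [h3, h4, h5, h1, h2, neg_neg]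
  exact ⟨rfl, rfl⟩

theorem integral_mul_comp_of_odd {r : PlanarPhaseSpace ≃L[ℝ] PlanarPhaseSpace}
    (hr : S.IsReflection r) {g : S.Hilb} (hg : hr.pullback g = -g) (F : PlanarPhaseSpace → ℝ) :
    ∫ z, g z * F (r z) ∂S.weightMeasure = -∫ z, g z * F z ∂S.weightMeasure := by
  rw [← hr.integral_pullback_mul, hg, ← integral_neg]
  refine integral_congr_ae ?_
  filter_upwards [Lp.coeFn_neg g] with z hz
  rw [hz, Pi.neg_apply, neg_mul]

/-- Let I(Ψ) denote the integral against the mode of amplitude Ψ. The reflections give I(Ψ̄) = -I(Ψ)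
and (-1)^k I(Ψ̄) = -I(Ψ). For odd k this forces I(Ψ) = 0; for even k, 2 I(Ψ) = I(Ψ - Ψ̄), whose
amplitude is imaginary. -/
theorem integral_mode_eq_zero_of_odd {g : S.Hilb} (hg : g ∈ S.oddSubspace)
    (h : ∀ k Ψ, S.IsAction Ψ → (∀ p, Ψ p ∈ oddAmplitude k) →
      ∫ z, g z * S.mode k Ψ z ∂S.weightMeasure = 0) (k : ℕ) (Ψ : ℝ × ℝ × ℝ → ℂ)
    (hΨ : S.IsAction Ψ) : ∫ z, g z * S.mode k Ψ z ∂S.weightMeasure = 0 := by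
  rw [mem_oddSubspace_iff] at hg
  have hX := integral_mul_comp_of_odd S.isReflection_reflX hg.1 (S.mode k Ψ)
  have hV := integral_mul_comp_of_odd S.isReflection_reflV hg.2 (S.mode k Ψ)
  simp only [coe_reflXEquiv, coe_reflVEquiv, mode_reflX k hΨ, mode_reflV k hΨ] at hX hV
  simp only [mul_left_comm _ ((-1 : ℝ) ^ k), integral_const_mul, hX] at hV
  by_cases hk : Even k
  · have hi : ∀ {Φ : ℝ × ℝ × ℝ → ℂ}, S.IsAction Φ →
        Integrable (fun z => g z * S.mode k Φ z) S.weightMeasure := fun hΦ =>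
      S.integrable_mul_memLp g (S.memLp_test (S.isTest_mode k hΦ))
    have hΦ := hΨ.add (hΨ.conj.const_mul (-1))
    have h0 : ∫ z, g z * S.mode k (fun p => Ψ p + -1 * (starRingEnd ℂ) (Ψ p)) z
        ∂S.weightMeasure = 0 := by
      rcases Nat.eq_zero_or_pos k with rfl | hpos
      · refine integral_eq_zero_of_ae (Eventually.of_forall fun z => ?_)
        simp [mode]
      · refine h k _ hΦ fun p => ?_
        rw [oddAmplitude, if_pos ⟨hk, hpos⟩]
        simp
    have h1 : ∀ z, g z * S.mode k (fun p => Ψ p + -1 * (starRingEnd ℂ) (Ψ p)) z =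
        g z * S.mode k Ψ z - g z * S.mode k (fun p => (starRingEnd ℂ) (Ψ p)) z := by
      intro z
      simp only [mode, add_mul, Complex.add_re, neg_mul, one_mul, Complex.neg_re]
      ring
    simp only [h1] at h0
    rw [integral_sub (hi hΨ) (hi hΨ.conj), hX] at h0
    linarith
  · rw [(Nat.not_even_iff_odd.1 hk).neg_one_pow] at hV
    linarith

theorem isModePart_odd : S.IsModePart S.oddSubspace.subtypeₗᵢ oddAmplitude
    ((-S.transportSq).restrictTo S.oddSubspace) where
  mem_domain_iff := LinearPMap.mem_domain_restrictTo_iff S.transportSq_mem_oddSubspace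
  map_apply _ _ := rfl
  core_le g hg := ⟨⟨g, core_oddAmplitude_le hg⟩, rfl⟩
  total g hg := Subtype.ext (eq_zero_of_integral_mode_eq_zero
    (integral_mode_eq_zero_of_odd g.2 hg))
  amplitude k hk := by
    have hk' := (oddAmplitude_ne_bot_iff k).1 hk
    refine ⟨Complex.I, ?_, Complex.I_ne_zero, fun h => absurd h hk'.2.ne'⟩
    rw [oddAmplitude, if_pos hk']
    simp

/-! The Antonov operator. -/

theorem mem_antonov_domain_iff (g : S.Hilb) :
    g ∈ S.antonov.domain ↔ g ∈ (-S.transportSq).domain := by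
  change g ∈ (-S.transportSq).domain ⊓ S.response.domain ↔ _
  rw [S.response_domain, inf_top_eq]

theorem antonov_apply (g : S.antonov.domain) (h : (g : S.Hilb) ∈ (-S.transportSq).domain) :
    S.antonov g = (-S.transportSq) ⟨g, h⟩ - S.responseCLM g := rfl

theorem antonov_mem_oddSubspace (g : S.antonov.domain) (hg : (g : S.Hilb) ∈ S.oddSubspace) :
    S.antonov g ∈ S.oddSubspace := by
  have h := (mem_antonov_domain_iff (g : S.Hilb)).1 g.2
  rw [antonov_apply g h]
  exact S.oddSubspace.sub_mem (S.transportSq_mem_oddSubspace ⟨g, h⟩ hg)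
    (S.response_mem_oddSubspace hg)

theorem response_isRelativelyCompact : (-S.response).IsRelativelyCompact (-S.transportSq) := by
  refine ⟨fun g _ => S.mem_response_domain g, ?_, fun lam R hR => ?_⟩
  -- The bands are nonnegative, so -1 lies in the resolvent set.
  · obtain ⟨R, hR, -⟩ := S.isModePart_top.exists_isResolventAt (S.neg_one_notMem_bandSet _)
    exact ⟨-1, R, hR⟩
  · have h := S.isModePart_top.isCompactOperator_comp_resolvent (C := S.responseCLM) (s := 1)
      (fun g => (one_smul ℝ _).symm) hR
    exact ⟨-(S.responseCLM.comp R), h.neg, fun f => ⟨S.mem_response_domain _, rfl⟩⟩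

theorem essentialSpectrum_antonov : S.antonov.essentialSpectrum = S.bandSet fun _ => ⊤ :=
  S.isModePart_top.essentialSpectrum_eq (C := S.responseCLM) (s := 1)
    (fun _ => (one_smul ℝ _).symm) mem_antonov_domain_iff antonov_apply

/-- The case s = 0 of the general statement, without perturbation. -/
theorem essentialSpectrum_transportSq :
    (-S.transportSq).essentialSpectrum = S.bandSet fun _ => ⊤ :=
  S.isModePart_top.essentialSpectrum_eq (C := 0) (s := 0)
    (fun g => by rw [zero_smul]; rfl) (fun _ => Iff.rfl) fun g _ => (sub_zero _).symm

theorem essentialSpectrum_antonov_odd :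
    (S.antonov.restrictTo S.oddSubspace).essentialSpectrum = S.bandSet oddAmplitude := by
  refine isModePart_odd.essentialSpectrum_eq (s := 1)
    (C := (S.responseCLM.comp S.oddSubspace.subtypeL).codRestrict S.oddSubspace
      fun g => S.response_mem_oddSubspace g.2)
    (fun _ => (one_smul ℝ _).symm) (fun g => ?_) fun g h => Subtype.ext ?_
  · rw [LinearPMap.mem_domain_restrictTo_iff antonov_mem_oddSubspace,
      LinearPMap.mem_domain_restrictTo_iff S.transportSq_mem_oddSubspace, mem_antonov_domain_iff]
  · rfl

theorem bandSet_top : S.bandSet (fun _ => ⊤) =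
    {lam | ∃ k : ℕ, ∃ E ∈ Icc (S.U₀ 0) S.E₀, lam = (2 * Real.pi * k / S.period E) ^ 2} := by
  ext lam
  refine exists_congr fun k => ?_
  rw [and_iff_right top_ne_bot]
  refine exists_congr fun E => and_congr_right fun hE => ?_
  rw [S.freqSq_eq hE.1, ← mul_pow, mul_div_assoc', mul_comm (k : ℝ)]

/-- The admitted orders are the even numbers 2j with j ≥ 1, whence the doubled frequency. -/
theorem bandSet_oddAmplitude : S.bandSet oddAmplitude =
    {lam | ∃ k : ℕ, 1 ≤ k ∧ ∃ E ∈ Icc (S.U₀ 0) S.E₀,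
      lam = 4 * Real.pi ^ 2 * (2 * k / S.period E) ^ 2} := by
  have key : ∀ (j : ℕ) (E : ℝ), S.U₀ 0 ≤ E →
      ((j + j : ℕ) : ℝ) ^ 2 * S.freqSq E = 4 * Real.pi ^ 2 * (2 * j / S.period E) ^ 2 := by
    intro j E hE
    rw [S.freqSq_eq hE]
    push_cast
    ring
  ext lam
  constructor
  · rintro ⟨k, hk, E, hE, rfl⟩
    obtain ⟨⟨j, rfl⟩, hpos⟩ := (oddAmplitude_ne_bot_iff k).1 hk
    exact ⟨j, by omega, E, hE, key j E hE.1⟩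
  · rintro ⟨j, hj, E, hE, rfl⟩
    exact ⟨j + j, (oddAmplitude_ne_bot_iff _).2 ⟨⟨j, rfl⟩, by omega⟩, E, hE, (key j E hE.1).symm⟩

end PlanarSteadyState

end

theorem theorem5p14 (S : PlanarSteadyState) :
    S.response.domain = ⊤ ∧
    (-S.response).IsRelativelyCompact (-S.transportSq) ∧
    S.antonov.essentialSpectrum = (-S.transportSq).essentialSpectrum ∧
    S.antonov.essentialSpectrum =
      {lam | ∃ k : ℕ, ∃ E ∈ Set.Icc (S.U₀ 0) S.E₀, lam = (2 * Real.pi * k / S.period E) ^ 2} ∧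
    (∀ g : S.antonov.domain, (g : S.Hilb) ∈ S.oddSubspace → S.antonov g ∈ S.oddSubspace) ∧
    (S.antonov.restrictTo S.oddSubspace).essentialSpectrum =
      {lam | ∃ k : ℕ, 1 ≤ k ∧ ∃ E ∈ Set.Icc (S.U₀ 0) S.E₀,
        lam = 4 * Real.pi ^ 2 * (2 * k / S.period E) ^ 2} := by
  refine ⟨S.response_domain, PlanarSteadyState.response_isRelativelyCompact,
    PlanarSteadyState.essentialSpectrum_antonov.trans
      PlanarSteadyState.essentialSpectrum_transportSq.symm,
    PlanarSteadyState.essentialSpectrum_antonov.trans PlanarSteadyState.bandSet_top,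
    PlanarSteadyState.antonov_mem_oddSubspace, ?_⟩
  exact PlanarSteadyState.essentialSpectrum_antonov_odd.trans
    PlanarSteadyState.bandSet_oddAmplitude
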